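/- Let $q\equiv 13\pmod{24}$ be a prime power, $\widehat G=\mathrm{SL}_2(\mathbb F_q)$, $m=\frac{q-1}{2}$, and let $\mathbb G=\mathbf U(m)$. Let $X$ be a connected $\widehat G$-graph whose vertex orbits are represented by $v_0,v_1,v_2,v_3$ and whose edge orbits are represented by $\eta_0,\eta_1,\eta_2,\eta_3$, with $$v_0\xrightarrow{\eta_0}v_1,\qquad v_1\xrightarrow{\eta_1}v_2,\qquad v_1\xrightarrow{\eta_2}v_3,\qquad v_3\xrightarrow{\eta_3}g_{\eta_3}v_0 ,\qquad g_{\eta_3}\in\widehat G,$$ where the stabilizers of $v_0,v_1,v_2,v_3$ are a Borel subgroup $B$ and groups isomorphic to the dicyclic groups $2D_{q-1}$, $2D_{q+1}$ (of orders $2(q-1)$, $2(q+1)$) and $\mathrm{SL}_2(3)$, and the stabilizers of $\eta_0,\eta_1,\eta_2,\eta_3$ are isomorphic to $C_{q-1},C_4,Q_8,C_6$. (The graph $X_1^{OS}$ of Oliver and Segev is of this kind.) Put $g_{\eta_0}=g_{\eta_1}=g_{\eta_2}=1$, and let $\Gamma_0$ be the group generated by the groups $\widehat G_{v_i}$ and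 letters $x_{\eta_0},\dots,x_{\eta_3}$, subject to the relations of the groups $\widehat G_{v_i}$, to $x_{\eta_0}=x_{\eta_1}=x_{\eta_2}=1$, and to $x_\eta^{-1}hx_\eta=g_\eta^{-1}hg_\eta$ for each $\eta=\eta_e$ and $h\in\widehat G_{\eta}$, where, if $\eta$ goes from $v_i$ to $g_\eta v_j$, the letter $h$ is read in $\widehat G_{v_i}$ and $g_\eta^{-1}hg_\eta$ in $\widehat G_{v_j}$. Let $\rho_0\colon\widehat G\to\mathbb G$ be an irreducible unitary representation of degree $m$, and write $\mathbf C_K=\mathbf C_{\mathbb G}(\rho_0(K))$. Let $\mathcal M_0=\prod_{e=0}^{3}\mathbf C_{\widehat G_{\eta_e}}$ and $\mathcal H=\mathbf C_{\widehat G_{v_1}}\times\mathbf C_{\widehat G_{v_2}}\times\mathbf C_{\widehat G_{v_3}}$, which acts on $\mathcal M_0$ on the right by $$(\tau_0,\tau_1,\tau_2,\tau_3)\cdot(\alpha_1,\alpha_2,\alpha_3)=(\alpha_1^{-1}\tau_0,\ \alpha_2^{-1}\tau_1\alpha_1,\ \alpha_3^{-1}\tau_2\alpha_1,\ \tau_3\alpha_3),$$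 and let $\overline{\mathcal M}_0=\mathcal M_0/\mathcal H$. For $\tau\in\mathcal M_0$ put $\tau_{v_0}=1$, $\tau_{v_1}=\tau_0$, $\tau_{v_2}=\tau_1\tau_0$, $\tau_{v_3}=\tau_2\tau_0$, and let $\rho_\tau\colon\Gamma_0\to\mathbb G$ be the homomorphism with $\rho_\tau(h)=\tau_{v_i}^{-1}\rho_0(h)\tau_{v_i}$ for $h\in\widehat G_{v_i}$ and $\rho_\tau(x_{\eta_e})=\tau_{v_i}^{-1}\tau_e^{-1}\rho_0(g_{\eta_e})\tau_{v_j}$ if $\eta_e$ goes from $v_i$ to $g_{\eta_e}v_j$. Let $Y_0(\tau)=\rho_\tau(x_{\eta_3})=\tau_0^{-1}\tau_2^{-1}\tau_3^{-1}\rho_0(g_{\eta_3})$. This map is constant on $\mathcal H$-orbits; let $\overline Y_0\colon\overline{\mathcal M}_0\to\mathbb G$ be the induced map. Then: (1) $\overline{\mathcal M}_0$ is an orientable smooth manifold of dimension $\dim\mathbb G$ (with the smooth structure for which $\mathcal M_0\to\overline{\mathcal M}_0$ is a smooth submersion), $\overline Y_0$ is smooth, and for all orientations of $\overline{\mathcal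 M}_0$ and $\mathbb G$ the degree of $\overline Y_0$ is $0$. (The degree is the number of preimages of a regular value, each counted with the sign of the differential of $\overline Y_0$.) (2) Let $M=\mathbf C_{\widehat G_{\eta_0}}\times\mathbf C_{\widehat G_{\eta_2}}\times\mathbf C_{\widehat G_{\eta_3}}$ and let $H=\mathbf C_{\widehat G_{v_1}}\times\mathbf C_{\widehat G_{v_3}}$ act on it on the right by $(\tau_0,\tau_2,\tau_3)\cdot(\alpha_1,\alpha_3)=(\alpha_1^{-1}\tau_0,\alpha_3^{-1}\tau_2\alpha_1,\tau_3\alpha_3)$. Then $M/H$ is a smooth manifold (with $M\to M/H$ a smooth submersion) of dimension $$\dim\mathbb G-\frac{(q-1)^2}{8}+\frac{q-1}{4}<\dim\mathbb G ,$$ the map $M/H\to\mathbb G$ induced by $(\tau_0,\tau_2,\tau_3)\mapsto\tau_0^{-1}\tau_2^{-1}\tau_3^{-1}\rho_0(g_{\eta_3})$ is smooth, and its image is the image of $\overline Y_0$. (3) $\overline Y_0$ is not surjective. -/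

import Mathlib

open scoped Manifold ContDiff MatrixGroups

noncomputable section

namespace OliverSegev

/-! ### Graphs with a group action -/

/-- A `G`-graph (a one-dimensional `G`-complex) with vertices `V` and edges `E`: every edge is
oriented, from `org e` to `ter e`, and `G` acts preserving incidence and orientation. -/
structure GGraph (G V E : Type*) [Group G] [MulAction G V] [MulAction G E] where
  org : E → V
  ter : E → V
  org_smul : ∀ (a : G) (e : E), org (a • e) = a • org e
  ter_smul : ∀ (a : G) (e : E), ter (a • e) = a • ter e

/-- The graph is connected. -/
def GGraph.Connected {G V E : Type*} [Group G] [MulAction G V] [MulAction G E]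
    (X : GGraph G V E) : Prop :=
  Nonempty V ∧ ∀ x y : V, Relation.EqvGen (fun a b => ∃ e, X.org e = a ∧ X.ter e = b) x y

/-- A Borel subgroup of `SL₂(F)`: a conjugate of the group of upper triangular matrices. -/
def IsBorel {F : Type*} [Field F] (K : Subgroup SL(2, F)) : Prop :=
  ∃ a : SL(2, F), ∀ b : SL(2, F), b ∈ K ↔ (a * b * a⁻¹) 1 0 = 0

/-- The index of the origin of the edge `η₀, η₁, η₂, η₃`. -/
def src : Fin 4 → Fin 4 := ![0, 1, 1, 3]

/-- The index of the representative of the orbit of the end of the edge `η₀, η₁, η₂, η₃`. -/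
def tgt : Fin 4 → Fin 4 := ![1, 2, 3, 0]

/-- The `SL₂(F)`-graph `X₁^{OS}`, where `F` has `q ≡ 13 (mod 24)` elements, together with the
choices needed for Brown's presentation: representatives `v₀, v₁, v₂, v₃` of the orbits of
vertices, representatives `η₀, η₁, η₂, η₃` of the orbits of edges, with
`v₀ -η₀→ v₁`, `v₁ -η₁→ v₂`, `v₁ -η₂→ v₃`, `v₃ -η₃→ g_{η₃} v₀`, the maximal tree
`T = {η₀, η₁, η₂}`, and the stabilizers
`B`, `2D_{q-1}`, `2D_{q+1}`, `SL₂(3)` of the vertices and `C_{q-1}`, `C₄`, `Q₈`, `C₆` of the edges.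
(`QuaternionGroup n` is the dicyclic group of order `4 n`; so `2D_{2n} = QuaternionGroup n`.) -/
structure OSGraph (F V E : Type*) [Field F] [MulAction SL(2, F) V] [MulAction SL(2, F) E]
    extends GGraph SL(2, F) V E where
  connected : toGGraph.Connected
  v : Fin 4 → V
  η : Fin 4 → E
  v_repr : ∀ x : V, ∃! i, x ∈ MulAction.orbit SL(2, F) (v i)
  η_repr : ∀ x : E, ∃! i, x ∈ MulAction.orbit SL(2, F) (η i)
  g : Fin 4 → SL(2, F)
  g_tree : ∀ e, e ≠ 3 → g e = 1
  org_η : ∀ e, org (η e) = v (src e)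
  ter_η : ∀ e, ter (η e) = g e • v (tgt e)
  stab_v₀ : IsBorel (MulAction.stabilizer SL(2, F) (v 0))
  stab_v₁ : Nonempty (MulAction.stabilizer SL(2, F) (v 1) ≃* QuaternionGroup ((Nat.card F - 1) / 2))
  stab_v₂ : Nonempty (MulAction.stabilizer SL(2, F) (v 2) ≃* QuaternionGroup ((Nat.card F + 1) / 2))
  stab_v₃ : Nonempty (MulAction.stabilizer SL(2, F) (v 3) ≃* SL(2, ZMod 3))
  stab_η₀ : Nonempty
    (MulAction.stabilizer SL(2, F) (η 0) ≃* Multiplicative (ZMod (Nat.card F - 1)))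
  stab_η₁ : Nonempty (MulAction.stabilizer SL(2, F) (η 1) ≃* Multiplicative (ZMod 4))
  stab_η₂ : Nonempty (MulAction.stabilizer SL(2, F) (η 2) ≃* QuaternionGroup 2)
  stab_η₃ : Nonempty (MulAction.stabilizer SL(2, F) (η 3) ≃* Multiplicative (ZMod 6))

/-! ### Unitary groups and unitary representations -/

/-- The unitary group `U(m)`. -/
abbrev U (m : ℕ) := Matrix.unitaryGroup (Fin m) ℂ

/-- The Lie algebra `𝔲(m)` of skew-Hermitian matrices, a real vector space. -/
abbrev LieU (m : ℕ) : Submodule ℝ (Matrix (Fin m) (Fin m) ℂ) :=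
  skewAdjoint.submodule ℝ (Matrix (Fin m) (Fin m) ℂ)

/-- The dimension of the Lie group `U(m)`. -/
def dimU (m : ℕ) : ℕ := Module.finrank ℝ (LieU m)

/-- `U(m)` as a subset of the normed space of complex `m × m` arrays. -/
def U.coords {m : ℕ} (A : U m) : Fin m → Fin m → ℂ := fun j k => (A : Matrix _ _ ℂ) j k

/-- The linear representation on `ℂ^m` given by a homomorphism to `U(m)`. -/
def linearRep {G : Type*} [Group G] {m : ℕ} (ρ : G →* U m) : Representation ℂ G (Fin m → ℂ) :=
  ((Matrix.toLinAlgEquiv' (R := ℂ) (n := Fin m) :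
      Matrix (Fin m) (Fin m) ℂ →* Module.End ℂ (Fin m → ℂ)).comp
    (Matrix.unitaryGroup (Fin m) ℂ).subtype).comp ρ

/-! ### Brown's group, and the moduli of representations -/

section Moduli

variable {F V E : Type*} [Field F] [MulAction SL(2, F) V] [MulAction SL(2, F) E]
variable (X : OSGraph F V E)

/-- The stabilizer of the vertex `v i`. -/
abbrev OSGraph.Gv (i : Fin 4) : Subgroup SL(2, F) := MulAction.stabilizer SL(2, F) (X.v i)

/-- The stabilizer of the edge `η e`. -/
abbrev OSGraph.Gη (e : Fin 4) : Subgroup SL(2, F) := MulAction.stabilizer SL(2, F) (X.η e)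

theorem OSGraph.mem_src {e : Fin 4} {h : SL(2, F)} (hh : h ∈ X.Gη e) : h ∈ X.Gv (src e) := by
  rw [MulAction.mem_stabilizer_iff] at hh ⊢
  rw [← X.org_η, ← X.org_smul, hh]

theorem OSGraph.mem_tgt {e : Fin 4} {h : SL(2, F)} (hh : h ∈ X.Gη e) :
    (X.g e)⁻¹ * h * X.g e ∈ X.Gv (tgt e) := by
  rw [MulAction.mem_stabilizer_iff] at hh ⊢
  rw [mul_smul, mul_smul, ← X.ter_η, ← X.ter_smul, hh, X.ter_η, inv_smul_smul]

/-- The generators of Brown's group: the elements of the groups `G_{v i}` and the letters `x_e`. -/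
abbrev OSGraph.Gen := (Σ i : Fin 4, X.Gv i) ⊕ Fin 4

/-- The relations of Brown's group: those of the groups `G_{v i}`, the relations `x_e = 1` for `e`
in the tree, and `x_e⁻¹ h x_e = g_e⁻¹ h g_e` for `h ∈ G_e`, where the `h` on the left is in
`G_{v (src e)}` and the right-hand side is in `G_{v (tgt e)}`. -/
inductive OSGraph.Rel : FreeGroup X.Gen → Prop
  | mul (i : Fin 4) (a b : X.Gv i) : OSGraph.Rel
      (FreeGroup.of (Sum.inl ⟨i, a⟩) * FreeGroup.of (Sum.inl ⟨i, b⟩) *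
        (FreeGroup.of (Sum.inl ⟨i, a * b⟩))⁻¹)
  | tree (e : Fin 4) (he : e ≠ 3) : OSGraph.Rel (FreeGroup.of (Sum.inr e))
  | edge (e : Fin 4) (h : SL(2, F)) (hh : h ∈ X.Gη e) : OSGraph.Rel
      ((FreeGroup.of (Sum.inr e))⁻¹ * FreeGroup.of (Sum.inl ⟨src e, ⟨h, X.mem_src hh⟩⟩) *
        FreeGroup.of (Sum.inr e) *
        (FreeGroup.of (Sum.inl ⟨tgt e, ⟨(X.g e)⁻¹ * h * X.g e, X.mem_tgt hh⟩⟩))⁻¹)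

/-- Brown's group `Γ₀` for the action of `SL₂(F)` on the graph. -/
abbrev OSGraph.Brown := PresentedGroup {r | X.Rel r}

/-- The element `y₀ = x_{η₃}` of `Γ₀`, given by the edge outside the tree. -/
def OSGraph.y₀ : X.Brown := PresentedGroup.of (Sum.inr 3)

variable {m : ℕ} (ρ : SL(2, F) →* U m)

/-- The centralizer of `ρ(G_{v i})` in `U(m)`. -/
abbrev OSGraph.Cv (i : Fin 4) : Subgroup (U m) := Subgroup.centralizer (ρ '' (X.Gv i : Set SL(2, F)))

/-- The centralizer of `ρ(G_{η e})` in `U(m)`. -/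
abbrev OSGraph.Cη (e : Fin 4) : Subgroup (U m) := Subgroup.centralizer (ρ '' (X.Gη e : Set SL(2, F)))

theorem OSGraph.comm_Cη {e : Fin 4} (t : X.Cη ρ e) {h : SL(2, F)} (hh : h ∈ X.Gη e) :
    ρ h * (t : U m) = t * ρ h :=
  Subgroup.mem_centralizer_iff.1 t.2 _ ⟨h, hh, rfl⟩

theorem OSGraph.Cv_src_le (e : Fin 4) : X.Cv ρ (src e) ≤ X.Cη ρ e :=
  Subgroup.centralizer_le (Set.image_mono fun _ hh => X.mem_src hh)

theorem OSGraph.conj_Cv_tgt {e : Fin 4} {a : U m} (ha : a ∈ X.Cv ρ (tgt e)) :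
    ρ (X.g e) * a * (ρ (X.g e))⁻¹ ∈ X.Cη ρ e := by
  rw [Subgroup.mem_centralizer_iff]
  rintro _ ⟨h, hh, rfl⟩
  have h1 := Subgroup.mem_centralizer_iff.1 ha _ ⟨_, X.mem_tgt hh, rfl⟩
  simp only [map_mul, map_inv] at h1
  calc ρ h * (ρ (X.g e) * a * (ρ (X.g e))⁻¹)
      = ρ (X.g e) * (((ρ (X.g e))⁻¹ * ρ h * ρ (X.g e)) * a) * (ρ (X.g e))⁻¹ := by group
    _ = ρ (X.g e) * a * (ρ (X.g e))⁻¹ * ρ h := by rw [h1]; group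

/-- The space of tuples `τ` with an entry in the centralizer of `ρ(G_{η (ε i)})` for each `i : ι`,
where `ε` lists some of the edges `η₀, …, η₃`. -/
@[ext] structure OSGraph.Moduli {ι : Type} (ε : ι → Fin 4) : Type where
  entry : ∀ i : ι, X.Cη ρ (ε i)

/-- The topology of `Moduli` is the product topology. -/
instance {ι : Type} (ε : ι → Fin 4) : TopologicalSpace (X.Moduli ρ ε) :=
  TopologicalSpace.induced OSGraph.Moduli.entry inferInstance

/-- The product of the groups `C_{U(m)}(ρ(G_{v i}))` over the `i` outside `S`, written as the group
of tuples that are trivial on `S`. -/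
def OSGraph.Gauge (S : Set (Fin 4)) : Subgroup (∀ i, X.Cv ρ i) where
  carrier := {α | ∀ i ∈ S, α i = 1}
  one_mem' := fun _ _ => rfl
  mul_mem' := fun ha hb i hi => by simp [ha i hi, hb i hi]
  inv_mem' := fun ha i hi => by simp [ha i hi]

/-- The right action
`(τ · α)_e = ρ(g_e) α_{tgt e}⁻¹ ρ(g_e)⁻¹ τ_e α_{src e}`
as an action of the opposite group. -/
instance {ι : Type} (ε : ι → Fin 4) (S : Set (Fin 4)) :
    MulAction (X.Gauge ρ S)ᵐᵒᵖ (X.Moduli ρ ε) where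
  smul α τ := ⟨fun i =>
    ⟨ρ (X.g (ε i)) * (α.unop.1 (tgt (ε i)) : U m)⁻¹ * (ρ (X.g (ε i)))⁻¹ * (τ.entry i : U m) *
        (α.unop.1 (src (ε i)) : U m),
      mul_mem (mul_mem (X.conj_Cv_tgt ρ (inv_mem (α.unop.1 (tgt (ε i))).2)) (τ.entry i).2)
        (X.Cv_src_le ρ _ (α.unop.1 (src (ε i))).2)⟩⟩
  one_smul τ := by
    apply OSGraph.Moduli.ext
    funext i
    apply Subtype.ext
    change ρ (X.g (ε i)) * (1 : U m)⁻¹ * (ρ (X.g (ε i)))⁻¹ * (τ.entry i : U m) * (1 : U m) = τ.entry i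
    group
  mul_smul α β τ := by
    apply OSGraph.Moduli.ext
    funext i
    apply Subtype.ext
    change ρ (X.g (ε i)) * ((β.unop.1 (tgt (ε i)) : U m) * (α.unop.1 (tgt (ε i)) : U m))⁻¹ *
        (ρ (X.g (ε i)))⁻¹ * (τ.entry i : U m) *
        ((β.unop.1 (src (ε i)) : U m) * (α.unop.1 (src (ε i)) : U m)) =
      ρ (X.g (ε i)) * (α.unop.1 (tgt (ε i)) : U m)⁻¹ * (ρ (X.g (ε i)))⁻¹ *
        (ρ (X.g (ε i)) * (β.unop.1 (tgt (ε i)) : U m)⁻¹ * (ρ (X.g (ε i)))⁻¹ * (τ.entry i : U m) *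
        (β.unop.1 (src (ε i)) : U m)) * (α.unop.1 (src (ε i)) : U m)
    group

theorem OSGraph.smul_apply {ι : Type} {ε : ι → Fin 4} {S : Set (Fin 4)}
    (α : (X.Gauge ρ S)ᵐᵒᵖ) (τ : X.Moduli ρ ε) (i : ι) :
    ((α • τ).entry i : U m) = ρ (X.g (ε i)) * (α.unop.1 (tgt (ε i)) : U m)⁻¹ * (ρ (X.g (ε i)))⁻¹ *
      (τ.entry i : U m) * (α.unop.1 (src (ε i)) : U m) := rfl

/-- The orbit space, with the quotient topology. -/
abbrev OSGraph.OrbitSpace {ι : Type} (ε : ι → Fin 4) (S : Set (Fin 4)) : Type :=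
  Quotient (MulAction.orbitRel (X.Gauge ρ S)ᵐᵒᵖ (X.Moduli ρ ε))

/-- The projection to the orbit space. -/
def OSGraph.proj {ι : Type} (ε : ι → Fin 4) (S : Set (Fin 4)) (τ : X.Moduli ρ ε) :
    X.OrbitSpace ρ ε S := Quotient.mk _ τ

/-- The inclusion of a space of tuples of unitary matrices in the real normed space of tuples of
complex `m × m` arrays, in which it is an embedded submanifold. -/
def OSGraph.coords {ι : Type} (ε : ι → Fin 4) (τ : X.Moduli ρ ε) : ι → Fin m → Fin m → ℂ :=
  fun i => U.coords (τ.entry i : U m)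

/-- The moduli `𝓜₀`, the product of the centralizers of `ρ(G_{η₀}), …, ρ(G_{η₃})`. -/
abbrev OSGraph.M₀ : Type := X.Moduli ρ (id : Fin 4 → Fin 4)

/-- The quotient of `𝓜₀` by `𝓗 = C(ρ(G_{v₁})) × C(ρ(G_{v₂})) × C(ρ(G_{v₃}))`. -/
abbrev OSGraph.M₀bar : Type := X.OrbitSpace ρ (id : Fin 4 → Fin 4) {0}

/-- The list of edges `η₀, η₂, η₃`. -/
def edges023 : Fin 3 → Fin 4 := ![0, 2, 3]

/-- The quotient `M/H` where `M` is the product of the centralizers of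
`ρ(G_{η₀}), ρ(G_{η₂}), ρ(G_{η₃})` and `H = C(ρ(G_{v₁})) × C(ρ(G_{v₃}))`, acting by
`(τ₀, τ₂, τ₃) · (α₁, α₃) = (α₁⁻¹ τ₀, α₃⁻¹ τ₂ α₁, τ₃ α₃)`. -/
abbrev OSGraph.MmodH : Type := X.OrbitSpace ρ edges023 {0, 2}

variable {ρ}

/-- For `τ ∈ 𝓜₀`, the product of the entries of `τ` along the path in the tree from `v₀` to
`v i`. -/
def OSGraph.pathProd (τ : X.M₀ ρ) : Fin 4 → U m :=
  ![1, τ.entry 0, (τ.entry 1 : U m) * (τ.entry 0 : U m), (τ.entry 2 : U m) * (τ.entry 0 : U m)]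

/-- The representation `ρ_τ` on the generators of `Γ₀`. -/
def OSGraph.genMap (τ : X.M₀ ρ) : X.Gen → U m
  | Sum.inl ⟨i, a⟩ => (X.pathProd τ i)⁻¹ * ρ a * X.pathProd τ i
  | Sum.inr e => (X.pathProd τ (src e))⁻¹ * (τ.entry e : U m)⁻¹ * ρ (X.g e) * X.pathProd τ (tgt e)

theorem OSGraph.lift_rel (τ : X.M₀ ρ) (r : FreeGroup X.Gen) (hr : r ∈ {r | X.Rel r}) :
    FreeGroup.lift (X.genMap τ) r = 1 := by
  cases hr with
  | mul i a b =>
    simp only [map_mul, map_inv, FreeGroup.lift_apply_of, OSGraph.genMap, Subgroup.coe_mul]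
    group
  | tree e he =>
    have hg : ρ (X.g e) = 1 := by rw [X.g_tree e he, map_one]
    have ht : X.pathProd τ (tgt e) = (τ.entry e : U m) * X.pathProd τ (src e) := by
      fin_cases e
      · exact (mul_one _).symm
      · rfl
      · rfl
      · exact absurd rfl he
    simp only [FreeGroup.lift_apply_of, OSGraph.genMap, hg, ht]
    group
  | edge e h hh =>
    have hc : ρ h * (τ.entry e : U m) = τ.entry e * ρ h := X.comm_Cη ρ (τ.entry e) hh
    have hc' : (τ.entry e : U m) * ρ h * (τ.entry e : U m)⁻¹ = ρ h := by rw [← hc]; group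
    simp only [map_mul, map_inv, FreeGroup.lift_apply_of, OSGraph.genMap]
    generalize X.pathProd τ (src e) = a, X.pathProd τ (tgt e) = b
    calc (a⁻¹ * (τ.entry e : U m)⁻¹ * ρ (X.g e) * b)⁻¹ * (a⁻¹ * ρ h * a) *
          (a⁻¹ * (τ.entry e : U m)⁻¹ * ρ (X.g e) * b) *
          (b⁻¹ * ((ρ (X.g e))⁻¹ * ρ h * ρ (X.g e)) * b)⁻¹
        = b⁻¹ * (ρ (X.g e))⁻¹ * ((τ.entry e : U m) * ρ h * (τ.entry e : U m)⁻¹) * (ρ h)⁻¹ * ρ (X.g e) * b := by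
          group
      _ = 1 := by rw [hc']; group

/-- The representation `ρ_τ : Γ₀ → U(m)` given by `τ ∈ 𝓜₀`. -/
def OSGraph.repr (τ : X.M₀ ρ) : X.Brown →* U m := PresentedGroup.toGroup (X.lift_rel τ)

/-- The map `Y₀ : 𝓜₀ → U(m)`, `Y₀(τ) = ρ_τ(y₀)`. -/
def OSGraph.Y₀ (τ : X.M₀ ρ) : U m := X.repr τ X.y₀

theorem OSGraph.Y₀_eq (τ : X.M₀ ρ) :
    X.Y₀ τ = (τ.entry 0 : U m)⁻¹ * (τ.entry 2 : U m)⁻¹ * (τ.entry 3 : U m)⁻¹ * ρ (X.g 3) := by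
  have h : X.Y₀ τ = X.genMap τ (Sum.inr 3) := PresentedGroup.toGroup.of _
  rw [h]
  change ((τ.entry 2 : U m) * (τ.entry 0 : U m))⁻¹ * (τ.entry 3 : U m)⁻¹ * ρ (X.g 3) * 1 = _
  group

theorem OSGraph.prod_invariant (S : Set (Fin 4)) (h0 : (0 : Fin 4) ∈ S) {ι : Type} (ε : ι → Fin 4)
    (i j k : ι) (hi : ε i = 0) (hj : ε j = 2) (hk : ε k = 3) (α : (X.Gauge ρ S)ᵐᵒᵖ)
    (τ : X.Moduli ρ ε) :
    ((α • τ).entry i : U m)⁻¹ * ((α • τ).entry j : U m)⁻¹ * ((α • τ).entry k : U m)⁻¹ * ρ (X.g 3) =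
      (τ.entry i : U m)⁻¹ * (τ.entry j : U m)⁻¹ * (τ.entry k : U m)⁻¹ * ρ (X.g 3) := by
  have hg0 : ρ (X.g 0) = 1 := by rw [X.g_tree 0 (by decide), map_one]
  have hg2 : ρ (X.g 2) = 1 := by rw [X.g_tree 2 (by decide), map_one]
  have ha : (α.unop.1 0 : U m) = 1 := by rw [α.unop.2 0 h0]; rfl
  rw [X.smul_apply, X.smul_apply, X.smul_apply]
  generalize (τ.entry i : U m) = a, (τ.entry j : U m) = b, (τ.entry k : U m) = c
  rw [hi, hj, hk, hg0, hg2,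
    show src 0 = 0 from rfl, show src 2 = 1 from rfl, show src 3 = 3 from rfl,
    show tgt 0 = 1 from rfl, show tgt 2 = 3 from rfl, show tgt 3 = 0 from rfl, ha]
  group

variable (ρ)

/-- The map `Ȳ₀` on the quotient of `𝓜₀` induced by `Y₀`. -/
def OSGraph.Y₀bar : X.M₀bar ρ → U m :=
  Quotient.lift X.Y₀ (by
    rintro a b ⟨α, rfl⟩
    change X.Y₀ (α • b) = X.Y₀ b
    rw [X.Y₀_eq, X.Y₀_eq]
    exact X.prod_invariant {0} rfl id 0 2 3 rfl rfl rfl α b)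

/-- The map `M/H → U(m)` induced by `(τ₀, τ₂, τ₃) ↦ τ₀⁻¹ τ₂⁻¹ τ₃⁻¹ ρ(g_{η₃})`. -/
def OSGraph.Tbar : X.MmodH ρ → U m :=
  Quotient.lift
    (fun τ : X.Moduli ρ edges023 =>
      (τ.entry 0 : U m)⁻¹ * (τ.entry 1 : U m)⁻¹ * (τ.entry 2 : U m)⁻¹ * ρ (X.g 3)) (by
    rintro a b ⟨α, rfl⟩
    exact X.prod_invariant {0, 2} (Or.inl rfl) edges023 0 1 2 rfl rfl rfl α b)

end Moduli

/-! ### Quotient manifolds, orientations and the degree -/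

section Manifolds

/-- Let `S` be an embedded submanifold of a normed space `W`, with inclusion `c : S → W`, and let
`π : S → Q` be the projection to an orbit space. The given charts make `Q` a quotient manifold:
a smooth (Hausdorff, second countable) `n`-manifold such that `π` is smooth (locally on `S`, the
map `π` extends to a smooth map on an open subset of `W`) and is a submersion (through every point
of `S` there is a smooth local section of `π`). The smooth structure on `Q` is determined by this. -/
structure IsQuotientManifold {S Q W : Type*} [NormedAddCommGroup W] [NormedSpace ℝ W]
    (c : S → W) (π : S → Q) (n : ℕ) [TopologicalSpace Q]
    [ChartedSpace (EuclideanSpace ℝ (Fin n)) Q] : Prop where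
  t2Space : T2Space Q
  secondCountable : SecondCountableTopology Q
  isManifold : IsManifold (𝓡 n) ∞ Q
  smooth_proj : ∀ x : S, ∃ O : Set W, IsOpen O ∧ c x ∈ O ∧ ∃ f : W → Q,
    ContMDiffOn 𝓘(ℝ, W) (𝓡 n) ∞ f O ∧ ∀ y : S, c y ∈ O → f (c y) = π y
  smooth_section : ∀ x : S, ∃ O : Set Q, IsOpen O ∧ π x ∈ O ∧ ∃ s : Q → S,
    s (π x) = x ∧ (∀ p ∈ O, π (s p) = p) ∧
    ContMDiffOn (𝓡 n) 𝓘(ℝ, W) ∞ (fun p => c (s p)) O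

variable {n m : ℕ} {Q : Type*} [TopologicalSpace Q]

/-- A map to `U(m)` is smooth if it is smooth as a matrix valued map. -/
def SmoothToU (n : ℕ) {m : ℕ} {Q : Type*} [TopologicalSpace Q]
    [ChartedSpace (EuclideanSpace ℝ (Fin n)) Q] (f : Q → U m) : Prop :=
  ContMDiff (𝓡 n) 𝓘(ℝ, Fin m → Fin m → ℂ) ∞ (fun p => U.coords (f p))

/-- An oriented atlas of the smooth manifold `Q`: compatible charts that cover `Q`, with transition
maps of positive Jacobian. Such an atlas defines an orientation of `Q`. -/
structure IsOrientedAtlas [ChartedSpace (EuclideanSpace ℝ (Fin n)) Q]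
    (A : Set (OpenPartialHomeomorph Q (EuclideanSpace ℝ (Fin n)))) : Prop where
  subset : A ⊆ IsManifold.maximalAtlas (𝓡 n) ∞ Q
  cover : ∀ p : Q, ∃ φ ∈ A, p ∈ φ.source
  det_pos : ∀ φ ∈ A, ∀ ψ ∈ A, ∀ p ∈ φ.source ∩ ψ.source,
    0 < (fderiv ℝ (fun x => ψ (φ.symm x)) (φ p)).det

/-- In the chart `φ` at `p`, the differential of `f : Q → U(m)` at `p` is the linear isomorphism
`v ↦ f(p) L(v)` onto the tangent space `f(p) 𝔲(m)` of `U(m)` at `f(p)`. -/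
def HasDerivIso (f : Q → U m) (φ : OpenPartialHomeomorph Q (EuclideanSpace ℝ (Fin n))) (p : Q)
    (L : EuclideanSpace ℝ (Fin n) ≃ₗ[ℝ] LieU m) : Prop :=
  ∀ v, fderiv ℝ (fun x => U.coords (f (φ.symm x))) (φ p) v =
    fun j k => ((f p : Matrix (Fin m) (Fin m) ℂ) * (L v : Matrix (Fin m) (Fin m) ℂ)) j k

variable (A : Set (OpenPartialHomeomorph Q (EuclideanSpace ℝ (Fin n))))

/-- `p` is a regular point of `f`. -/
def IsRegularPoint (f : Q → U m) (p : Q) : Prop :=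
  ∃ φ ∈ A, p ∈ φ.source ∧ ∃ L, HasDerivIso f φ p L

/-- `y` is a regular value of `f`. -/
def IsRegularValue (f : Q → U m) (y : U m) : Prop :=
  ∀ p, f p = y → IsRegularPoint A f p

/-- `p` is a regular point of `f` at which `f` preserves orientations, when `Q` is oriented by the
atlas `A` and `U(m)` by the left translates of the orientation `o` of `𝔲(m)`. -/
def PreservesOrientationAt (o : Orientation ℝ (LieU m) (Fin n)) (f : Q → U m) (p : Q) : Prop :=
  ∃ φ ∈ A, p ∈ φ.source ∧ ∃ L, HasDerivIso f φ p L ∧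
    Orientation.map (Fin n) L (EuclideanSpace.basisFun (Fin n) ℝ).toBasis.orientation = o

open Classical in
/-- The sign of the differential of `f` at a regular point `p`. -/
def localSign (o : Orientation ℝ (LieU m) (Fin n)) (f : Q → U m) (p : Q) : ℤ :=
  if PreservesOrientationAt A o f p then 1 else -1

/-- The smooth map `f : Q → U(m)` of oriented manifolds of the same dimension, with `Q` compact,
has degree `d`: there are regular values, and each regular value has finitely many preimages,
which number `d` when counted with the sign of the differential of `f`. -/
def HasDegree (o : Orientation ℝ (LieU m) (Fin n)) (f : Q → U m) (d : ℤ) : Prop :=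
  (∃ y, IsRegularValue A f y) ∧
  ∀ y, IsRegularValue A f y →
    (f ⁻¹' {y}).Finite ∧ ∑ᶠ p ∈ f ⁻¹' {y}, localSign A o f p = d

end Manifolds

end OliverSegev

end

/-! The entry `τ₁` does not occur in `Y₀`, and the gauge factor at `v₂` moves no other entry. So
`Ȳ₀` factors through `M/H` and has the same image as `Tbar`. Everything then follows from
dimensions: `𝓜₀/𝓗` has the dimension of `U(m)`, and `M/H` is smaller by `dim C(G_{η₁}) - dim
C(G_{v₂}) = (q-1)²/8 - (q-1)/4 > 0`. Hence the differential of `Ȳ₀` is nowhere an isomorphism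
(`OSGraph.not_isRegularPoint`), and the image has Hausdorff dimension less than `dim U(m)`
(`SmoothToU.not_surjective`). The regular values are exactly the points outside the image, and the
degree is an empty sum.

Dimensions. The centralizer of `ρ(K)` has as dimension the mean of `|χ|²` over `K`
(`finrank_commLie_mul_card`). A representation of degree `m = (q-1)/2` restricts to the unipotent
group with nonzero weights of multiplicity at most one (`exists_weights`), because the torus
permutes the weights through multiplication by squares. So `χ` vanishes on elements with two
distinct eigenvalues in `F`. With `q = 12k+1`, the stabilizers that matter, except that of `v₂`,
have even order and exponent dividing `q-1`; only `±1` contribute, and the dimension is `2m²/|K|`.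
For `v₂` the relation `∑ |χ|² = |G|` yields the sum of `|χ|²` over the traces without eigenvalues in
`F` (`sum_nonsplit`). The cyclic subgroup of order `q+1` takes each such trace exactly twice, so the
dimension is `m/2`.

Quotient manifolds. Centralizers in `U(m)` are treated through the Cayley transform, a rational
chart at `1` with values in the Lie algebra (`IsCayley`). The gauge group acts by `t ↦ l(h)⁻¹ t
r(h)`; the action is free because the gauge element can be solved for along the tree, continuously
in the two points. Slices transverse to the orbits give the charts (`exists_localInverse_tube`,
`LocalSlice.chart`). Each slice is chosen so that, together with the orbit directions, it forms a
positive frame. Transition maps then have positive Jacobian, since the adjoint action of an element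
with a square root has positive determinant (`LocalSlice.det_transition_pos`). -/

open scoped Manifold ContDiff MatrixGroups

noncomputable section

set_option linter.unusedSectionVars false

namespace OliverSegev

/-! ### The Cayley transform -/

section Cayley

variable {R : Type*} [NormedRing R] [NormedAlgebra ℝ R]

/-- The Cayley transform `(1 + x) / (1 - x)`. -/
def cay (x : R) : R := (2 : ℝ) • Ring.inverse (1 - x) - 1

/-- The inverse `(u - 1) / (u + 1)` of the Cayley transform. -/
def cayInv (u : R) : R := 1 - (2 : ℝ) • Ring.inverse (u + 1)

@[simp] theorem cay_zero : cay (0 : R) = 1 := by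
  simp [cay, two_smul]

theorem cay_mul_one_sub {x : R} (h : IsUnit (1 - x)) : cay x * (1 - x) = 1 + x := by
  rw [cay, sub_mul, smul_mul_assoc, Ring.inverse_mul_cancel _ h, two_smul]; noncomm_ring

theorem one_sub_mul_cay {x : R} (h : IsUnit (1 - x)) : (1 - x) * cay x = 1 + x := by
  rw [cay, mul_sub, mul_smul_comm, Ring.mul_inverse_cancel _ h, two_smul]; noncomm_ring

theorem eq_cay {x u : R} (h : IsUnit (1 - x)) (hu : u * (1 - x) = 1 + x) : u = cay x :=
  h.mul_left_injective (hu.trans (cay_mul_one_sub h).symm)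

theorem cay_mul_cay_neg {x : R} (h : IsUnit (1 - x)) (h' : IsUnit (1 + x)) :
    cay x * cay (-x) = 1 := by
  have h1 : IsUnit (1 - -x) := by rwa [sub_neg_eq_add]
  apply h1.mul_left_injective
  change cay x * cay (-x) * (1 - -x) = 1 * (1 - -x)
  rw [mul_assoc, cay_mul_one_sub h1, ← sub_eq_add_neg, cay_mul_one_sub h]
  noncomm_ring

/-- Together with `one_sub_cayInv` this shows that the transform exchanges the two domains of
invertibility, of `1 - x` and of `u + 1`. -/
theorem cay_add_one {x : R} : cay x + 1 = (2 : ℝ) • Ring.inverse (1 - x) := by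
  rw [cay]; abel

theorem isUnit_two_smul {x : R} (h : IsUnit x) : IsUnit ((2 : ℝ) • x) := by
  rw [← algebraMap_smul R, smul_eq_mul]
  exact ((isUnit_iff_ne_zero.2 (two_ne_zero (α := ℝ))).map (algebraMap ℝ R)).mul h

theorem isUnit_cay_add_one {x : R} (h : IsUnit (1 - x)) : IsUnit (cay x + 1) := by
  rw [cay_add_one]; exact isUnit_two_smul h.ringInverse

theorem cayInv_mul {u : R} (h : IsUnit (u + 1)) : cayInv u * (u + 1) = u - 1 := by
  rw [cayInv, sub_mul, smul_mul_assoc, Ring.inverse_mul_cancel _ h, two_smul]; noncomm_ring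

theorem one_sub_cayInv {u : R} : 1 - cayInv u = (2 : ℝ) • Ring.inverse (u + 1) := by
  rw [cayInv]; abel

theorem cayInv_cay {x : R} (h : IsUnit (1 - x)) : cayInv (cay x) = x := by
  apply (isUnit_cay_add_one h).mul_left_injective
  change cayInv (cay x) * (cay x + 1) = x * (cay x + 1)
  rw [cayInv_mul (isUnit_cay_add_one h)]
  have := one_sub_mul_cay h
  rw [sub_mul, one_mul] at this
  rw [mul_add, mul_one]
  rw [sub_eq_iff_eq_add] at this ⊢
  exact this.trans (by abel)

theorem isUnit_one_sub_cayInv {u : R} (h : IsUnit (u + 1)) : IsUnit (1 - cayInv u) := by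
  rw [one_sub_cayInv]; exact isUnit_two_smul h.ringInverse

theorem cay_cayInv {u : R} (h : IsUnit (u + 1)) : cay (cayInv u) = u := by
  symm
  apply eq_cay (isUnit_one_sub_cayInv h)
  have h1 : 1 + cayInv u = 1 + 1 - (1 - cayInv u) := by abel
  rw [h1, one_sub_cayInv, mul_smul_comm]
  have := Ring.mul_inverse_cancel _ h
  rw [add_mul, one_mul] at this
  rw [eq_sub_of_add_eq this, smul_sub, two_smul ℝ (1 : R)]

theorem map_cay {R' : Type*} [NormedRing R'] [NormedAlgebra ℝ R'] (f : R →ₐ[ℝ] R') {x : R}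
    (h : IsUnit (1 - x)) : f (cay x) = cay (f x) := by
  have h1 : IsUnit (1 - f x) := by simpa using h.map f
  apply eq_cay h1
  have := congrArg f (cay_mul_one_sub h)
  simpa using this

theorem isUnit_one_add_one : IsUnit ((1 : R) + 1) := by
  have : (1 : R) + 1 = (2 : ℝ) • 1 := (two_smul _ _).symm
  rw [this]; exact isUnit_two_smul isUnit_one

theorem cayInv_one : cayInv (1 : R) = 0 := by
  have := cayInv_cay (x := (0 : R)) (by simp)
  rwa [cay_zero] at this

variable [CompleteSpace R]

theorem contDiffAt_cay {x : R} (h : IsUnit (1 - x)) {n : WithTop ℕ∞} : ContDiffAt ℝ n cay x := by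
  obtain ⟨u, hu⟩ := h
  have h1 : ContDiffAt ℝ n (Ring.inverse : R → R) (1 - x) := hu ▸ contDiffAt_ringInverse ℝ u
  exact ((h1.comp x (contDiffAt_const.sub contDiffAt_id)).const_smul (2 : ℝ)).sub
    contDiffAt_const

theorem contDiffAt_cayInv {x : R} (h : IsUnit (x + 1)) {n : WithTop ℕ∞} :
    ContDiffAt ℝ n cayInv x := by
  obtain ⟨u, hu⟩ := h
  have h1 : ContDiffAt ℝ n (Ring.inverse : R → R) (x + 1) := hu ▸ contDiffAt_ringInverse ℝ u
  exact contDiffAt_const.sub ((h1.comp x (contDiffAt_id.add contDiffAt_const)).const_smul (2 : ℝ))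

theorem hasFDerivAt_cay {x : R} (h : IsUnit (1 - x)) :
    HasFDerivAt cay ((2 : ℝ) • ContinuousLinearMap.mulLeftRight ℝ R (Ring.inverse (1 - x))
      (Ring.inverse (1 - x))) x := by
  obtain ⟨u, hu⟩ := h
  have h1 : HasFDerivAt (Ring.inverse : R → R) _ (1 - x) :=
    hu ▸ hasFDerivAt_ringInverse (𝕜 := ℝ) u
  have h2 := ((h1.comp x ((hasFDerivAt_id x).const_sub 1)).const_smul (2 : ℝ)).sub_const 1
  refine h2.congr_fderiv ?_
  rw [← hu, Ring.inverse_unit]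
  ext y
  simp

theorem hasFDerivAt_cay_zero :
    HasFDerivAt (cay : R → R) ((2 : ℝ) • ContinuousLinearMap.id ℝ R) 0 := by
  refine (hasFDerivAt_cay (by simp)).congr_fderiv ?_
  ext y
  simp

theorem hasFDerivAt_cayInv_one :
    HasFDerivAt (cayInv : R → R) ((2⁻¹ : ℝ) • ContinuousLinearMap.id ℝ R) 1 := by
  have e : (1 : R) + 1 = (2 : ℝ) • 1 := (two_smul _ _).symm
  let u : Rˣ := ⟨(2 : ℝ) • 1, (2⁻¹ : ℝ) • 1, by simp [smul_smul], by simp [smul_smul]⟩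
  have h1 : HasFDerivAt (Ring.inverse : R → R) _ (1 + 1) :=
    (show (u : R) = 1 + 1 from e.symm) ▸ hasFDerivAt_ringInverse (𝕜 := ℝ) u
  have h0 : HasFDerivAt (fun u : R => u + 1) (ContinuousLinearMap.id ℝ R) 1 :=
    (hasFDerivAt_id (1 : R)).add_const 1
  have h2 := ((HasFDerivAt.comp (f := fun u : R => u + 1) 1 h1 h0).const_smul (2 : ℝ)).const_sub 1
  refine h2.congr_fderiv ?_
  ext y
  have : (↑u⁻¹ : R) = (2⁻¹ : ℝ) • 1 := rfl
  simp [this, smul_smul]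

theorem eventually_isUnit_add_one : ∀ᶠ u in nhds (1 : R), IsUnit (u + 1) := by
  have h : ContinuousAt (fun u : R => u + 1) 1 := by fun_prop
  exact h.eventually (Units.isOpen.mem_nhds isUnit_one_add_one)

end Cayley

/-! ### Groups with a Cayley transform, and local products -/

/-- A group `P` of units with a Lie algebra `𝔰` such that the Cayley transform is a chart of `P`
at `1` with values in `𝔰`. -/
structure IsCayley {R : Type*} [Ring R] [Algebra ℝ R] (P : Subgroup Rˣ) (𝔰 : Submodule ℝ R) :
    Prop where
  isUnit_one_sub : ∀ x ∈ 𝔰, IsUnit (1 - x)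
  mem_of_cay : ∀ x ∈ 𝔰, ∀ u : Rˣ, (u : R) * (1 - x) = 1 + x → u ∈ P
  mem_of_cayInv : ∀ u ∈ P, IsUnit ((u : R) + 1) → ∀ x : R, x * (u + 1) = u - 1 → x ∈ 𝔰
  conj_mem : ∀ u ∈ P, ∀ x ∈ 𝔰, (u : R) * x * ↑u⁻¹ ∈ 𝔰
  mem_of_sandwich : ∀ x ∈ 𝔰, ∀ y ∈ 𝔰, ∀ z : R, (1 + x) * z * (1 - x) = y → z ∈ 𝔰
  exists_sqrt : ∀ u ∈ P, ∃ w ∈ P, w * w = u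

namespace IsCayley

variable {R : Type*} [NormedRing R] [NormedAlgebra ℝ R] {P : Subgroup Rˣ} {𝔰 : Submodule ℝ R}

theorem isUnit_one_add (h : IsCayley P 𝔰) {x : R} (hx : x ∈ 𝔰) : IsUnit (1 + x) := by
  simpa using h.isUnit_one_sub (-x) (neg_mem hx)

theorem exists_cay (h : IsCayley P 𝔰) {x : R} (hx : x ∈ 𝔰) :
    ∃ u ∈ P, (u : R) = cay x ∧ (↑u⁻¹ : R) = cay (-x) := by
  have h1 := h.isUnit_one_sub x hx
  have h2 := h.isUnit_one_add hx
  have h3 : cay (-x) * cay x = 1 := by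
    have := cay_mul_cay_neg (x := -x) (by simpa using h2) (by simpa [← sub_eq_add_neg] using h1)
    rwa [neg_neg] at this
  exact ⟨⟨cay x, cay (-x), cay_mul_cay_neg h1 h2, h3⟩,
    h.mem_of_cay x hx _ (cay_mul_one_sub h1), rfl, rfl⟩

theorem cayInv_mem (h : IsCayley P 𝔰) {u : Rˣ} (hu : u ∈ P) (h1 : IsUnit ((u : R) + 1)) :
    cayInv (u : R) ∈ 𝔰 :=
  h.mem_of_cayInv u hu h1 _ (cayInv_mul h1)

end IsCayley

/-- Two homomorphisms of Cayley groups, which define the action `t ↦ l(h)⁻¹ t r(h)`. -/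
structure IsCayleyPair {𝔄 𝔅 : Type*} [Ring 𝔄] [Algebra ℝ 𝔄] [Ring 𝔅] [Algebra ℝ 𝔅]
    (P : Subgroup 𝔄ˣ) (𝔰 : Submodule ℝ 𝔄) (H : Subgroup 𝔅ˣ) (𝔥 : Submodule ℝ 𝔅)
    (l r : 𝔅 →ₐ[ℝ] 𝔄) : Prop where
  left : IsCayley P 𝔰
  right : IsCayley H 𝔥
  l_mem : ∀ h ∈ H, Units.map (l : 𝔅 →* 𝔄) h ∈ P
  r_mem : ∀ h ∈ H, Units.map (r : 𝔅 →* 𝔄) h ∈ P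
  l_mem' : ∀ x ∈ 𝔥, l x ∈ 𝔰
  r_mem' : ∀ x ∈ 𝔥, r x ∈ 𝔰

/-! ### Slices and the local product structure of the group. -/

section Tube

variable {𝔄 𝔅 E : Type*} [NormedRing 𝔄] [NormedAlgebra ℝ 𝔄]
  [NormedRing 𝔅] [NormedAlgebra ℝ 𝔅]
  [NormedAddCommGroup E] [NormedSpace ℝ E]
  {P : Subgroup 𝔄ˣ} {𝔰 : Submodule ℝ 𝔄} {H : Subgroup 𝔅ˣ} {𝔥 : Submodule ℝ 𝔅}
  {l r : 𝔅 →ₐ[ℝ] 𝔄}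

/-- The slice `v ↦ x · cay (b v)`. -/
def slice (b : E →L[ℝ] 𝔰) (x : 𝔄) (v : E) : 𝔄 := x * cay (b v : 𝔄)

/-- The translates of the slice by the group. -/
def tube (l r : 𝔅 →ₐ[ℝ] 𝔄) (b : E →L[ℝ] 𝔰) (x : 𝔄) (p : E × 𝔥) : 𝔄 :=
  cay (-(l p.2 : 𝔄)) * slice b x p.1 * cay (r p.2 : 𝔄)

theorem slice_mem (hP : IsCayley P 𝔰) (b : E →L[ℝ] 𝔰) {x : 𝔄ˣ} (hx : x ∈ P) (v : E) :
    ∃ u ∈ P, (u : 𝔄) = slice b x v ∧ (↑u⁻¹ : 𝔄) = cay (-(b v : 𝔄)) * ↑x⁻¹ := by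
  obtain ⟨u, hu, h1, h2⟩ := hP.exists_cay (b v).2
  exact ⟨x * u, mul_mem hx hu, by simp [slice, h1], by simp [h2]⟩

theorem tube_mem (h : IsCayleyPair P 𝔰 H 𝔥 l r) (b : E →L[ℝ] 𝔰) {x : 𝔄ˣ} (hx : x ∈ P)
    (p : E × 𝔥) : ∃ u ∈ P, (u : 𝔄) = tube l r b x p := by
  obtain ⟨u, hu, h1, -⟩ := slice_mem h.left b hx p.1
  obtain ⟨a, ha, h2, -⟩ := h.left.exists_cay (neg_mem (h.l_mem' _ p.2.2))
  obtain ⟨c, hc, h3, -⟩ := h.left.exists_cay (h.r_mem' _ p.2.2)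
  exact ⟨a * u * c, mul_mem (mul_mem ha hu) hc, by simp [tube, h1, h2, h3]⟩

/-- Algebra homomorphisms commute with the Cayley transform, and `cay (-y)` is inverse to `cay y`.
So the two outer factors of the tube come from one group element, and moving along `𝔥` stays within
an orbit. -/
theorem tube_eq_smul (h : IsCayleyPair P 𝔰 H 𝔥 l r) (b : E →L[ℝ] 𝔰) (x : 𝔄) (p : E × 𝔥) :
    ∃ a ∈ H, (a : 𝔅) = cay (p.2 : 𝔅) ∧
      tube l r b x p = l (↑a⁻¹ : 𝔅) * slice b x p.1 * r (a : 𝔅) := by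
  obtain ⟨a, ha, h1, h2⟩ := h.right.exists_cay p.2.2
  refine ⟨a, ha, h1, ?_⟩
  rw [h1, h2, map_cay, map_cay, map_neg, tube]
  · exact h.right.isUnit_one_sub _ p.2.2
  · exact h.right.isUnit_one_sub _ (neg_mem p.2.2)

@[simp] theorem tube_zero (b : E →L[ℝ] 𝔰) (x : 𝔄) (v : E) :
    tube l r b x (v, (0 : 𝔥)) = slice b x v := by
  simp [tube]

@[simp] theorem slice_zero (b : E →L[ℝ] 𝔰) (x : 𝔄) : slice b x 0 = x := by
  simp [slice]

variable [FiniteDimensional ℝ 𝔄] [FiniteDimensional ℝ 𝔅]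

variable (𝔥) in
/-- An algebra homomorphism restricted to the Lie algebra. -/
def lieMap (f : 𝔅 →ₐ[ℝ] 𝔄) : 𝔥 →L[ℝ] 𝔄 := (f.toLinearMap ∘ₗ 𝔥.subtype).toContinuousLinearMap

@[simp] theorem lieMap_apply (f : 𝔅 →ₐ[ℝ] 𝔄) (x : 𝔥) : lieMap 𝔥 f x = f x := rfl

/-- Half of the logarithmic derivative of the tube at the point `(v, 0)`. -/
def frame (l r : 𝔅 →ₐ[ℝ] 𝔄) (b : E →L[ℝ] 𝔰) (x : 𝔄ˣ) (v : E) : E × 𝔥 →L[ℝ] 𝔄 :=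
  (ContinuousLinearMap.mulLeftRight ℝ 𝔄 (Ring.inverse (1 + (b v : 𝔄)))
      (Ring.inverse (1 - (b v : 𝔄))) ∘L 𝔰.subtypeL ∘L b).coprod
    (lieMap 𝔥 r - ContinuousLinearMap.mulLeftRight ℝ 𝔄 (cay (-(b v : 𝔄)) * ↑x⁻¹) (slice b x v) ∘L
      lieMap 𝔥 l)

theorem frame_apply (b : E →L[ℝ] 𝔰) (x : 𝔄ˣ) (v : E) (p : E × 𝔥) :
    frame l r b x v p = Ring.inverse (1 + (b v : 𝔄)) * b p.1 * Ring.inverse (1 - (b v : 𝔄)) +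
      (r p.2 - cay (-(b v : 𝔄)) * ↑x⁻¹ * l p.2 * slice b x v) := by
  simp [frame]

/-- A logarithmic derivative of a map into the group must lie in the Lie algebra. The slice
directions use the sandwich axiom, the orbit directions the stability under conjugation. -/
theorem frame_mem (h : IsCayleyPair P 𝔰 H 𝔥 l r) (b : E →L[ℝ] 𝔰) {x : 𝔄ˣ} (hx : x ∈ P) (v : E)
    (p : E × 𝔥) : frame l r b x v p ∈ 𝔰 := by
  rw [frame_apply]
  refine add_mem ?_ (sub_mem (h.r_mem' _ p.2.2) ?_)
  · refine h.left.mem_of_sandwich _ (b v).2 _ (b p.1).2 _ ?_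
    have h1 := Ring.mul_inverse_cancel _ (h.left.isUnit_one_add (b v).2)
    have h2 := Ring.inverse_mul_cancel _ (h.left.isUnit_one_sub _ (b v).2)
    rw [← mul_assoc, ← mul_assoc, h1, one_mul, mul_assoc, h2, mul_one]
  · obtain ⟨u, hu, h1, h2⟩ := slice_mem h.left b hx v
    rw [← h1, ← h2]
    simpa using h.left.conj_mem _ (inv_mem hu) _ (h.l_mem' _ p.2.2)

/-- The identity `cay y * (1 + y)⁻¹ = (1 - y)⁻¹` turns the derivative `2 (1 - y)⁻¹ w (1 - y)⁻¹` of
`cay` into a left multiple of `slice b x v`. -/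
theorem hasFDerivAt_slice (hP : IsCayley P 𝔰) (b : E →L[ℝ] 𝔰) (x : 𝔄) (v : E) :
    HasFDerivAt (slice b x) ((2 : ℝ) • (ContinuousLinearMap.mul ℝ 𝔄 (slice b x v) ∘L
      ContinuousLinearMap.mulLeftRight ℝ 𝔄 (Ring.inverse (1 + (b v : 𝔄)))
      (Ring.inverse (1 - (b v : 𝔄))) ∘L 𝔰.subtypeL ∘L b)) v := by
  have := FiniteDimensional.complete ℝ 𝔄
  have h1 := hP.isUnit_one_sub _ (b v).2
  have h2 := hP.isUnit_one_add (b v).2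
  have hb : HasFDerivAt (fun v => (b v : 𝔄)) (𝔰.subtypeL ∘L b) v :=
    (𝔰.subtypeL ∘L b).hasFDerivAt
  have h3 := ((hasFDerivAt_cay h1).comp v hb).const_mul x
  refine h3.congr_fderiv ?_
  have h4 : cay (b v : 𝔄) * Ring.inverse (1 + (b v : 𝔄)) = Ring.inverse (1 - (b v : 𝔄)) := by
    have h5 : cay (b v : 𝔄) = Ring.inverse (1 - (b v : 𝔄)) * (1 + (b v : 𝔄)) := by
      rw [← one_sub_mul_cay h1, Ring.inverse_mul_cancel_left _ _ h1]
    rw [h5, mul_assoc, Ring.mul_inverse_cancel _ h2, mul_one]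
  ext w
  simp only [slice, ContinuousLinearMap.coe_comp, Function.comp_apply, Submodule.subtypeL_apply,
    FunLike.coe_smul, Pi.smul_apply, ContinuousLinearMap.mulLeftRight_apply,
    ContinuousLinearMap.mul_apply', smul_eq_mul]
  rw [← h4]
  simp only [mul_assoc, mul_smul_comm]

theorem hasFDerivAt_tube (h : IsCayleyPair P 𝔰 H 𝔥 l r) (b : E →L[ℝ] 𝔰) {x : 𝔄ˣ} (hx : x ∈ P)
    (v : E) : HasFDerivAt (tube l r b (x : 𝔄) (𝔥 := 𝔥)) ((2 : ℝ) •
      (ContinuousLinearMap.mul ℝ 𝔄 (slice b x v) ∘L frame l r b x v)) (v, 0) := by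
  have := FiniteDimensional.complete ℝ 𝔄
  have h1 : HasFDerivAt (fun p : E × 𝔥 => slice b (x : 𝔄) p.1) _ (v, (0 : 𝔥)) :=
    HasFDerivAt.comp (g := slice b (x : 𝔄)) (v, (0 : 𝔥)) (hasFDerivAt_slice h.left b x v)
      hasFDerivAt_fst
  have hl : HasFDerivAt (fun p : E × 𝔥 => -(l p.2 : 𝔄))
      (-(lieMap 𝔥 l ∘L ContinuousLinearMap.snd ℝ E 𝔥)) (v, (0 : 𝔥)) :=
    (HasFDerivAt.neg (lieMap 𝔥 l ∘L ContinuousLinearMap.snd ℝ E 𝔥).hasFDerivAt)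
  have hr : HasFDerivAt (fun p : E × 𝔥 => (r p.2 : 𝔄))
      (lieMap 𝔥 r ∘L ContinuousLinearMap.snd ℝ E 𝔥) (v, (0 : 𝔥)) :=
    (lieMap 𝔥 r ∘L ContinuousLinearMap.snd ℝ E 𝔥).hasFDerivAt
  have hcl : HasFDerivAt (cay : 𝔄 → 𝔄) ((2 : ℝ) • ContinuousLinearMap.id ℝ 𝔄)
      (-(l ((v, (0 : 𝔥)) : E × 𝔥).2 : 𝔄)) := by
    have := hasFDerivAt_cay_zero (R := 𝔄)
    simpa using this
  have hcr : HasFDerivAt (cay : 𝔄 → 𝔄) ((2 : ℝ) • ContinuousLinearMap.id ℝ 𝔄)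
      (r ((v, (0 : 𝔥)) : E × 𝔥).2 : 𝔄) := by
    have := hasFDerivAt_cay_zero (R := 𝔄)
    simpa using this
  have h2 := ((hcl.comp (v, (0 : 𝔥)) hl).mul' h1).mul' (hcr.comp (v, (0 : 𝔥)) hr)
  refine h2.congr_fderiv ?_
  obtain ⟨u, -, h3, h4⟩ := slice_mem h.left b hx v
  ext p
  · simp [frame, ← h3, ← h4, mul_assoc]
  · simp [frame, ← h3, ← h4, mul_sub, smul_sub]
    rw [show (u : 𝔄) * (↑u⁻¹ * l p * u) = l p * u by rw [mul_assoc, Units.mul_inv_cancel_left]]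
    abel

theorem contDiff_slice (hP : IsCayley P 𝔰) (b : E →L[ℝ] 𝔰) (x : 𝔄) {n : WithTop ℕ∞} :
    ContDiff ℝ n (slice b x) := by
  have := FiniteDimensional.complete ℝ 𝔄
  rw [contDiff_iff_contDiffAt]
  intro v
  have h1 : ContDiffAt ℝ n (fun v => (b v : 𝔄)) v := (𝔰.subtypeL ∘L b).contDiff.contDiffAt
  exact contDiffAt_const.mul (ContDiffAt.comp (g := cay) v (contDiffAt_cay
    (hP.isUnit_one_sub _ (b v).2)) h1)

theorem contDiff_tube (h : IsCayleyPair P 𝔰 H 𝔥 l r) (b : E →L[ℝ] 𝔰) (x : 𝔄) {n : WithTop ℕ∞} :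
    ContDiff ℝ n (tube l r b x (𝔥 := 𝔥)) := by
  have := FiniteDimensional.complete ℝ 𝔄
  have h1 : ContDiff ℝ n (fun p : E × 𝔥 => slice b x p.1) :=
    (contDiff_slice h.left b x).comp contDiff_fst
  have h2 : ContDiff ℝ n (fun p : E × 𝔥 => cay (-(l p.2 : 𝔄))) := by
    rw [contDiff_iff_contDiffAt]
    intro p
    have : ContDiffAt ℝ n (fun p : E × 𝔥 => -(l p.2 : 𝔄)) p :=
      (lieMap 𝔥 l ∘L ContinuousLinearMap.snd ℝ E 𝔥).contDiff.neg.contDiffAt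
    exact (contDiffAt_cay (h.left.isUnit_one_sub _ (neg_mem (h.l_mem' _ p.2.2)))).comp p this
  have h3 : ContDiff ℝ n (fun p : E × 𝔥 => cay (r p.2 : 𝔄)) := by
    rw [contDiff_iff_contDiffAt]
    intro p
    have : ContDiffAt ℝ n (fun p : E × 𝔥 => (r p.2 : 𝔄)) p :=
      (lieMap 𝔥 r ∘L ContinuousLinearMap.snd ℝ E 𝔥).contDiff.contDiffAt
    exact (contDiffAt_cay (h.left.isUnit_one_sub _ (h.r_mem' _ p.2.2))).comp p this
  exact (h2.mul h1).mul h3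

variable [FiniteDimensional ℝ E]

/-- Where the frame is nondegenerate, the group `P` is locally the product of the slice and the
acting group. -/
theorem exists_localInverse_tube (h : IsCayleyPair P 𝔰 H 𝔥 l r) (b : E →L[ℝ] 𝔰) {x : 𝔄ˣ}
    (hx : x ∈ P) (v : E) (J : 𝔰 ≃L[ℝ] E × 𝔥) (pr : 𝔄 →L[ℝ] 𝔰) (hpr : ∀ s : 𝔰, pr s = s)
    (hdet : ((J : 𝔰 →L[ℝ] E × 𝔥) ∘L pr ∘L frame l r b x v).det ≠ 0) :
    ∃ G : 𝔄 → E × 𝔥, ContDiffAt ℝ ω G (slice b x v) ∧ G (slice b x v) = (v, 0) ∧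
      (∀ᶠ u in nhds (slice b (x : 𝔄) v), ∀ t ∈ P, (t : 𝔄) = u → tube l r b (x : 𝔄) (G u) = u) ∧
      ∀ᶠ p in nhds (v, (0 : 𝔥)), G (tube l r b (x : 𝔄) p) = p := by
  have := FiniteDimensional.complete ℝ 𝔄
  have : CompleteSpace (E × 𝔥) := FiniteDimensional.complete ℝ _
  obtain ⟨y, hyP, hy1, hy2⟩ := slice_mem h.left b hx v
  -- The Cayley chart centred at the slice point `y`, extended to the ambient algebra by the
  -- projection `pr`.
  set κ : 𝔄 → E × 𝔥 := fun u => J (pr (cayInv (↑y⁻¹ * u))) with hκ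
  have hyy : (↑y⁻¹ : 𝔄) * slice b x v = 1 := by rw [← hy1]; exact y.inv_mul
  have hκs : ContDiffAt ℝ ω κ (slice b x v) := by
    have h1 : ContDiffAt ℝ ω (cayInv : 𝔄 → 𝔄) (↑y⁻¹ * slice b (x : 𝔄) v) := by
      rw [hyy]; exact contDiffAt_cayInv isUnit_one_add_one
    exact ((J : 𝔰 →L[ℝ] E × 𝔥) ∘L pr).contDiff.contDiffAt.comp _
      (h1.comp _ (contDiffAt_const.mul contDiffAt_id))
  have hκd : HasFDerivAt κ (((J : 𝔰 →L[ℝ] E × 𝔥) ∘L pr) ∘L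
      (((2⁻¹ : ℝ) • ContinuousLinearMap.id ℝ 𝔄) ∘L ContinuousLinearMap.mul ℝ 𝔄 (↑y⁻¹ : 𝔄)))
      (slice b x v) := by
    have h1 : HasFDerivAt (cayInv : 𝔄 → 𝔄) ((2⁻¹ : ℝ) • ContinuousLinearMap.id ℝ 𝔄)
      (ContinuousLinearMap.mul ℝ 𝔄 (↑y⁻¹ : 𝔄) (slice b (x : 𝔄) v)) := by
      rw [ContinuousLinearMap.mul_apply', hyy]; exact hasFDerivAt_cayInv_one
    exact ((J : 𝔰 →L[ℝ] E × 𝔥) ∘L pr).hasFDerivAt.comp _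
      (h1.comp _ (ContinuousLinearMap.mul ℝ 𝔄 (↑y⁻¹ : 𝔄)).hasFDerivAt)
  have hκ0 : κ (slice b x v) = 0 := by simp [hκ, hyy, cayInv_one]
  set p₀ : E × 𝔥 := (v, 0) with hp₀
  have ht0 : tube l r b (x : 𝔄) p₀ = slice b x v := tube_zero b _ v
  -- In this chart the tube is a map between open parts of `E × 𝔥`. The factors `1/2` from `cayInv`
  -- and `2` from the tube cancel, so its derivative is the frame itself and the inverse function
  -- theorem applies.
  set f : E × 𝔥 → E × 𝔥 := fun p => κ (tube l r b (x : 𝔄) p) with hf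
  have hfs : ContDiffAt ℝ ω f p₀ := by
    rw [← ht0] at hκs
    exact hκs.comp _ (contDiff_tube h b x).contDiffAt
  set f' := ((J : 𝔰 →L[ℝ] E × 𝔥) ∘L pr ∘L frame l r b x v).toContinuousLinearEquivOfDetNeZero hdet
  have hfd : HasFDerivAt f (f' : E × 𝔥 →L[ℝ] E × 𝔥) p₀ := by
    rw [← ht0] at hκd
    refine (hκd.comp p₀ (hasFDerivAt_tube h b hx v)).congr_fderiv ?_
    rw [ContinuousLinearMap.coe_toContinuousLinearEquivOfDetNeZero]
    apply ContinuousLinearMap.ext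
    intro p
    simp only [ContinuousLinearMap.comp_apply, smul_apply,
      ContinuousLinearMap.mul_apply', ContinuousLinearMap.id_apply, mul_smul_comm, smul_smul]
    rw [← mul_assoc, hyy]
    norm_num
  have hω : (ω : WithTop ℕ∞) ≠ 0 := by simp
  have hs := hfs.hasStrictFDerivAt' hfd hω
  have hf0 : f p₀ = 0 := by simp only [hf, ht0, hκ0]
  set g := hfs.localInverse hfd hω with hg
  have hg0 : g 0 = p₀ := by rw [← hf0]; exact hfs.localInverse_apply_image hfd hω
  have hgs : ContDiffAt ℝ ω g 0 := by rw [← hf0]; exact hfs.to_localInverse hfd hω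
  have hgl : ∀ᶠ p in nhds p₀, g (f p) = p := hs.eventually_left_inverse
  have hgr : ∀ᶠ z in nhds (0 : E × 𝔥), f (g z) = z := hf0 ▸ hs.eventually_right_inverse
  have hGs : ContDiffAt ℝ ω (fun u => g (κ u)) (slice b x v) := by
    rw [← hκ0] at hgs; exact hgs.comp _ hκs
  have hGc := hGs.continuousAt
  have hG0 : g (κ (slice b x v)) = p₀ := by rw [hκ0, hg0]
  refine ⟨fun u => g (κ u), hGs, hG0, ?_, hgl⟩
  have hunit : ∀ᶠ u in nhds (slice b (x : 𝔄) v), IsUnit ((↑y⁻¹ : 𝔄) * u + 1) := by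
    have hc : ContinuousAt (fun u : 𝔄 => (↑y⁻¹ : 𝔄) * u) (slice b x v) := by fun_prop
    have h1 : ∀ᶠ u in nhds ((↑y⁻¹ : 𝔄) * slice b (x : 𝔄) v), IsUnit (u + 1) := by
      rw [hyy]; exact eventually_isUnit_add_one
    exact hc.eventually h1
  have h1 : ∀ᶠ u in nhds (slice b (x : 𝔄) v), f (g (κ u)) = κ u := by
    rw [← hκ0] at hgr
    exact hκs.continuousAt.eventually hgr
  have h2 : ∀ᶠ u in nhds (slice b (x : 𝔄) v), IsUnit ((↑y⁻¹ : 𝔄) * tube l r b (x : 𝔄) (g (κ u)) + 1) := by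
    have hc : ContinuousAt (fun u => tube l r b (x : 𝔄) (g (κ u))) (slice b x v) :=
      ((contDiff_tube h b x (n := 0)).continuous.continuousAt).comp hGc
    have h3 : tube l r b (x : 𝔄) (g (κ (slice b x v))) = slice b x v := by rw [hG0, ht0]
    rw [← h3] at hunit
    exact hc.eventually hunit
  -- The chart `κ` is not injective on the whole algebra. On points of `P` it is, where `u + 1` is
  -- invertible after translation, because `cayInv` lands in `𝔰` and `pr` is the identity there.
  -- Hence equality of the `κ` values gives equality of the points.
  filter_upwards [hunit, h1, h2] with u hu1 hu2 hu3 t ht htu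
  obtain ⟨t', ht', htu'⟩ := tube_mem h b hx (g (κ u))
  have hu4 : cayInv ((↑y⁻¹ : 𝔄) * u) ∈ 𝔰 := by
    have := h.left.cayInv_mem (mul_mem (inv_mem hyP) ht) (by simpa [htu] using hu1)
    simpa [htu] using this
  have hu5 : cayInv ((↑y⁻¹ : 𝔄) * tube l r b (x : 𝔄) (g (κ u))) ∈ 𝔰 := by
    have := h.left.cayInv_mem (mul_mem (inv_mem hyP) ht') (by simpa [htu'] using hu3)
    simpa [htu'] using this
  have hu6 := J.injective hu2
  have e1 := hpr ⟨_, hu4⟩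
  have e2 := hpr ⟨_, hu5⟩
  simp only at e1 e2
  rw [e1, e2] at hu6
  have hu7 := congrArg cay (congrArg Subtype.val hu6)
  simp only at hu7
  rw [cay_cayInv hu1, cay_cayInv hu3] at hu7
  have hu8 := congrArg ((y : 𝔄) * ·) hu7
  simpa using hu8

end Tube

/-! ### Determinants -/

section Determinants

variable {V W E : Type*} [AddCommGroup V] [Module ℝ V] [AddCommGroup W] [Module ℝ W]
  [AddCommGroup E] [Module ℝ E] [FiniteDimensional ℝ V] [FiniteDimensional ℝ W]
  [FiniteDimensional ℝ E]

theorem det_lowerTriangular (D : E →ₗ[ℝ] E) (L : E →ₗ[ℝ] W) (A : W →ₗ[ℝ] W) :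
    LinearMap.det ((D.prod L).coprod (LinearMap.inr ℝ E W ∘ₗ A)) =
      LinearMap.det D * LinearMap.det A := by
  classical
  let b := Module.finBasis ℝ E
  let b' := Module.finBasis ℝ W
  rw [← LinearMap.det_toMatrix (b.prod b'), ← LinearMap.det_toMatrix b, ← LinearMap.det_toMatrix b',
    ← Matrix.det_fromBlocks_zero₁₂ _ (LinearMap.toMatrix b b' L)]
  congr 1
  ext (i | i) (j | j) <;> simp [LinearMap.toMatrix_apply]

theorem exists_det_eq_neg_one [Nontrivial E] : ∃ R : E →ₗ[ℝ] E, LinearMap.det R = -1 := by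
  classical
  let b := Module.finBasis ℝ E
  have : Nonempty (Fin (Module.finrank ℝ E)) := ⟨⟨0, Module.finrank_pos⟩⟩
  let i : Fin (Module.finrank ℝ E) := Classical.arbitrary _
  refine ⟨Matrix.toLin b b (Matrix.diagonal (Function.update 1 i (-1))), ?_⟩
  rw [LinearMap.det_toLin, Matrix.det_diagonal, Finset.prod_update_of_mem (Finset.mem_univ i)]
  simp

/-- An injective linear map extends to a linear isomorphism of positive determinant. -/
theorem exists_coprod_det_pos [Nontrivial E] (ρ : W →ₗ[ℝ] V) (hρ : Function.Injective ρ)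
    (J : V ≃ₗ[ℝ] E × W) :
    ∃ b : E →ₗ[ℝ] V, 0 < LinearMap.det ((J : V →ₗ[ℝ] E × W) ∘ₗ b.coprod ρ) := by
  -- Any isomorphism of `E` with a complement of the range gives an isomorphism; only the sign of
  -- its determinant remains.
  obtain ⟨C, hC⟩ := (LinearMap.range ρ).exists_isCompl
  have h1 := Submodule.finrank_add_eq_of_isCompl hC
  rw [LinearMap.finrank_range_of_inj hρ, J.finrank_eq, Module.finrank_prod] at h1
  let i : E ≃ₗ[ℝ] C := LinearEquiv.ofFinrankEq E C (by omega)
  let b₀ : E →ₗ[ℝ] V := C.subtype ∘ₗ i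
  have hinj : Function.Injective ((J : V →ₗ[ℝ] E × W) ∘ₗ b₀.coprod ρ) := by
    rw [LinearMap.coe_comp]
    refine J.injective.comp ((injective_iff_map_eq_zero _).2 ?_)
    rintro ⟨v, w⟩ hvw
    rw [LinearMap.coprod_apply] at hvw
    have h2 : b₀ v ∈ C := (i v).2
    have h3 : b₀ v ∈ LinearMap.range ρ := by
      rw [eq_neg_of_add_eq_zero_left hvw]; exact neg_mem ⟨w, rfl⟩
    have h4 : b₀ v = 0 := Submodule.disjoint_def.1 hC.disjoint _ h3 h2
    have h5 : i v = 0 := Subtype.ext h4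
    rw [h4, zero_add] at hvw
    rw [Prod.mk_eq_zero]
    exact ⟨by simpa using h5, hρ (hvw.trans (map_zero ρ).symm)⟩
  have hdet : LinearMap.det ((J : V →ₗ[ℝ] E × W) ∘ₗ b₀.coprod ρ) ≠ 0 := fun h =>
    (LinearMap.det_eq_zero_iff_ker_ne_bot.1 h) (LinearMap.ker_eq_bot.2 hinj)
  -- A reflection of `E` reverses the sign, which is why `E` must be nontrivial.
  rcases hdet.lt_or_gt with h | h
  · obtain ⟨R, hR⟩ := exists_det_eq_neg_one (E := E)
    refine ⟨b₀ ∘ₗ R, ?_⟩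
    have h2 : (b₀ ∘ₗ R).coprod ρ = b₀.coprod ρ ∘ₗ R.prodMap LinearMap.id := by
      ext <;> simp
    rw [h2, ← LinearMap.comp_assoc, LinearMap.det_comp, LinearMap.det_prodMap, hR, LinearMap.det_id]
    linarith
  · exact ⟨b₀, h⟩

end Determinants

namespace IsCayley

variable {R : Type*} [Ring R] [Algebra ℝ R] {P : Subgroup Rˣ} {𝔰 : Submodule ℝ R}

/-- The adjoint action on the Lie algebra. -/
def adjoint (h : IsCayley P 𝔰) (u : Rˣ) (hu : u ∈ P) : 𝔰 →ₗ[ℝ] 𝔰 :=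
  (LinearMap.mulLeftRight ℝ ((u : R), (↑u⁻¹ : R))).restrict fun x hx => by
    simpa using h.conj_mem u hu x hx

@[simp] theorem adjoint_apply (h : IsCayley P 𝔰) (u : Rˣ) (hu : u ∈ P) (x : 𝔰) :
    (h.adjoint u hu x : R) = u * x * ↑u⁻¹ := by
  simp [adjoint]

/-- If `u = w²` then `Ad u = (Ad w)²`, and the square of a nonzero real number is positive. Square
roots take the place of connectedness of the group. -/
theorem det_adjoint_pos (h : IsCayley P 𝔰) (u : Rˣ) (hu : u ∈ P) :
    0 < LinearMap.det (h.adjoint u hu) := by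
  obtain ⟨w, hw, rfl⟩ := h.exists_sqrt u hu
  have h1 : h.adjoint (w * w) hu = h.adjoint w hw ∘ₗ h.adjoint w hw := by
    ext x; simp [mul_assoc]
  have h2 : h.adjoint w hw ∘ₗ h.adjoint w⁻¹ (inv_mem hw) = LinearMap.id := by
    ext x; simp [mul_assoc]
  have h3 := congrArg LinearMap.det h2
  rw [LinearMap.det_comp, LinearMap.det_id] at h3
  rw [h1, LinearMap.det_comp]
  exact mul_self_pos.2 (left_ne_zero_of_mul (h3.symm ▸ one_ne_zero))

end IsCayley

/-! ### Slices and charts of the orbit space -/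

section Slices

variable {𝔄 𝔅 S Q : Type*} [NormedRing 𝔄] [NormedAlgebra ℝ 𝔄] [NormedRing 𝔅] [NormedAlgebra ℝ 𝔅]
  [TopologicalSpace S] [TopologicalSpace Q]

/-- The space `S` is, by means of `e`, a Cayley group `P`, and `π : S → Q` is the projection to the
orbit space of a free action `t ↦ l(h)⁻¹ t r(h)` of a Cayley group `H`. -/
structure IsCayleyQuotient (P : Subgroup 𝔄ˣ) (𝔰 : Submodule ℝ 𝔄) (H : Subgroup 𝔅ˣ)
    (𝔥 : Submodule ℝ 𝔅) (l r : 𝔅 →ₐ[ℝ] 𝔄) (e : S → 𝔄ˣ) (π : S → Q) (δ : S → S → 𝔅) : Prop where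
  pair : IsCayleyPair P 𝔰 H 𝔥 l r
  range_e : Set.range e = P
  injective_e : Function.Injective e
  inducing_e : Topology.IsInducing fun x => (e x : 𝔄)
  quot : IsOpenQuotientMap π
  rel : ∀ x y, π x = π y ↔ ∃ h ∈ H, (e y : 𝔄) = l (↑h⁻¹ : 𝔅) * e x * r (h : 𝔅)
  continuous_δ : Continuous (Function.uncurry δ)
  δ_spec : ∀ x y, ∀ h ∈ H, (e y : 𝔄) = l (↑h⁻¹ : 𝔅) * e x * r (h : 𝔅) → (h : 𝔅) = δ x y
  isClosed : IsClosed ((fun h : 𝔅ˣ => (h : 𝔅)) '' H)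

variable {E : Type*} [NormedAddCommGroup E] [NormedSpace ℝ E]
  {P : Subgroup 𝔄ˣ} {𝔰 : Submodule ℝ 𝔄} {H : Subgroup 𝔅ˣ} {𝔥 : Submodule ℝ 𝔅}
  {l r : 𝔅 →ₐ[ℝ] 𝔄} {e : S → 𝔄ˣ} {π : S → Q} {δ : S → S → 𝔅}

variable [FiniteDimensional ℝ 𝔄] [FiniteDimensional ℝ 𝔅] [FiniteDimensional ℝ E]

/-- The determinant of the frame, with respect to a fixed identification `J`. -/
def frameDet (l r : 𝔅 →ₐ[ℝ] 𝔄) (J : 𝔰 ≃L[ℝ] E × 𝔥) (pr : 𝔄 →L[ℝ] 𝔰) (b : E →L[ℝ] 𝔰) (x : 𝔄ˣ)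
    (v : E) : ℝ :=
  ((J : 𝔰 →L[ℝ] E × 𝔥) ∘L pr ∘L frame l r b x v).det

variable (l r e π) in
/-- A slice at the point `x`, parametrized by an open set `D`. -/
structure LocalSlice (J : 𝔰 ≃L[ℝ] E × 𝔥) (pr : 𝔄 →L[ℝ] 𝔰) (x : S) where
  b : E →L[ℝ] 𝔰
  σ : E → S
  D : Set E
  isOpen : IsOpen D
  zero_mem : 0 ∈ D
  σ_zero : σ 0 = x
  e_σ : ∀ v, (e (σ v) : 𝔄) = slice b (e x : 𝔄) v
  det_pos : ∀ v ∈ D, 0 < frameDet l r J pr b (e x) v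
  injOn : Set.InjOn (fun v => π (σ v)) D

namespace IsCayleyQuotient

variable (h : IsCayleyQuotient P 𝔰 H 𝔥 l r e π δ)

include h

theorem e_mem (x : S) : e x ∈ P := by
  have : e x ∈ Set.range e := ⟨x, rfl⟩
  rwa [h.range_e] at this

theorem exists_eq {u : 𝔄ˣ} (hu : u ∈ P) : ∃ x, e x = u := by
  have : u ∈ (P : Set 𝔄ˣ) := hu
  rwa [← h.range_e] at this

theorem exists_σ (b : E →L[ℝ] 𝔰) (x : S) :
    ∃ σ : E → S, ∀ v, (e (σ v) : 𝔄) = slice b (e x : 𝔄) v := by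
  have : ∀ v, ∃ s, (e s : 𝔄) = slice b (e x : 𝔄) v := by
    intro v
    obtain ⟨u, hu, h1, -⟩ := slice_mem h.pair.left b (h.e_mem x) v
    obtain ⟨s, hs⟩ := h.exists_eq hu
    exact ⟨s, by rw [hs, h1]⟩
  choose σ hσ using this
  exact ⟨σ, hσ⟩

theorem continuous_σ {b : E →L[ℝ] 𝔰} {x : S} {σ : E → S}
    (hσ : ∀ v, (e (σ v) : 𝔄) = slice b (e x : 𝔄) v) : Continuous σ := by
  rw [h.inducing_e.continuous_iff]
  have : (fun x => (e x : 𝔄)) ∘ σ = slice b (e x : 𝔄) := funext hσ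
  rw [this]
  exact (contDiff_slice h.pair.left b _ (n := 0)).continuous

theorem δ_self (x : S) : δ x x = 1 := by
  have := h.δ_spec x x 1 (one_mem _) (by simp)
  simpa using this.symm

/-- The infinitesimal action is injective, because the action is free. -/
theorem injective_infinitesimal (x : S) :
    Function.Injective (lieMap 𝔥 r - ContinuousLinearMap.mulLeftRight ℝ 𝔄 (↑(e x)⁻¹ : 𝔄) (e x) ∘L
      lieMap 𝔥 l) := by
  rw [injective_iff_map_eq_zero]
  intro ξ hξ
  have h1 : (e x : 𝔄) * r ξ = l ξ * e x := by
    have h2 := congrArg ((e x : 𝔄) * ·) hξ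
    simpa [mul_sub, mul_assoc, sub_eq_zero] using h2
  -- A vector `ξ` that acts trivially at `x` has a Cayley transform that fixes `x`. By freeness this
  -- group element is `1`, so `ξ = 0`.
  obtain ⟨u, hu, hu1, hu2⟩ := h.pair.right.exists_cay ξ.2
  have hn := h.pair.right.isUnit_one_sub _ ξ.2
  have h3 : (u : 𝔅) = δ x x := by
    apply h.δ_spec x x u hu
    have e1 : l (cay (ξ : 𝔅)) = cay (l ξ) := map_cay l hn
    have e2 : r (cay (ξ : 𝔅)) = cay (r ξ) := map_cay r hn
    have h4 : l (u : 𝔅) * e x = e x * r (u : 𝔅) := by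
      have nl := h.pair.left.isUnit_one_sub _ (h.pair.l_mem' _ ξ.2)
      have nr := h.pair.left.isUnit_one_sub _ (h.pair.r_mem' _ ξ.2)
      rw [hu1, e1, e2]
      apply nr.mul_left_injective
      apply nl.mul_right_injective
      change (1 - l ξ) * (cay (l ξ) * e x * (1 - r ξ)) = (1 - l ξ) * (e x * cay (r ξ) * (1 - r ξ))
      rw [mul_assoc (e x : 𝔄), cay_mul_one_sub nr, ← mul_assoc, ← mul_assoc, one_sub_mul_cay nl]
      have h5 : (e x : 𝔄) * (1 - r ξ) = (1 - l ξ) * e x := by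
        rw [mul_sub, sub_mul, h1, mul_one, one_mul]
      have h6 : (e x : 𝔄) * (1 + r ξ) = (1 + l ξ) * e x := by
        rw [mul_add, add_mul, h1, mul_one, one_mul]
      rw [mul_assoc, h5, h6]
      noncomm_ring
    rw [mul_assoc, ← h4, ← mul_assoc, ← map_mul]
    simp
  rw [h.δ_self, hu1] at h3
  have h4 := cayInv_cay hn
  rw [h3, cayInv_one] at h4
  exact Subtype.ext h4.symm

theorem continuous_frameDet (J : 𝔰 ≃L[ℝ] E × 𝔥) (pr : 𝔄 →L[ℝ] 𝔰) (b : E →L[ℝ] 𝔰) (x : 𝔄ˣ) :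
    Continuous (frameDet l r J pr b x) := by
  have := FiniteDimensional.complete ℝ 𝔄
  have hb : Continuous fun v => (b v : 𝔄) := (𝔰.subtypeL ∘L b).continuous
  have h1 : Continuous fun v => Ring.inverse (1 + (b v : 𝔄)) := by
    rw [continuous_iff_continuousAt]
    intro v
    obtain ⟨u, hu⟩ := h.pair.left.isUnit_one_add (b v).2
    have : ContinuousAt (Ring.inverse : 𝔄 → 𝔄) (1 + (b v : 𝔄)) := hu ▸ NormedRing.inverse_continuousAt u
    exact ContinuousAt.comp (f := fun v => 1 + (b v : 𝔄)) this (by fun_prop)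
  have h2 : Continuous fun v => Ring.inverse (1 - (b v : 𝔄)) := by
    rw [continuous_iff_continuousAt]
    intro v
    obtain ⟨u, hu⟩ := h.pair.left.isUnit_one_sub _ (b v).2
    have : ContinuousAt (Ring.inverse : 𝔄 → 𝔄) (1 - (b v : 𝔄)) := hu ▸ NormedRing.inverse_continuousAt u
    exact ContinuousAt.comp (f := fun v => 1 - (b v : 𝔄)) this (by fun_prop)
  have h3 : Continuous (slice b (x : 𝔄)) := (contDiff_slice h.pair.left b _ (n := 0)).continuous
  have h4 : Continuous fun v => cay (-(b v : 𝔄)) * (↑x⁻¹ : 𝔄) := by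
    have := (contDiff_slice h.pair.left (-b) 1 (n := 0)).continuous
    have h5 : Continuous fun v => cay (-(b v : 𝔄)) := by
      refine this.congr fun v => ?_
      simp [slice]
    exact h5.mul continuous_const
  apply ContinuousLinearMap.continuous_det.comp
  apply continuous_const.clm_comp
  apply continuous_const.clm_comp
  unfold frame
  have h5 : Continuous fun v => ContinuousLinearMap.mulLeftRight ℝ 𝔄 (Ring.inverse (1 + (b v : 𝔄)))
      (Ring.inverse (1 - (b v : 𝔄))) :=
    ((ContinuousLinearMap.mulLeftRight ℝ 𝔄).continuous.comp h1).clm_apply h2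
  have h6 : Continuous fun v => ContinuousLinearMap.mulLeftRight ℝ 𝔄 (cay (-(b v : 𝔄)) * ↑x⁻¹)
      (slice b (x : 𝔄) v) :=
    ((ContinuousLinearMap.mulLeftRight ℝ 𝔄).continuous.comp h4).clm_apply h3
  have h7 : Continuous fun v => ((ContinuousLinearMap.mulLeftRight ℝ 𝔄
      (Ring.inverse (1 + (b v : 𝔄))) (Ring.inverse (1 - (b v : 𝔄))) ∘L 𝔰.subtypeL ∘L b) ∘L
        ContinuousLinearMap.fst ℝ E 𝔥) +
      ((lieMap 𝔥 r - ContinuousLinearMap.mulLeftRight ℝ 𝔄 (cay (-(b v : 𝔄)) * ↑x⁻¹)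
        (slice b (x : 𝔄) v) ∘L lieMap 𝔥 l) ∘L ContinuousLinearMap.snd ℝ E 𝔥) :=
    ((h5.clm_comp continuous_const).clm_comp continuous_const).add
      ((continuous_const.sub (h6.clm_comp continuous_const)).clm_comp continuous_const)
  convert h7 using 2 with v
  ext p <;> simp

/-- At `v = 0` the frame is `b` on `E` and the infinitesimal action on `𝔥`. The latter is injective,
so it can be completed to a positively oriented isomorphism. -/
theorem exists_direction [Nontrivial E] (J : 𝔰 ≃L[ℝ] E × 𝔥) (pr : 𝔄 →L[ℝ] 𝔰)
    (hpr : ∀ s : 𝔰, pr s = s) (x : S) : ∃ b : E →L[ℝ] 𝔰, 0 < frameDet l r J pr b (e x) 0 := by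
  set ρ := lieMap 𝔥 r - ContinuousLinearMap.mulLeftRight ℝ 𝔄 (↑(e x)⁻¹ : 𝔄) (e x) ∘L
      lieMap 𝔥 l with hρ
  have hmem : ∀ ξ, ρ ξ ∈ 𝔰 := fun ξ => by
    have := frame_mem h.pair (0 : E →L[ℝ] 𝔰) (h.e_mem x) 0 (0, ξ)
    simpa [frame_apply, hρ] using this
  have hprinj : ∀ ξ, (pr (ρ ξ) : 𝔄) = ρ ξ := fun ξ => congrArg Subtype.val (hpr ⟨_, hmem ξ⟩)
  obtain ⟨b, hb⟩ := exists_coprod_det_pos ((pr ∘L ρ : 𝔥 →L[ℝ] 𝔰) : 𝔥 →ₗ[ℝ] 𝔰) (by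
    intro ξ ξ' hξ
    apply h.injective_infinitesimal x
    rw [← hρ, ← hprinj ξ, ← hprinj ξ']
    exact congrArg Subtype.val hξ) J.toLinearEquiv
  refine ⟨b.toContinuousLinearMap, ?_⟩
  rw [frameDet, ContinuousLinearMap.det]
  convert hb using 2
  apply LinearMap.ext
  intro p
  have h1 : frame l r b.toContinuousLinearMap (e x) 0 p = b p.1 + ρ p.2 := by
    simp [frame_apply, hρ]
  simp [h1, hpr]

/-- If two slice points near `x` lie in one orbit, the group element between them is a value of `δ`
near `δ x x = 1`, hence `cay ξ` with `ξ` small. Then `(v, ξ)` and `(w, 0)` have the same image under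
the tube, which is locally injective. -/
theorem eventually_injective (J : 𝔰 ≃L[ℝ] E × 𝔥) (pr : 𝔄 →L[ℝ] 𝔰) (hpr : ∀ s : 𝔰, pr s = s)
    (x : S) (b : E →L[ℝ] 𝔰) (hb : 0 < frameDet l r J pr b (e x) 0) (σ : E → S)
    (hσ : ∀ v, (e (σ v) : 𝔄) = slice b (e x : 𝔄) v) :
    ∀ᶠ p in nhds ((0, 0) : E × E), π (σ p.1) = π (σ p.2) → p.1 = p.2 := by
  have := FiniteDimensional.complete ℝ 𝔅
  obtain ⟨G, -, -, -, hG⟩ := exists_localInverse_tube h.pair b (h.e_mem x) 0 J pr hpr hb.ne'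
  obtain ⟨prH, hprH⟩ := 𝔥.subtype.exists_leftInverse_of_injective 𝔥.ker_subtype
  have hprH' : ∀ ξ : 𝔥, prH.toContinuousLinearMap ξ = ξ := fun ξ => LinearMap.congr_fun hprH ξ
  set prH' := prH.toContinuousLinearMap
  have hσc := h.continuous_σ hσ
  have hσ0 : σ 0 = x := h.injective_e (Units.ext (by rw [hσ, slice_zero]))
  have hδ : ContinuousAt (fun p : E × E => δ (σ p.1) (σ p.2)) (0, 0) :=
    (h.continuous_δ.comp ((hσc.comp continuous_fst).prodMk (hσc.comp continuous_snd))).continuousAt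
  have hδ0 : δ (σ 0) (σ 0) = 1 := h.δ_self _
  have hu : ∀ᶠ p in nhds ((0, 0) : E × E), IsUnit (δ (σ p.1) (σ p.2) + 1) := by
    apply hδ.eventually (p := fun u => IsUnit (u + 1))
    simp only [hδ0]
    exact eventually_isUnit_add_one
  have hcay : ContinuousAt (cayInv : 𝔅 → 𝔅) (δ (σ 0) (σ 0)) := by
    rw [hδ0]; exact (contDiffAt_cayInv isUnit_one_add_one (n := 0)).continuousAt
  have hc : ContinuousAt (fun p : E × E => (p.1, prH' (cayInv (δ (σ p.1) (σ p.2))))) (0, 0) :=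
    continuousAt_fst.prodMk (prH'.continuous.continuousAt.comp
      (ContinuousAt.comp (g := cayInv) (x := ((0, 0) : E × E)) hcay hδ))
  have hG1 := hc.eventually (p := fun p => G (tube l r b (e x : 𝔄) p) = p) (by
    simpa [hδ0, cayInv_one] using hG)
  have hc2 : ContinuousAt (fun p : E × E => (p.2, (0 : 𝔥))) (0, 0) := by fun_prop
  have hG2 := hc2.eventually (p := fun p => G (tube l r b (e x : 𝔄) p) = p) hG
  filter_upwards [hu, hG1, hG2] with p hp1 hp2 hp3 hp
  obtain ⟨u, huH, hu1⟩ := (h.rel _ _).1 hp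
  have hu2 := h.δ_spec _ _ u huH hu1
  rw [← hu2] at hp1 hp2
  set ξ : 𝔥 := ⟨cayInv (u : 𝔅), h.pair.right.cayInv_mem huH hp1⟩ with hξ
  have hξ' : prH' (cayInv (u : 𝔅)) = ξ := hprH' ξ
  rw [hξ'] at hp2
  have hn := h.pair.right.isUnit_one_sub _ ξ.2
  have hcu : cay (ξ : 𝔅) = u := cay_cayInv hp1
  have ht : tube l r b (e x : 𝔄) (p.1, ξ) = tube l r b (e x : 𝔄) (p.2, (0 : 𝔥)) := by
    obtain ⟨a, -, ha1, ha2⟩ := tube_eq_smul h.pair b (e x : 𝔄) (p.1, ξ)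
    have hau : a = u := Units.ext (ha1.trans hcu)
    rw [ha2, tube_zero, hau, ← hσ, ← hσ, hu1]
  rw [ht, hp3] at hp2
  exact (congrArg Prod.fst hp2).symm

theorem nonempty_localSlice [Nontrivial E] (J : 𝔰 ≃L[ℝ] E × 𝔥) (pr : 𝔄 →L[ℝ] 𝔰)
    (hpr : ∀ s : 𝔰, pr s = s) (x : S) : Nonempty (LocalSlice l r e π J pr x) := by
  obtain ⟨b, hb⟩ := h.exists_direction J pr hpr x
  obtain ⟨σ, hσ⟩ := h.exists_σ b x
  have h1 := h.eventually_injective J pr hpr x b hb σ hσ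
  rw [nhds_prod_eq] at h1
  obtain ⟨U, hU, hU1⟩ := (Filter.eventually_prod_self_iff
    (r := fun v w => π (σ v) = π (σ w) → v = w)).1 h1
  refine ⟨⟨b, σ, interior U ∩ {v | 0 < frameDet l r J pr b (e x) v},
    isOpen_interior.inter (isOpen_lt continuous_const (h.continuous_frameDet J pr b _)),
    ⟨mem_interior_iff_mem_nhds.2 hU, hb⟩, h.injective_e (Units.ext (by rw [hσ, slice_zero])), hσ,
    fun v hv => hv.2, fun v hv w hw hvw => hU1 v (interior_subset hv.1) w (interior_subset hw.1) hvw⟩⟩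

end IsCayleyQuotient
end Slices

/-! ### Charts from local slices, and the sign of their transition maps. -/

section Charts

variable {𝔄 𝔅 S Q : Type*} [NormedRing 𝔄] [NormedAlgebra ℝ 𝔄] [NormedRing 𝔅] [NormedAlgebra ℝ 𝔅]
  [TopologicalSpace S] [TopologicalSpace Q]
  {E : Type*} [NormedAddCommGroup E] [NormedSpace ℝ E]
  {P : Subgroup 𝔄ˣ} {𝔰 : Submodule ℝ 𝔄} {H : Subgroup 𝔅ˣ} {𝔥 : Submodule ℝ 𝔅}
  {l r : 𝔅 →ₐ[ℝ] 𝔄} {e : S → 𝔄ˣ} {π : S → Q} {δ : S → S → 𝔅}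
  [FiniteDimensional ℝ 𝔄] [FiniteDimensional ℝ 𝔅] [FiniteDimensional ℝ E]
  {J : 𝔰 ≃L[ℝ] E × 𝔥} {pr : 𝔄 →L[ℝ] 𝔰}

namespace LocalSlice

variable (h : IsCayleyQuotient P 𝔰 H 𝔥 l r e π δ) (hpr : ∀ s : 𝔰, pr s = s) {x y : S}
  (c : LocalSlice l r e π J pr x) (c' : LocalSlice l r e π J pr y)

include h

theorem continuous_σ : Continuous c.σ := h.continuous_σ c.e_σ

theorem contDiff_e_σ {k : WithTop ℕ∞} : ContDiff ℝ k fun v => (e (c.σ v) : 𝔄) := by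
  have : (fun v => (e (c.σ v) : 𝔄)) = slice c.b (e x : 𝔄) := funext c.e_σ
  rw [this]; exact contDiff_slice h.pair.left _ _

include hpr

theorem exists_localInverse {v : E} (hv : v ∈ c.D) :
    ∃ G : 𝔄 → E × 𝔥, ContDiffAt ℝ ω G (e (c.σ v)) ∧ G (e (c.σ v)) = (v, 0) ∧
      ∀ᶠ u in nhds (e (c.σ v) : 𝔄), (G u).1 ∈ c.D ∧ ∀ s : S, (e s : 𝔄) = u →
        tube l r c.b (e x : 𝔄) (G u) = u ∧ π (c.σ (G u).1) = π s := by
  obtain ⟨G, hG1, hG2, hG3, -⟩ := exists_localInverse_tube h.pair c.b (h.e_mem x) v J pr hpr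
    (c.det_pos v hv).ne'
  rw [← c.e_σ] at hG1 hG2 hG3
  refine ⟨G, hG1, hG2, ?_⟩
  have h1 : ∀ᶠ u in nhds (e (c.σ v) : 𝔄), (G u).1 ∈ c.D := by
    apply (continuous_fst.continuousAt.comp hG1.continuousAt).eventually (p := fun v => v ∈ c.D)
    simp only [Function.comp_apply, hG2]
    exact c.isOpen.mem_nhds hv
  filter_upwards [hG3, h1] with u hu1 hu2
  refine ⟨hu2, fun s hs => ?_⟩
  have h2 := hu1 (e s) (h.e_mem s) hs
  refine ⟨h2, (h.rel _ _).2 ?_⟩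
  obtain ⟨a, ha, -, ha2⟩ := tube_eq_smul h.pair c.b (e x : 𝔄) (G u)
  exact ⟨a, ha, by rw [hs, c.e_σ, ← ha2, h2]⟩

/-- The points near `c.σ v` can be moved along their orbits into the slice with parameter in `U`,
and `π` is open. -/
theorem image_mem_nhds {v : E} (hv : v ∈ c.D) {U : Set E} (hU : U ∈ nhds v) :
    (fun v => π (c.σ v)) '' U ∈ nhds (π (c.σ v)) := by
  obtain ⟨G, hG1, hG2, hG3⟩ := c.exists_localInverse h hpr hv
  have h1 : ∀ᶠ u in nhds (e (c.σ v) : 𝔄), (G u).1 ∈ U := by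
    apply (continuous_fst.continuousAt.comp hG1.continuousAt).eventually (p := fun v => v ∈ U)
    simp only [Function.comp_apply, hG2]
    exact hU
  have h2 := (h.inducing_e.continuous.continuousAt (x := c.σ v)).eventually (hG3.and h1)
  refine Filter.mem_of_superset (h.quot.isOpenMap.image_mem_nhds h2) ?_
  rintro _ ⟨s, ⟨hs1, hs2⟩, rfl⟩
  exact ⟨_, hs2, (hs1.2 s rfl).2⟩

theorem isOpenMap_domRestrict : IsOpenMap (Set.domRestrict c.D fun v => π (c.σ v)) := by
  rw [isOpenMap_iff_nhds_le]
  rintro ⟨v, hv⟩ U hU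
  have h2 : Subtype.val '' ((Set.domRestrict c.D fun v => π (c.σ v)) ⁻¹' U) ∈ nhds v :=
    c.isOpen.isOpenMap_subtype_val.image_mem_nhds hU
  refine Filter.mem_of_superset (c.image_mem_nhds h hpr hv h2) ?_
  rintro _ ⟨_, ⟨w, hw, rfl⟩, rfl⟩
  exact hw

/-- The chart of the orbit space given by a local slice. -/
def chart : OpenPartialHomeomorph Q E :=
  (OpenPartialHomeomorph.ofContinuousOpenRestrict (c.injOn.toPartialEquiv _ _)
    (h.quot.continuous.comp (c.continuous_σ h)).continuousOn (c.isOpenMap_domRestrict h hpr)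
    c.isOpen).symm

@[simp] theorem chart_target : (c.chart h hpr).target = c.D := rfl

@[simp] theorem chart_symm (v : E) : (c.chart h hpr).symm v = π (c.σ v) := rfl

theorem mem_chart_source {v : E} (hv : v ∈ c.D) : π (c.σ v) ∈ (c.chart h hpr).source :=
  (c.chart h hpr).map_target hv

theorem chart_apply {v : E} (hv : v ∈ c.D) : c.chart h hpr (π (c.σ v)) = v :=
  (c.chart h hpr).right_inv hv

theorem exists_of_mem_source {p : Q} (hp : p ∈ (c.chart h hpr).source) :
    ∃ v ∈ c.D, π (c.σ v) = p := ⟨_, (c.chart h hpr).map_source hp, (c.chart h hpr).left_inv hp⟩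

/-- The transition between two charts, together with the translation between the slices. -/
theorem exists_transition {v w : E} (hw : w ∈ c'.D) (hvw : π (c.σ v) = π (c'.σ w)) :
    ∃ W : E → E × 𝔥, ContDiffAt ℝ ω W v ∧ W v = (w, 0) ∧
      (∀ᶠ v' in nhds v, c'.chart h hpr (π (c.σ v')) = (W v').1) ∧
      ∃ a ∈ H, ∀ᶠ v' in nhds v, l (↑a⁻¹ : 𝔅) * e (c.σ v') * r (a : 𝔅) =
        tube l r c'.b (e y : 𝔄) (W v') := by
  obtain ⟨a, ha, ha1⟩ := (h.rel _ _).1 hvw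
  obtain ⟨G, hG1, hG2, hG3⟩ := c'.exists_localInverse h hpr hw
  -- One fixed group element `a` carries the first slice to a transversal through the point `c'.σ
  -- w`. Tube coordinates of the second slice then describe this transversal, and their `E`
  -- component is the transition map.
  set T : E → 𝔄 := fun v' => l (↑a⁻¹ : 𝔅) * e (c.σ v') * r (a : 𝔅) with hT
  have hTs : ContDiffAt ℝ ω T v :=
    ((contDiff_const.mul (c.contDiff_e_σ h)).mul contDiff_const).contDiffAt
  have hTv : T v = e (c'.σ w) := ha1.symm
  have hTG := hTs.continuousAt.eventually (hTv ▸ hG3)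
  have key : ∀ v', ∃ s, (e s : 𝔄) = T v' ∧ π (c.σ v') = π s := by
    intro v'
    obtain ⟨s, hs⟩ := h.exists_eq (mul_mem (mul_mem (h.pair.l_mem _ (inv_mem ha)) (h.e_mem (c.σ v')))
      (h.pair.r_mem _ ha))
    have hs' : (e s : 𝔄) = T v' := by rw [hs]; rfl
    exact ⟨s, hs', (h.rel _ _).2 ⟨a, ha, hs'⟩⟩
  refine ⟨fun v' => G (T v'), (hTv ▸ hG1).comp v hTs, by simp only [hTv, hG2], ?_, a, ha, ?_⟩
  · filter_upwards [hTG] with v' hv'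
    obtain ⟨s, hs, hs'⟩ := key v'
    have h1 := (hv'.2 s hs).2
    rw [hs', ← h1]
    exact c'.chart_apply h hpr hv'.1
  · filter_upwards [hTG] with v' hv'
    obtain ⟨s, hs, hs'⟩ := key v'
    exact (hv'.2 s hs).1.symm

theorem contDiffAt_transition {v : E} (hv' : π (c.σ v) ∈ (c'.chart h hpr).source) :
    ContDiffAt ℝ ω (fun v => c'.chart h hpr (π (c.σ v))) v := by
  obtain ⟨w, hw, hw'⟩ := c'.exists_of_mem_source h hpr hv'
  obtain ⟨W, hW, -, hW1, -⟩ := c.exists_transition h hpr c' hw hw'.symm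
  exact (contDiff_fst.contDiffAt.comp v hW).congr_of_eventuallyEq hW1

/-- Differentiating the translation between the slices compares the two frames: the second frame,
composed with a block triangular map with diagonal blocks the Jacobian of the transition and `Ad
a⁻¹`, equals the first frame followed by `Ad (r a)⁻¹`. All determinants other than the Jacobian are
positive, so the Jacobian is positive as well. -/
theorem det_transition_pos {v : E} (hv : v ∈ c.D) (hv' : π (c.σ v) ∈ (c'.chart h hpr).source) :
    0 < (fderiv ℝ (fun v => c'.chart h hpr (π (c.σ v))) v).det := by
  obtain ⟨w, hw, hw'⟩ := c'.exists_of_mem_source h hpr hv'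
  obtain ⟨W, hW, hWv, hW1, a, ha, hW2⟩ := c.exists_transition h hpr c' hw hw'.symm
  have hWd : HasFDerivAt W (fderiv ℝ W v) v := (hW.differentiableAt (by simp)).hasFDerivAt
  set W' := fderiv ℝ W v
  have hfd : fderiv ℝ (fun v => c'.chart h hpr (π (c.σ v))) v =
      ContinuousLinearMap.fst ℝ E 𝔥 ∘L W' :=
    ((hasFDerivAt_fst.comp v hWd).congr_of_eventuallyEq hW1).fderiv
  rw [hfd]
  -- the points of the two slices
  obtain ⟨u, hu, hu1, hu2⟩ := slice_mem h.pair.left c.b (h.e_mem x) v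
  obtain ⟨u', hu', hu1', hu2'⟩ := slice_mem h.pair.left c'.b (h.e_mem y) w
  have hra := h.pair.r_mem a ha
  have huu : (u' : 𝔄) = l (↑a⁻¹ : 𝔅) * u * r (a : 𝔅) := by
    have h1 := hW2.self_of_nhds
    rw [hWv, tube_zero, c.e_σ] at h1
    rw [hu1, hu1', h1]
  have huu' : (u : 𝔄) * r (a : 𝔅) = l (a : 𝔅) * u' := by
    rw [huu, ← mul_assoc, ← mul_assoc, ← map_mul]; simp
  -- the derivative of the two sides
  have hσ := hasFDerivAt_slice h.pair.left c.b (e x : 𝔄) v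
  rw [← show (fun v' => (e (c.σ v') : 𝔄)) = slice c.b (e x : 𝔄) from funext c.e_σ] at hσ
  have hL := (hσ.const_mul (l (↑a⁻¹ : 𝔅))).mul_const' (r (a : 𝔅))
  have hR := by
    have h1 := hasFDerivAt_tube h.pair c'.b (h.e_mem y) w
    rw [← hWv] at h1
    exact HasFDerivAt.comp (g := tube l r c'.b (e y : 𝔄)) v h1 hWd
  have hLR := hL.unique (hR.congr_of_eventuallyEq hW2)
  have hframe : ∀ d : E, frame l r c'.b (e y) w (W' d) =
      r (↑a⁻¹ : 𝔅) * frame l r c.b (e x) v (d, (0 : 𝔥)) * r (a : 𝔅) := by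
    intro d
    have h1 := congrArg (fun L => (2⁻¹ : ℝ) • ((↑u'⁻¹ : 𝔄) * L d)) hLR
    simp only [ContinuousLinearMap.comp_apply, smul_apply,
      ContinuousLinearMap.mul_apply', ← hu1', mul_smul_comm, smul_smul] at h1
    have h3 : (↑u'⁻¹ : 𝔄) * l (↑a⁻¹ : 𝔅) * u = r (↑a⁻¹ : 𝔅) := by
      have h4 : (↑u'⁻¹ : 𝔄) * l (↑a⁻¹ : 𝔅) * (u * r (a : 𝔅)) = 1 := by
        rw [huu', mul_assoc, ← mul_assoc (l _), ← map_mul]; simp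
      have h5 : r (a : 𝔅) * r (↑a⁻¹ : 𝔅) = 1 := by rw [← map_mul]; simp
      rw [← mul_one ((↑u'⁻¹ : 𝔄) * l (↑a⁻¹ : 𝔅) * u), ← h5, mul_assoc, ← mul_assoc (u : 𝔄),
        ← mul_assoc, h4, one_mul]
    rw [frame_apply c.b (e x) v]
    simp only [← h3, map_zero, mul_zero, zero_mul, sub_zero, add_zero, ZeroMemClass.coe_zero]
    simpa [mul_assoc, show (e (c.σ v) : 𝔄) = u by rw [c.e_σ, hu1]] using h1.symm
  set A := h.pair.right.adjoint a⁻¹ (inv_mem ha) with hA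
  set Ad := h.pair.left.adjoint (Units.map (r : 𝔅 →* 𝔄) a)⁻¹ (inv_mem hra) with hAd
  -- On the orbit directions no differentiation is needed: the comparison follows from `u * r a = l
  -- a * u'`.
  have hframe2 : ∀ ζ : 𝔥, frame l r c'.b (e y) w ((0 : E), A ζ) =
      r (↑a⁻¹ : 𝔅) * frame l r c.b (e x) v ((0 : E), ζ) * r (a : 𝔅) := by
    intro ζ
    have h5 : (↑u'⁻¹ : 𝔄) * l (↑a⁻¹ : 𝔅) = r (↑a⁻¹ : 𝔅) * ↑u⁻¹ := by
      have h6 : u'⁻¹ * (Units.map (l : 𝔅 →* 𝔄) a)⁻¹ = (Units.map (r : 𝔅 →* 𝔄) a)⁻¹ * u⁻¹ := by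
        rw [← mul_inv_rev, ← mul_inv_rev]
        congr 1
        ext
        simpa using huu'.symm
      have := congrArg Units.val h6
      simpa using this
    rw [frame_apply, frame_apply, ← hu2, ← hu2', ← hu1, ← hu1']
    simp only [map_zero, ZeroMemClass.coe_zero, mul_zero, zero_mul, zero_add, hA,
      IsCayley.adjoint_apply, map_mul, inv_inv, mul_sub, sub_mul]
    congr 1
    rw [← mul_assoc, ← mul_assoc, h5]
    simp only [mul_assoc]
    rw [huu']
  -- The two comparisons combined into one equation of endomorphisms of `E × 𝔥`, of which
  -- determinants can be taken.
  have hmain : (((J : 𝔰 →L[ℝ] E × 𝔥) ∘L pr ∘L frame l r c'.b (e y) w :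
        E × 𝔥 →L[ℝ] E × 𝔥) : E × 𝔥 →ₗ[ℝ] E × 𝔥) ∘ₗ
      (((LinearMap.fst ℝ E 𝔥 ∘ₗ (W' : E →ₗ[ℝ] E × 𝔥)).prod
        (LinearMap.snd ℝ E 𝔥 ∘ₗ (W' : E →ₗ[ℝ] E × 𝔥))).coprod (LinearMap.inr ℝ E 𝔥 ∘ₗ A)) =
      ((J.toLinearEquiv : 𝔰 →ₗ[ℝ] E × 𝔥) ∘ₗ Ad ∘ₗ (J.toLinearEquiv.symm : E × 𝔥 →ₗ[ℝ] 𝔰)) ∘ₗ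
        (((J : 𝔰 →L[ℝ] E × 𝔥) ∘L pr ∘L frame l r c.b (e x) v :
        E × 𝔥 →L[ℝ] E × 𝔥) : E × 𝔥 →ₗ[ℝ] E × 𝔥) := by
    have key : ∀ p : E × 𝔥, ∀ p' : E × 𝔥, frame l r c'.b (e y) w p' =
        r (↑a⁻¹ : 𝔅) * frame l r c.b (e x) v p * r (a : 𝔅) →
        pr (frame l r c'.b (e y) w p') = Ad (pr (frame l r c.b (e x) v p)) := by
      intro p p' hp
      apply Subtype.ext
      have e1 := congrArg Subtype.val (hpr ⟨_, frame_mem h.pair c'.b (h.e_mem y) w p'⟩)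
      have e2 := congrArg Subtype.val (hpr ⟨_, frame_mem h.pair c.b (h.e_mem x) v p⟩)
      simp only at e1 e2
      rw [hAd, IsCayley.adjoint_apply, e1, e2, hp]
      simp
    apply LinearMap.prod_ext
    · ext1 d
      have h0 : frame l r c'.b (e y) w ((0 : E), (0 : 𝔥)) = 0 := map_zero _
      simpa [h0] using congrArg J (key (d, 0) (W' d) (hframe d))
    · ext1 ζ
      simpa using key (0, ζ) (0, A ζ) (hframe2 ζ)
  have hd := congrArg LinearMap.det hmain
  rw [LinearMap.det_comp, LinearMap.det_comp, det_lowerTriangular] at hd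
  have hc : LinearMap.det ((J.toLinearEquiv : 𝔰 →ₗ[ℝ] E × 𝔥) ∘ₗ Ad ∘ₗ
      (J.toLinearEquiv.symm : E × 𝔥 →ₗ[ℝ] 𝔰)) = LinearMap.det Ad :=
    LinearMap.det_conj Ad J.toLinearEquiv
  rw [hc] at hd
  have p1 : 0 < LinearMap.det (((J : 𝔰 →L[ℝ] E × 𝔥) ∘L pr ∘L frame l r c'.b (e y) w :
        E × 𝔥 →L[ℝ] E × 𝔥) : E × 𝔥 →ₗ[ℝ] E × 𝔥) := c'.det_pos w hw
  have p2 : 0 < LinearMap.det (((J : 𝔰 →L[ℝ] E × 𝔥) ∘L pr ∘L frame l r c.b (e x) v :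
        E × 𝔥 →L[ℝ] E × 𝔥) : E × 𝔥 →ₗ[ℝ] E × 𝔥) := c.det_pos v hv
  have p3 : 0 < LinearMap.det A := h.pair.right.det_adjoint_pos _ _
  have p4 : 0 < LinearMap.det Ad := h.pair.left.det_adjoint_pos _ _
  have p5 := mul_pos p4 p2
  rw [← hd] at p5
  exact pos_of_mul_pos_left (pos_of_mul_pos_right p5 p1.le) p3.le

end LocalSlice
end Charts

/-! ### The orbit space as an oriented smooth manifold. -/

section QuotientManifold

variable {𝔄 𝔅 S Q W : Type*} [NormedRing 𝔄] [NormedAlgebra ℝ 𝔄] [NormedRing 𝔅]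
  [NormedAlgebra ℝ 𝔅] [TopologicalSpace S] [TopologicalSpace Q]
  [NormedAddCommGroup W] [NormedSpace ℝ W]
  {P : Subgroup 𝔄ˣ} {𝔰 : Submodule ℝ 𝔄} {H : Subgroup 𝔅ˣ} {𝔥 : Submodule ℝ 𝔅}
  {l r : 𝔅 →ₐ[ℝ] 𝔄} {e : S → 𝔄ˣ} {π : S → Q} {δ : S → S → 𝔅}
  [FiniteDimensional ℝ 𝔄] [FiniteDimensional ℝ 𝔅]

namespace IsCayleyQuotient

variable (h : IsCayleyQuotient P 𝔰 H 𝔥 l r e π δ)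

include h

/-- The quotient map is open, so it suffices that the orbit relation is closed. It is described by
conditions on the continuous function `δ`: its value lies in the closed set `H` and satisfies the
equation of the action, written without inverses. -/
theorem t2Space : T2Space Q := by
  rw [t2Space_iff_of_isOpenQuotientMap h.quot]
  have h1 : {q : S × S | π q.1 = π q.2} =
      {q | δ q.1 q.2 ∈ (fun h : 𝔅ˣ => (h : 𝔅)) '' H} ∩
        {q | l (δ q.1 q.2) * e q.2 = e q.1 * r (δ q.1 q.2)} := by
    ext ⟨x, y⟩
    simp only [Set.mem_ofPred_eq, Set.mem_inter_iff, h.rel]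
    have key : ∀ a : 𝔅ˣ, (e y : 𝔄) = l (↑a⁻¹ : 𝔅) * e x * r (a : 𝔅) ↔
        l (a : 𝔅) * e y = e x * r (a : 𝔅) := by
      intro a
      have h2 : l (a : 𝔅) * l (↑a⁻¹ : 𝔅) = 1 := by rw [← map_mul]; simp
      have h3 : l (↑a⁻¹ : 𝔅) * l (a : 𝔅) = 1 := by rw [← map_mul]; simp
      constructor
      · intro h4
        rw [h4, mul_assoc, ← mul_assoc, h2, one_mul]
      · intro h4
        rw [mul_assoc, ← h4, ← mul_assoc, h3, one_mul]
    constructor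
    · rintro ⟨a, ha, ha1⟩
      have h2 := h.δ_spec x y a ha ha1
      exact ⟨⟨a, ha, h2⟩, h2 ▸ (key a).1 ha1⟩
    · rintro ⟨⟨a, ha, ha1⟩, ha2⟩
      exact ⟨a, ha, (key a).2 (by rw [show (a : 𝔅) = δ x y from ha1]; exact ha2)⟩
  rw [h1]
  have hl : Continuous l := l.toLinearMap.continuous_of_finiteDimensional
  have hr : Continuous r := r.toLinearMap.continuous_of_finiteDimensional
  have he := h.inducing_e.continuous
  have hδ : Continuous fun q : S × S => δ q.1 q.2 := h.continuous_δ
  exact (h.isClosed.preimage hδ).inter (isClosed_eq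
    ((hl.comp hδ).mul (he.comp continuous_snd)) ((he.comp continuous_fst).mul (hr.comp hδ)))

theorem secondCountableTopology : SecondCountableTopology Q := by
  have : ProperSpace 𝔄 := FiniteDimensional.proper ℝ 𝔄
  have : SecondCountableTopology S := h.inducing_e.secondCountableTopology
  exact h.quot.isQuotientMap.secondCountableTopology h.quot.isOpenMap

/-- The orbit space is an orientable quotient manifold. -/
theorem exists_isQuotientManifold {n : ℕ} (hn : n ≠ 0)
    (hdim : Module.finrank ℝ 𝔰 = n + Module.finrank ℝ 𝔥) (Λ : 𝔄 →L[ℝ] W) (Λ' : W →L[ℝ] 𝔄)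
    (hΛ : ∀ a, Λ' (Λ a) = a) :
    ∃ _ : ChartedSpace (EuclideanSpace ℝ (Fin n)) Q,
      IsQuotientManifold (fun s => Λ (e s)) π n ∧
      ∃ A : Set (OpenPartialHomeomorph Q (EuclideanSpace ℝ (Fin n))), IsOrientedAtlas A := by
  have : Nontrivial (EuclideanSpace ℝ (Fin n)) :=
    Module.nontrivial_of_finrank_pos (R := ℝ) (by simpa using Nat.pos_of_ne_zero hn)
  let J : 𝔰 ≃L[ℝ] EuclideanSpace ℝ (Fin n) × 𝔥 := ContinuousLinearEquiv.ofFinrankEq (by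
    rw [hdim, Module.finrank_prod, finrank_euclideanSpace_fin])
  obtain ⟨pr₀, hpr₀⟩ := 𝔰.subtype.exists_leftInverse_of_injective 𝔰.ker_subtype
  let pr : 𝔄 →L[ℝ] 𝔰 := pr₀.toContinuousLinearMap
  have hpr : ∀ s : 𝔰, pr s = s := fun s => LinearMap.congr_fun hpr₀ s
  let c := fun x => Classical.choice (h.nonempty_localSlice J pr hpr x)
  let φ : S → OpenPartialHomeomorph Q (EuclideanSpace ℝ (Fin n)) := fun x => (c x).chart h hpr
  have hmem : ∀ x, π x ∈ (φ x).source := fun x => by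
    have := (c x).mem_chart_source h hpr (c x).zero_mem
    rwa [(c x).σ_zero] at this
  have hφ0 : ∀ x, φ x (π x) = 0 := fun x => by
    have := (c x).chart_apply h hpr (c x).zero_mem
    rwa [(c x).σ_zero] at this
  let CS : ChartedSpace (EuclideanSpace ℝ (Fin n)) Q :=
    { atlas := Set.range φ
      chartAt := fun p => φ (Function.surjInv h.quot.surjective p)
      mem_chart_source := fun p => by
        have := hmem (Function.surjInv h.quot.surjective p)
        rwa [Function.surjInv_eq h.quot.surjective p] at this
      chart_mem_atlas := fun p => ⟨_, rfl⟩ }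
  have hman : IsManifold (𝓡 n) ∞ Q := by
    apply isManifold_of_contDiffOn
    rintro _ _ ⟨x, rfl⟩ ⟨y, rfl⟩ v hv
    simp only [modelWithCornersSelf_coe, modelWithCornersSelf_coe_symm, Set.range_id,
      Set.inter_univ, Set.preimage_id, Function.comp_id, Function.id_comp] at hv ⊢
    have hv1 : v ∈ (c x).D := hv.1
    have hv2 : π ((c x).σ v) ∈ (φ y).source := hv.2
    exact (((c x).contDiffAt_transition h hpr (c y) hv2).of_le (by simp)).contDiffWithinAt
  have hat : ∀ x, φ x ∈ IsManifold.maximalAtlas (𝓡 n) ∞ Q := fun x =>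
    IsManifold.subset_maximalAtlas ⟨x, rfl⟩
  refine ⟨CS, ⟨h.t2Space, h.secondCountableTopology, hman, fun x => ?_, fun x => ?_⟩, Set.range φ,
    ⟨?_, ?_, ?_⟩⟩
  -- The local inverse of the tube is defined on an open set of the ambient algebra. Its `E`
  -- component, read in the chart, extends `π` there.
  · obtain ⟨G, hG1, hG2, hG3⟩ := (c x).exists_localInverse h hpr (c x).zero_mem
    rw [(c x).σ_zero] at hG1 hG2 hG3
    obtain ⟨O, hO, hO1, hO2⟩ := eventually_nhds_iff.1 (hG3.and (hG1.eventually (by simp)))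
    refine ⟨Λ' ⁻¹' O, hO1.preimage Λ'.continuous, by rw [Set.mem_preimage, hΛ]; exact hO2,
      fun w => (φ x).symm (G (Λ' w)).1, ?_, fun s hs => ?_⟩
    · have h1 : ContMDiffOn (𝓡 n) (𝓡 n) ∞ (φ x).symm (φ x).target :=
        contMDiffOn_symm_of_mem_maximalAtlas (hat x)
      have h2 : ContMDiffOn 𝓘(ℝ, W) (𝓡 n) ∞ (fun w => (G (Λ' w)).1) (Λ' ⁻¹' O) := by
        rw [contMDiffOn_iff_contDiffOn]
        intro w hw
        exact ((contDiff_fst.contDiffAt.comp w (((hO _ hw).2.of_le (by simp)).comp w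
          Λ'.contDiff.contDiffAt))).contDiffWithinAt
      exact h1.comp h2 fun w hw => (hO _ hw).1.1
    · have hs' : (e s : 𝔄) ∈ O := by simpa [hΛ] using hs
      simp only [hΛ]
      exact ((hO _ hs').1.2 s rfl).2
  -- The slice itself is a local section.
  · refine ⟨(φ x).source, (φ x).open_source, hmem x, fun p => (c x).σ (φ x p), ?_, ?_, ?_⟩
    · simp only [hφ0, (c x).σ_zero]
    · exact fun p hp => (φ x).left_inv hp
    · have h1 : ContMDiffOn (𝓡 n) (𝓡 n) ∞ (φ x) (φ x).source := contMDiffOn_of_mem_maximalAtlas (hat x)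
      have h2 : ContMDiff (𝓡 n) 𝓘(ℝ, W) ∞ fun v => Λ (e ((c x).σ v)) :=
        (Λ.contDiff.comp ((c x).contDiff_e_σ h)).contMDiff
      exact h2.comp_contMDiffOn h1
  · rintro _ ⟨x, rfl⟩
    exact hat x
  · intro p
    obtain ⟨x, rfl⟩ := h.quot.surjective p
    exact ⟨_, ⟨x, rfl⟩, hmem x⟩
  · rintro _ ⟨x, rfl⟩ _ ⟨y, rfl⟩ p ⟨hp1, hp2⟩
    obtain ⟨v, hv, rfl⟩ := (c x).exists_of_mem_source h hpr hp1
    have := (c x).det_transition_pos h hpr (c y) hv hp2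
    rw [show φ x (π ((c x).σ v)) = v from (c x).chart_apply h hpr hv]
    exact this

end IsCayleyQuotient
end QuotientManifold

/-! ### The dimension of the centralizer of a finite group of unitary matrices -/

section Centralizer

variable {G : Type*} [Group G] {m : ℕ} (ρ : G →* U m)

/-- The matrix of `ρ g`. -/
abbrev mat (g : G) : Matrix (Fin m) (Fin m) ℂ := (ρ g : Matrix (Fin m) (Fin m) ℂ)

/-- The square of the absolute value of the character of `ρ`. -/
def normChar (g : G) : ℝ := Complex.normSq (mat ρ g).trace

theorem mat_mul (g h : G) : mat ρ (g * h) = mat ρ g * mat ρ h := by simp [mat]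

@[simp] theorem mat_one : mat ρ 1 = 1 := by simp [mat]

theorem star_mat (g : G) : star (mat ρ g) = mat ρ g⁻¹ := by
  change star (ρ g : Matrix (Fin m) (Fin m) ℂ) = ((ρ g⁻¹ : U m) : Matrix (Fin m) (Fin m) ℂ)
  rw [map_inv]; rfl

theorem trace_mat_inv (g : G) : (mat ρ g⁻¹).trace = star (mat ρ g).trace := by
  rw [← star_mat, Matrix.star_eq_conjTranspose, Matrix.trace_conjTranspose]

theorem trace_mat_conj (g h : G) : (mat ρ (h * g * h⁻¹)).trace = (mat ρ g).trace := by
  rw [mat_mul, Matrix.trace_mul_comm, ← mat_mul]; simp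

theorem normChar_conj (g h : G) : normChar ρ (h * g * h⁻¹) = normChar ρ g := by
  rw [normChar, trace_mat_conj, normChar]

theorem normChar_one : normChar ρ 1 = (m : ℝ) ^ 2 := by
  simp [normChar, Complex.normSq_apply]; ring

/-- The complex algebra of the matrices that commute with `ρ K`. -/
def commutant (K : Subgroup G) : Submodule ℂ (Matrix (Fin m) (Fin m) ℂ) where
  carrier := {x | ∀ k ∈ K, mat ρ k * x = x * mat ρ k}
  add_mem' := fun ha hb k hk => by rw [mul_add, add_mul, ha k hk, hb k hk]
  zero_mem' := fun k _ => by simp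
  smul_mem' := fun c x hx k hk => by rw [mul_smul_comm, smul_mul_assoc, hx k hk]

/-- The Lie algebra of the centralizer of `ρ K` in the unitary group. -/
def commLie (K : Subgroup G) : Submodule ℝ (Matrix (Fin m) (Fin m) ℂ) :=
  LieU m ⊓ (commutant ρ K).restrictScalars ℝ

theorem mem_commLie {K : Subgroup G} {x : Matrix (Fin m) (Fin m) ℂ} :
    x ∈ commLie ρ K ↔ star x = -x ∧ ∀ k ∈ K, mat ρ k * x = x * mat ρ k := Iff.rfl

theorem star_mem_commutant {K : Subgroup G} {x : Matrix (Fin m) (Fin m) ℂ}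
    (hx : x ∈ commutant ρ K) : star x ∈ commutant ρ K := by
  intro k hk
  have h := congrArg star (hx k⁻¹ (inv_mem hk))
  simpa [star_mul, star_mat] using h.symm

theorem trace_mulLeftRight {n : Type*} [Fintype n] [DecidableEq n] (A B : Matrix n n ℂ) :
    LinearMap.trace ℂ _ (LinearMap.mulLeftRight ℂ (A, B)) = A.trace * B.trace := by
  rw [LinearMap.trace_eq_matrix_trace ℂ (Matrix.stdBasis ℂ n n), Matrix.trace,
    Fintype.sum_prod_type, Matrix.trace, Matrix.trace, Finset.sum_mul_sum]
  refine Finset.sum_congr rfl fun i _ => Finset.sum_congr rfl fun j _ => ?_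
  rw [Matrix.diag_apply, LinearMap.toMatrix_apply, Matrix.stdBasis_eq_single]
  simp [Matrix.stdBasis, Matrix.mul_apply, Matrix.single_apply, ite_and]

/-- Averaging `x ↦ ρ(k) x ρ(k)⁻¹` over `K` is a projection onto the commutant, so its trace is the
dimension. Each summand has trace `χ(k) χ(k⁻¹) = |χ(k)|²`. -/
theorem finrank_commutant [Finite G] (K : Subgroup G) :
    (Module.finrank ℂ (commutant ρ K) : ℝ) * Nat.card K = ∑ᶠ k : K, normChar ρ k := by
  have := Fintype.ofFinite K
  set c : ℂ := (Nat.card K : ℂ)⁻¹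
  have hc : (Nat.card K : ℂ) ≠ 0 := Nat.cast_ne_zero.2 Nat.card_pos.ne'
  let p : Matrix (Fin m) (Fin m) ℂ →ₗ[ℂ] Matrix (Fin m) (Fin m) ℂ :=
    c • ∑ k : K, LinearMap.mulLeftRight ℂ (mat ρ k, mat ρ (k : G)⁻¹)
  have hp : LinearMap.IsProj (commutant ρ K) p := by
    constructor
    · intro x k hk
      have h1 : ∀ y, p y = c • ∑ k : K, mat ρ k * y * mat ρ (k : G)⁻¹ := fun y => by simp [p]
      rw [h1, mul_smul_comm, smul_mul_assoc, Finset.mul_sum, Finset.sum_mul]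
      congr 1
      refine Fintype.sum_equiv (Equiv.mulLeft ⟨k, hk⟩) _ _ fun j => ?_
      simp only [Equiv.coe_mulLeft, Subgroup.coe_mul, mul_inv_rev, mat_mul]
      simp only [mul_assoc]
      rw [← mat_mul ρ k⁻¹ k]
      simp
    · intro x hx
      have h1 : ∀ k : K, mat ρ k * x * mat ρ (k : G)⁻¹ = x := fun k => by
        rw [hx k k.2, mul_assoc, ← mat_mul]; simp
      simp [p, h1, c, ← Nat.card_eq_fintype_card, ← Nat.cast_smul_eq_nsmul ℂ, smul_smul, hc]
  have h1 := hp.trace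
  simp only [p, map_smul, map_sum, trace_mulLeftRight] at h1
  rw [finsum_eq_sum_of_fintype]
  have h2 : ((∑ k : K, normChar ρ k : ℝ) : ℂ) =
      ∑ k : K, (mat ρ (k : G)).trace * (mat ρ (k : G)⁻¹).trace := by
    push_cast
    refine Finset.sum_congr rfl fun k _ => ?_
    rw [trace_mat_inv, normChar, Complex.normSq_eq_conj_mul_self, mul_comm]; rfl
  rw [← h2, smul_eq_mul] at h1
  have h3 : ((Module.finrank ℂ (commutant ρ K) : ℂ)) * Nat.card K = (∑ k : K, normChar ρ k : ℝ) := by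
    rw [← h1, mul_comm, ← mul_assoc, mul_inv_cancel₀ hc, one_mul]
  exact_mod_cast h3

/-- The commutant is stable under the adjoint, so it is the direct sum of its skew-Hermitian part
and `i` times that part. -/
theorem finrank_commLie (K : Subgroup G) :
    Module.finrank ℝ (commLie ρ K) = Module.finrank ℂ (commutant ρ K) := by
  let f : commLie ρ K × commLie ρ K →ₗ[ℝ] (commutant ρ K).restrictScalars ℝ :=
    { toFun := fun p => ⟨p.1 + Complex.I • p.2, add_mem p.1.2.2
        ((commutant ρ K).smul_mem Complex.I p.2.2.2)⟩
      map_add' := fun p p' => by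
        ext1; simp only [Prod.fst_add, Prod.snd_add, Submodule.coe_add, smul_add]; abel
      map_smul' := fun a p => by
        ext1
        simp only [Prod.smul_fst, Prod.smul_snd, Submodule.coe_smul, RingHom.id_apply, smul_add]
        rw [smul_comm a Complex.I] }
  have hf : Function.Bijective f := by
    constructor
    · rw [injective_iff_map_eq_zero]
      rintro ⟨x, y⟩ hxy
      have h1 : (x : Matrix (Fin m) (Fin m) ℂ) + Complex.I • (y : Matrix (Fin m) (Fin m) ℂ) = 0 :=
        congrArg Subtype.val hxy
      have hx : star (x : Matrix (Fin m) (Fin m) ℂ) = -x := x.2.1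
      have hy : star (y : Matrix (Fin m) (Fin m) ℂ) = -y := y.2.1
      have h2 := congrArg star h1
      rw [star_add, star_smul, hx, hy, star_zero] at h2
      have h3 : -(x : Matrix (Fin m) (Fin m) ℂ) + Complex.I • (y : Matrix (Fin m) (Fin m) ℂ) = 0 := by
        rw [← h2]; simp
      have h4 : (x : Matrix (Fin m) (Fin m) ℂ) = 0 := by
        have : (2 : ℂ) • (x : Matrix (Fin m) (Fin m) ℂ) = 0 := by
          rw [two_smul]
          refine Eq.trans ?_ ((congrArg₂ (· - ·) h1 h3).trans (sub_zero 0))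
          abel
        simpa using this
      have h5 : (y : Matrix (Fin m) (Fin m) ℂ) = 0 := by
        rw [h4, zero_add] at h1
        simpa using h1
      exact Prod.ext (Subtype.ext h4) (Subtype.ext h5)
    · rintro ⟨z, hz⟩
      have hz' := star_mem_commutant ρ hz
      refine ⟨(⟨(2⁻¹ : ℝ) • (z - star z), ⟨?_, ?_⟩⟩,
        ⟨(2⁻¹ : ℝ) • (-Complex.I) • (z + star z), ⟨?_, ?_⟩⟩), Subtype.ext ?_⟩
      · change star _ = -_
        rw [star_smul, star_sub, star_star, ← smul_neg, neg_sub]; simp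
      · exact Submodule.smul_mem _ _ (sub_mem hz hz')
      · change star _ = -_
        rw [star_smul, star_smul, star_add, star_star, ← smul_neg, ← neg_smul, add_comm]; simp
      · exact Submodule.smul_mem _ _ ((commutant ρ K).smul_mem _ (add_mem hz hz'))
      · change (2⁻¹ : ℝ) • (z - star z) + Complex.I • (2⁻¹ : ℝ) • (-Complex.I) • (z + star z) = z
        rw [smul_comm Complex.I, smul_smul Complex.I, mul_neg, Complex.I_mul_I, neg_neg, one_smul,
          ← smul_add, sub_add_add_cancel, ← two_smul ℝ z, smul_smul]
        norm_num
  have h1 := (LinearEquiv.ofBijective f hf).finrank_eq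
  have h2 := finrank_real_of_complex (commutant ρ K)
  rw [Module.finrank_prod] at h1
  have h3 : Module.finrank ℝ ((commutant ρ K).restrictScalars ℝ) =
      Module.finrank ℝ (commutant ρ K) := rfl
  omega

theorem finrank_commLie_mul_card [Finite G] (K : Subgroup G) :
    (Module.finrank ℝ (commLie ρ K) : ℝ) * Nat.card K = ∑ᶠ k : K, normChar ρ k := by
  rw [finrank_commLie, finrank_commutant]

/-- The case of the trivial group, whose commutant is everything and whose only character value is
`m`. -/
theorem dimU_eq (m : ℕ) : dimU m = m ^ 2 := by
  have h1 := finrank_commLie_mul_card (1 : Multiplicative (ZMod 1) →* U m) ⊥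
  have h2 : commLie (1 : Multiplicative (ZMod 1) →* U m) ⊥ = LieU m := by
    ext x
    rw [mem_commLie]
    constructor
    · exact fun h => h.1
    · exact fun h => ⟨h, fun k _ => by simp [mat]⟩
  rw [h2, finsum_eq_sum_of_fintype] at h1
  simp [normChar, mat, Complex.normSq_apply] at h1
  rw [dimU, sq]
  exact_mod_cast h1

/-- Schur's lemma. -/
theorem finrank_commutant_top (hρ : (linearRep ρ).IsIrreducible) :
    Module.finrank ℂ (commutant ρ ⊤) = 1 := by
  rw [← Representation.IsIrreducible.finrank_intertwiningMap_self (linearRep ρ)]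
  have hap : ∀ g, linearRep ρ g = Matrix.toLin' (mat ρ g) := fun g => rfl
  refine LinearEquiv.finrank_eq
    { toFun := fun x => ⟨Matrix.toLin' (x : Matrix (Fin m) (Fin m) ℂ), fun g => by
        rw [hap, ← Matrix.toLin'_mul, ← Matrix.toLin'_mul, x.2 g trivial]⟩
      map_add' := fun x y => by ext; simp
      map_smul' := fun a x => by ext; simp
      invFun := fun f => ⟨LinearMap.toMatrix' f.toLinearMap, fun g _ => by
        apply Matrix.toLin'.injective
        rw [Matrix.toLin'_mul, Matrix.toLin'_mul, Matrix.toLin'_toMatrix', ← hap]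
        exact (f.isIntertwining' g).symm⟩
      left_inv := fun x => by ext1; simp
      right_inv := fun f => by
        apply Representation.IntertwiningMap.ext; simp }

theorem sum_normChar [Finite G] (hρ : (linearRep ρ).IsIrreducible) :
    ∑ᶠ g : G, normChar ρ g = Nat.card G := by
  have h := finrank_commutant ρ (⊤ : Subgroup G)
  rw [finrank_commutant_top ρ hρ, Nat.cast_one, one_mul, Subgroup.card_top] at h
  rw [h]
  exact finsum_eq_of_bijective _ Subgroup.topEquiv.symm.bijective fun g => rfl

/-- Central elements act by scalars of absolute value `1`. -/
theorem normChar_mul_of_central (hρ : (linearRep ρ).IsIrreducible) {z : G}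
    (hz : z ∈ Subgroup.center G) (g : G) : normChar ρ (z * g) = normChar ρ g := by
  have hm : mat ρ z ∈ commutant ρ ⊤ := fun k _ => by
    rw [← mat_mul, ← mat_mul, Subgroup.mem_center_iff.1 hz k]
  have h1 : (1 : Matrix (Fin m) (Fin m) ℂ) ∈ commutant ρ ⊤ := fun k _ => by simp
  have hm0 : (1 : Matrix (Fin m) (Fin m) ℂ) ≠ 0 := by
    intro h0
    have h2 := finrank_commutant_top ρ hρ
    have h3 : commutant ρ ⊤ = ⊥ := by
      rw [Submodule.eq_bot_iff]
      intro x _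
      rw [← one_mul x, h0, zero_mul]
    rw [h3, finrank_bot] at h2
    exact zero_ne_one h2
  obtain ⟨c, hc⟩ := (finrank_eq_one_iff_of_nonzero' (⟨1, h1⟩ : commutant ρ ⊤)
    (fun h => hm0 (congrArg Subtype.val h))).1 (finrank_commutant_top ρ hρ) ⟨mat ρ z, hm⟩
  have hc' : mat ρ z = c • 1 := (congrArg Subtype.val hc).symm
  have hn : Complex.normSq c = 1 := by
    have h2 : star (mat ρ z) * mat ρ z = 1 := (ρ z).2.1
    rw [hc', star_smul, star_one, smul_mul_smul_comm, mul_one] at h2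
    have h3 : (star c * c - 1) • (1 : Matrix (Fin m) (Fin m) ℂ) = 0 := by
      rw [sub_smul, h2, one_smul, sub_self]
    have h4 := (smul_eq_zero.1 h3).resolve_right hm0
    have h5 : ((Complex.normSq c : ℝ) : ℂ) = 1 := by
      rw [Complex.normSq_eq_conj_mul_self]
      exact sub_eq_zero.1 h4
    exact_mod_cast h5
  rw [normChar, mat_mul, hc', smul_mul_assoc, one_mul, Matrix.trace_smul, smul_eq_mul,
    Complex.normSq_mul, hn, one_mul, normChar]

end Centralizer

/-! ### The restriction to the unipotent group of a representation of `SL₂(F)` of small degree -/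

section Unipotent

variable {F : Type*} [Field F]

/-- The upper unipotent matrices. -/
def upp (x : F) : SL(2, F) := ⟨!![1, x; 0, 1], by simp [Matrix.det_fin_two_of]⟩

/-- The diagonal matrices. -/
def dia (a : Fˣ) : SL(2, F) := ⟨!![(a : F), 0; 0, ↑a⁻¹], by simp [Matrix.det_fin_two_of]⟩

/-- The matrices with a prescribed first column and trace. -/
def big (c : Fˣ) (a t : F) : SL(2, F) :=
  ⟨!![a, (a * (t - a) - 1) * ↑c⁻¹; (c : F), t - a], by
    rw [Matrix.det_fin_two_of, mul_assoc, Units.inv_mul, mul_one]; ring⟩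

theorem sl2_ext {g h : SL(2, F)} (h00 : g 0 0 = h 0 0) (h01 : g 0 1 = h 0 1) (h10 : g 1 0 = h 1 0)
    (h11 : g 1 1 = h 1 1) : g = h := by
  ext i j; fin_cases i <;> fin_cases j <;> assumption

theorem sl2_mul_apply (g h : SL(2, F)) (i j : Fin 2) :
    (g * h) i j = g i 0 * h 0 j + g i 1 * h 1 j := by
  rw [Matrix.SpecialLinearGroup.coe_mul, Matrix.mul_apply, Fin.sum_univ_two]

@[simp] theorem upp_00 (x : F) : upp x 0 0 = 1 := rfl
@[simp] theorem upp_01 (x : F) : upp x 0 1 = x := rfl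
@[simp] theorem upp_10 (x : F) : upp x 1 0 = 0 := rfl
@[simp] theorem upp_11 (x : F) : upp x 1 1 = 1 := rfl
@[simp] theorem dia_00 (a : Fˣ) : dia a 0 0 = a := rfl
@[simp] theorem dia_01 (a : Fˣ) : dia a 0 1 = 0 := rfl
@[simp] theorem dia_10 (a : Fˣ) : dia a 1 0 = 0 := rfl
@[simp] theorem dia_11 (a : Fˣ) : dia a 1 1 = ↑a⁻¹ := rfl
@[simp] theorem big_00 (c : Fˣ) (a t : F) : big c a t 0 0 = a := rfl
@[simp] theorem big_01 (c : Fˣ) (a t : F) : big c a t 0 1 = (a * (t - a) - 1) * ↑c⁻¹ := rfl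
@[simp] theorem big_10 (c : Fˣ) (a t : F) : big c a t 1 0 = c := rfl
@[simp] theorem big_11 (c : Fˣ) (a t : F) : big c a t 1 1 = t - a := rfl

theorem upp_add (x y : F) : upp (x + y) = upp x * upp y := by
  apply sl2_ext <;> simp [sl2_mul_apply, add_comm]

theorem upp_zero : upp (0 : F) = 1 := by
  apply sl2_ext <;> simp

theorem dia_mul_upp (a : Fˣ) (x : F) : dia a * upp x = upp (a * x * a) * dia a := by
  apply sl2_ext <;> simp [sl2_mul_apply]

theorem sl2_det (g : SL(2, F)) : g 0 0 * g 1 1 - g 0 1 * g 1 0 = 1 := by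
  have := g.2
  rwa [Matrix.det_fin_two] at this

/-- Conjugation by an upper unipotent matrix keeps the lower left entry and the trace and shifts `a`
arbitrarily. Class functions on these matrices therefore do not depend on `a`. -/
theorem conj_upp_big (c : Fˣ) (a t x : F) :
    upp x * big c a t = big c (a + x * c) t * upp x := by
  apply sl2_ext
  · simp [sl2_mul_apply]
  · simp only [sl2_mul_apply, upp_00, upp_01, upp_11, big_00, big_01, big_11]
    have hc : (↑c⁻¹ : F) * c = 1 := c.inv_mul
    linear_combination (x * (2 * a - t) + x ^ 2 * c) * hc
  · simp [sl2_mul_apply]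
  · simp [sl2_mul_apply]; ring

/-- A normal subgroup that contains the upper unipotent matrices is the whole group. -/
theorem eq_top_of_upp_mem (N : Subgroup SL(2, F)) [N.Normal] (hN : ∀ x, upp x ∈ N) : N = ⊤ := by
  have h1 : ∀ c : Fˣ, ∀ a t, big c a t ∈ N := by
    intro c a t
    -- This is the conjugate of `upp (-c)` by the Weyl element `big 1 0 0`, hence in `N`.
    have h0 : big c 1 2 ∈ N := by
      have h2 := Subgroup.Normal.conj_mem inferInstance _ (hN (-(c : F))) (big 1 0 0)
      convert h2 using 1
      rw [eq_mul_inv_iff_mul_eq]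
      apply sl2_ext <;> simp [sl2_mul_apply]
      all_goals norm_num
    have h3 : big c a t = upp ((a - 1) * ↑c⁻¹) * big c 1 2 * upp ((t - a - 1) * ↑c⁻¹) := by
      have hc : (↑c⁻¹ : F) * c = 1 := c.inv_mul
      apply sl2_ext
      · simp [sl2_mul_apply]
      · simp only [sl2_mul_apply, upp_00, upp_01, upp_11, big_00, big_01, big_10, big_11]
        linear_combination (-(a - 1) * (t - a - 1) * ↑c⁻¹) * hc
      · simp [sl2_mul_apply]
      · simp only [sl2_mul_apply, upp_01, upp_10, upp_11, big_00, big_01, big_10, big_11]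
        linear_combination (-(t - a - 1)) * hc
    rw [h3]
    exact mul_mem (mul_mem (hN _) h0) (hN _)
  have h2 : ∀ g : SL(2, F), g 1 0 ≠ 0 → g ∈ N := by
    intro g hg
    convert h1 (Units.mk0 _ hg) (g 0 0) (g 0 0 + g 1 1) using 1
    have := sl2_det g
    apply sl2_ext <;> simp
    rw [eq_mul_inv_iff_mul_eq₀ hg]
    linear_combination -this
  rw [eq_top_iff]
  intro g _
  by_cases hg : g 1 0 = 0
  · have hd := sl2_det g
    -- For triangular `g`, multiplication by the Weyl element makes the lower left entry nonzero.
    have h3 : g * big 1 0 0 ∈ N := by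
      apply h2
      rw [sl2_mul_apply]
      simp only [big_00, big_10, Units.val_one, mul_zero, mul_one, zero_add]
      intro h0
      rw [h0, hg] at hd
      simp at hd
    exact (mul_mem_cancel_right (h1 1 0 0)).1 h3
  · exact h2 g hg

variable [Fintype F] [DecidableEq F] {m : ℕ} (ρ : SL(2, F) →* U m) (ψ : AddChar F ℂ)

/-- The projection to a weight space of the unipotent group, times the order of the group. -/
def wt (a : F) : Matrix (Fin m) (Fin m) ℂ := ∑ x, ψ (-(a * x)) • mat ρ (upp x)

theorem wt_mul_upp (a y : F) : wt ρ ψ a * mat ρ (upp y) = ψ (a * y) • wt ρ ψ a := by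
  rw [wt, Finset.sum_mul, Finset.smul_sum]
  refine Fintype.sum_equiv (Equiv.addRight y) _ _ fun x => ?_
  rw [smul_mul_assoc, ← mat_mul, ← upp_add, smul_smul, ← AddChar.map_add_eq_mul]
  congr 2
  simp only [Equiv.coe_addRight]
  ring

theorem wt_mul_self (a : F) : wt ρ ψ a * wt ρ ψ a = (Fintype.card F : ℂ) • wt ρ ψ a := by
  rw [show wt ρ ψ a * wt ρ ψ a = wt ρ ψ a * ∑ x, ψ (-(a * x)) • mat ρ (upp x) from rfl,
    Finset.mul_sum]
  have : ∀ x, wt ρ ψ a * ψ (-(a * x)) • mat ρ (upp x) = wt ρ ψ a := fun x => by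
    rw [mul_smul_comm, wt_mul_upp, smul_smul, ← AddChar.map_add_eq_mul]; simp
  simp only [this, Finset.sum_const, Finset.card_univ, ← Nat.cast_smul_eq_nsmul ℂ]

/-- Fourier inversion on the additive group of `F`: the operator `upp y` is recovered from its
spectral projections. -/
theorem sum_wt (hψ : ψ.IsPrimitive) (y : F) :
    ∑ a, ψ (a * y) • wt ρ ψ a = (Fintype.card F : ℂ) • mat ρ (upp y) := by
  simp only [wt, Finset.smul_sum, smul_smul, ← AddChar.map_add_eq_mul]
  rw [Finset.sum_comm]
  have h1 : ∀ x, ∑ a, ψ (a * y + -(a * x)) • mat ρ (upp x) =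
      (if y - x = 0 then (Fintype.card F : ℂ) else 0) • mat ρ (upp x) := fun x => by
    rw [← Finset.sum_smul]
    congr 1
    have := AddChar.sum_mulShift (y - x) hψ
    push_cast at this
    rw [← this]
    refine Finset.sum_congr rfl fun a _ => ?_
    congr 1; ring
  simp only [h1, sub_eq_zero, ite_smul, zero_smul]
  simp

/-- The multiplicity of a weight. -/
theorem exists_mult (a : F) : ∃ n : ℕ, (wt ρ ψ a).trace = Fintype.card F * n ∧
    (n = 0 → wt ρ ψ a = 0) := by
  have hq : (Fintype.card F : ℂ) ≠ 0 := Nat.cast_ne_zero.2 Fintype.card_ne_zero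
  set p := (Fintype.card F : ℂ)⁻¹ • wt ρ ψ a with hp
  have hpp : p * p = p := by
    rw [hp, smul_mul_smul_comm, wt_mul_self, smul_smul]
    congr 1; field_simp
  have hid : IsIdempotentElem (Matrix.toLin' p) := by
    rw [IsIdempotentElem, Module.End.mul_eq_comp, ← Matrix.toLin'_mul, hpp]
  have htr : (wt ρ ψ a).trace = Fintype.card F * p.trace := by
    rw [hp, Matrix.trace_smul, smul_eq_mul, mul_inv_cancel_left₀ hq]
  have htr2 := (LinearMap.IsIdempotentElem.isProj_range _ hid).trace
  rw [Matrix.trace_toLin'_eq] at htr2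
  refine ⟨_, by rw [htr, htr2], fun h0 => ?_⟩
  rw [h0, Nat.cast_zero, ← Matrix.trace_toLin'_eq] at htr2
  have h3 := LinearMap.IsIdempotentElem.eq_zero_of_trace_eq_zero hid htr2
  have h4 : p = 0 := by simpa using h3
  have h5 := congrArg ((Fintype.card F : ℂ) • ·) h4
  simpa [hp, smul_smul, hq] using h5

/-- Conjugation by `dia b` normalizes the unipotent group and multiplies its parameter by `b²`, so
it identifies the weight spaces of `a` and `b²a`. -/
theorem trace_wt_mul_sq (a : F) (b : Fˣ) : (wt ρ ψ (b * a * b)).trace = (wt ρ ψ a).trace := by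
  have h : mat ρ (dia b) * wt ρ ψ (b * a * b) = wt ρ ψ a * mat ρ (dia b) := by
    rw [wt, wt, Finset.mul_sum, Finset.sum_mul]
    refine Fintype.sum_equiv ((Units.mulLeft b).trans (Units.mulRight b)) _ _ fun x => ?_
    rw [mul_smul_comm, smul_mul_assoc, ← mat_mul, dia_mul_upp, mat_mul]
    simp only [Equiv.trans_apply, Units.mulLeft_apply, Units.mulRight_apply]
    congr 3; ring
  have h2 : wt ρ ψ (b * a * b) = mat ρ (dia b)⁻¹ * (wt ρ ψ a * mat ρ (dia b)) := by
    rw [← h, ← mul_assoc, ← mat_mul]; simp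
  rw [h2, Matrix.trace_mul_comm, mul_assoc, ← mat_mul]; simp

variable (hψ : ψ.IsPrimitive) (hρ : (linearRep ρ).IsIrreducible) (hm : 2 * m + 1 = Fintype.card F)
  (hm1 : 1 < m)

include hψ hρ hm hm1

/-- The weights of the unipotent group are nontrivial and have multiplicity one. -/
theorem exists_weights : ∃ n : F → ℕ, (∀ a, (wt ρ ψ a).trace = Fintype.card F * n a) ∧
    ∑ a, n a = m ∧ (∀ a, n a ≤ 1) ∧ wt ρ ψ 0 = 0 := by
  choose n hn hn0 using exists_mult ρ ψ
  have hq : (Fintype.card F : ℂ) ≠ 0 := Nat.cast_ne_zero.2 Fintype.card_ne_zero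
  have hsum : ∑ a, n a = m := by
    have h1 := congrArg Matrix.trace (sum_wt ρ ψ hψ 0)
    simp only [mul_zero, AddChar.map_zero_eq_one, one_smul, Matrix.trace_sum, hn, upp_zero, mat_one,
      Matrix.trace_smul, Matrix.trace_one, Fintype.card_fin, smul_eq_mul, ← Finset.mul_sum] at h1
    exact_mod_cast mul_left_cancel₀ hq h1
  have hinv : ∀ a (b : Fˣ), n (b * a * b) = n a := fun a b => by
    have h1 := trace_wt_mul_sq ρ ψ a b
    rw [hn, hn] at h1
    exact_mod_cast mul_left_cancel₀ hq h1
  -- As `b` runs over the `2m` units, the weights `b²a` all have multiplicity `n a`, and each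
  -- nonzero weight occurs at most twice. Thus `2m n(a)` is at most twice the total multiplicity `m
  -- - n 0` of the nonzero weights.
  have hle : ∀ a ≠ 0, (2 * m) * n a + 2 * n 0 ≤ 2 * m := by
    intro a ha
    have h1 : ∑ b : Fˣ, n (b * a * b) = (2 * m) * n a := by
      simp only [hinv, Finset.sum_const, Finset.card_univ, Fintype.card_units, ← hm,
        Nat.add_sub_cancel, smul_eq_mul]
    have h2 : ∑ b : Fˣ, n (b * a * b) =
        ∑ c ∈ Finset.univ.erase (0 : F), ∑ b ∈ Finset.univ.filter (fun b : Fˣ => (b : F) * a * b = c), n (b * a * b) := by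
      rw [Finset.sum_fiberwise_of_maps_to]
      intro b _
      simp [ha]
    have h3 : ∀ c ∈ Finset.univ.erase (0 : F),
        ∑ b ∈ Finset.univ.filter (fun b : Fˣ => (b : F) * a * b = c), n (b * a * b) ≤ 2 * n c := by
      intro c _
      rw [Finset.sum_congr rfl (g := fun _ => n c) (by
        intro b hb; rw [(Finset.mem_filter.1 hb).2])]
      rw [Finset.sum_const, smul_eq_mul]
      apply Nat.mul_le_mul_right
      by_cases hc : ∃ b : Fˣ, (b : F) * a * b = c
      · obtain ⟨b, hb⟩ := hc
        refine (Finset.card_le_card (t := {b, -b}) ?_).trans Finset.card_le_two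
        intro b' hb'
        have h4 : (b' : F) * a * b' = c := (Finset.mem_filter.1 hb').2
        have h5 : (b' : F) * b' = b * b := by
          apply mul_right_cancel₀ ha
          linear_combination h4 - hb
        rw [Finset.mem_insert, Finset.mem_singleton, Units.ext_iff, Units.ext_iff, Units.val_neg]
        exact mul_self_eq_mul_self_iff.1 h5
      · rw [Finset.filter_false_of_mem]
        · simp
        · exact fun b _ hb => hc ⟨b, hb⟩
    have h4 := Finset.sum_le_sum h3
    rw [← h2, h1, ← Finset.mul_sum] at h4
    have h5 := Finset.add_sum_erase Finset.univ n (Finset.mem_univ (0 : F))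
    omega
  -- Otherwise all unipotent matrices act trivially, hence so does the whole group. Then the
  -- commutant has dimension `m² > 1`, against irreducibility.
  obtain ⟨a, ha, hna⟩ : ∃ a ≠ 0, n a ≠ 0 := by
    by_contra! hcon
    have h1 : ∀ y, mat ρ (upp y) = 1 := by
      have h2 : ∀ y, wt ρ ψ 0 = (Fintype.card F : ℂ) • mat ρ (upp y) := fun y => by
        rw [← sum_wt ρ ψ hψ y, Finset.sum_eq_single 0]
        · simp
        · intro a _ ha; rw [hn0 a (hcon a ha), smul_zero]
        · simp
      intro y
      have h3 := (h2 y).symm.trans (h2 0)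
      rw [upp_zero, mat_one] at h3
      exact smul_right_injective _ hq h3
    have h2 : ρ.ker = ⊤ := by
      apply eq_top_of_upp_mem
      intro x
      rw [MonoidHom.mem_ker]
      exact Subtype.ext (h1 x)
    have h3 : commutant ρ ⊤ = ⊤ := by
      rw [eq_top_iff]
      intro x _ k _
      have h4 : ρ k = 1 := by
        rw [← MonoidHom.mem_ker, h2]; trivial
      simp [mat, h4]
    have h4 := finrank_commutant_top ρ hρ
    rw [h3, finrank_top, Module.finrank_matrix] at h4
    simp at h4
    omega
  have h1 := hle a ha
  have h2 : n a = 1 ∧ n 0 = 0 := by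
    have : 1 ≤ n a := Nat.one_le_iff_ne_zero.2 hna
    have h3 : 2 * m * 1 ≤ 2 * m * n a := Nat.mul_le_mul_left _ this
    refine ⟨?_, by omega⟩
    by_contra hne
    have h4 : 2 * m * 2 ≤ 2 * m * n a := Nat.mul_le_mul_left _ (by omega)
    omega
  refine ⟨n, hn, hsum, fun b => ?_, hn0 0 h2.2⟩
  by_cases hb : b = 0
  · rw [hb, h2.2]; exact zero_le_one
  · by_contra hne
    have h4 : 2 * m * 2 ≤ 2 * m * n b := Nat.mul_le_mul_left _ (by omega)
    have := hle b hb
    omega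

/-- Parseval for the restriction to the unipotent group: the sum is `q ∑ n(a)²`, and `n(a)² = n(a)`
because multiplicities are `0` or `1`. -/
theorem sum_normChar_upp : ∑ x : F, normChar ρ (upp x) = Fintype.card F * m := by
  obtain ⟨n, hn, hsum, hn1, -⟩ := exists_weights ρ ψ hψ hρ hm hm1
  have hq : (Fintype.card F : ℂ) ≠ 0 := Nat.cast_ne_zero.2 Fintype.card_ne_zero
  have htr : ∀ y, (mat ρ (upp y)).trace = ∑ a, ψ (a * y) * n a := fun y => by
    have h1 := congrArg Matrix.trace (sum_wt ρ ψ hψ y)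
    simp only [Matrix.trace_sum, Matrix.trace_smul, hn, smul_eq_mul] at h1
    apply mul_left_cancel₀ hq
    rw [← h1, Finset.mul_sum]
    exact Finset.sum_congr rfl fun a _ => by ring
  have hneg : ∀ y, upp (-y) = (upp y : SL(2, F))⁻¹ := fun y => by
    rw [eq_inv_iff_mul_eq_one, ← upp_add, neg_add_cancel, upp_zero]
  have hnc : ∀ y, ((normChar ρ (upp y) : ℝ) : ℂ) =
      ∑ a, ∑ b, ψ (y * (a - b)) * (n a * n b) := fun y => by
    rw [normChar, Complex.normSq_eq_conj_mul_self, mul_comm]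
    have : (starRingEnd ℂ) (mat ρ (upp y)).trace = (mat ρ (upp (-y))).trace := by
      rw [hneg, trace_mat_inv]; rfl
    rw [this, htr, htr, Finset.sum_mul_sum]
    refine Finset.sum_congr rfl fun a _ => Finset.sum_congr rfl fun b _ => ?_
    have h2 : y * (a - b) = a * y + b * -y := by ring
    rw [h2, AddChar.map_add_eq_mul]; ring
  have h1 : ((∑ x : F, normChar ρ (upp x) : ℝ) : ℂ) = Fintype.card F * m := by
    push_cast
    simp only [hnc]
    rw [Finset.sum_comm]
    have h2 : ∀ a, ∑ y, ∑ b, ψ (y * (a - b)) * (n a * n b : ℂ) = Fintype.card F * n a := by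
      intro a
      rw [Finset.sum_comm]
      have h3 : ∀ b, ∑ y, ψ (y * (a - b)) * (n a * n b : ℂ) =
          if b = a then Fintype.card F * (n a * n b : ℂ) else 0 := by
        intro b
        have := AddChar.sum_mulShift (a - b) hψ
        push_cast at this
        rw [← Finset.sum_mul, this]
        simp only [sub_eq_zero, eq_comm (a := a), ite_mul, zero_mul]
      simp only [h3, Finset.sum_ite_eq', Finset.mem_univ, if_true]
      have h4 : n a * n a = n a := by
        have := hn1 a
        interval_cases n a <;> rfl
      rw [← Nat.cast_mul, h4]
    simp only [h2, ← Finset.mul_sum]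
    rw [← Nat.cast_sum, hsum]
  exact_mod_cast h1

/-- All `dia a * upp x` are conjugate to `dia a` when `a² ≠ 1`. So `q χ(dia a)` is the trace of
`ρ(dia a)` times the operator `wt 0`, and the weight zero does not occur. -/
theorem normChar_dia (a : Fˣ) (ha : (a : F) * a ≠ 1) : normChar ρ (dia a) = 0 := by
  obtain ⟨n, -, -, -, h0⟩ := exists_weights ρ ψ hψ hρ hm hm1
  have hq : (Fintype.card F : ℂ) ≠ 0 := Nat.cast_ne_zero.2 Fintype.card_ne_zero
  have h1 : ∀ x, (mat ρ (dia a * upp x)).trace = (mat ρ (dia a)).trace := by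
    intro x
    have h2 : (1 - (a : F) * a) ≠ 0 := sub_ne_zero.2 ha.symm
    set y := a * x * a / (1 - (a : F) * a) with hy
    have h3 : dia a * upp x = upp y * dia a * (upp y)⁻¹ := by
      rw [eq_mul_inv_iff_mul_eq, mul_assoc, ← upp_add, dia_mul_upp]
      congr 2
      have hy' : y * (1 - (a : F) * a) = a * x * a := div_mul_cancel₀ _ h2
      linear_combination -hy'
    rw [h3, trace_mat_conj]
  have h2 : (mat ρ (dia a) * wt ρ ψ 0).trace = Fintype.card F * (mat ρ (dia a)).trace := by
    rw [wt, Finset.mul_sum, Matrix.trace_sum]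
    simp [← mat_mul, h1]
  rw [h0, mul_zero, Matrix.trace_zero] at h2
  rw [normChar, (mul_eq_zero.1 h2.symm).resolve_left hq, map_zero]

end Unipotent

/-! ### Conjugacy classes of `SL₂(F)` and the sum of the values of the character -/

section Traces

variable {F : Type*} [Field F]

/-- The trace of a matrix of determinant one. -/
def tr (g : SL(2, F)) : F := g 0 0 + g 1 1

@[simp] theorem tr_big (c : Fˣ) (a t : F) : tr (big c a t) = t := by simp [tr]

theorem big_mul_upp (c : Fˣ) : big (1 : Fˣ) (0 : F) 0 * upp (-(c : F)) = big c 1 2 * big 1 0 0 := by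
  apply sl2_ext <;> simp [sl2_mul_apply] <;> norm_num

/-- The central element `-1`. -/
def negOne : SL(2, F) := dia (-1)

theorem negOne_mul (g : SL(2, F)) (i j : Fin 2) : (negOne * g : SL(2, F)) i j = -g i j := by
  rw [negOne, sl2_mul_apply]
  fin_cases i <;> simp

theorem negOne_mem_center : (negOne : SL(2, F)) ∈ Subgroup.center SL(2, F) := by
  rw [Subgroup.mem_center_iff]
  intro g
  have h : ∀ i j, (g * negOne : SL(2, F)) i j = -g i j := fun i j => by
    rw [negOne, sl2_mul_apply]
    fin_cases j <;> simp
  apply sl2_ext <;> rw [h, negOne_mul]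

theorem big_neg_two (c : Fˣ) : big c (0 : F) (-2) = negOne * big (-c) 0 2 := by
  apply sl2_ext <;> rw [negOne_mul] <;> simp

variable [Fintype F] [DecidableEq F]

theorem two_ne_zero_of_card {m : ℕ} (hm : 2 * m + 1 = Fintype.card F) : (2 : F) ≠ 0 := by
  apply Ring.two_ne_zero
  intro h
  have := FiniteField.even_card_iff_char_two.1 h
  omega

variable {m : ℕ} (hm : 2 * m + 1 = Fintype.card F)

include hm

/-- A nondegenerate binary quadratic form over a finite field represents `1`. -/
theorem exists_form_eq_one {a b c d : F} (h : (d - a) ^ 2 + 4 * b * c ≠ 0) :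
    ∃ x y : F, c * x ^ 2 + (d - a) * x * y - b * y ^ 2 = 1 := by
  have h2 := two_ne_zero_of_card hm
  by_cases hc : c = 0
  · have hd : d - a ≠ 0 := by
      intro h0; apply h; rw [h0, hc]; ring
    refine ⟨(1 + b) / (d - a), 1, ?_⟩
    rw [hc]; field_simp; ring
  -- Completing the square gives the diagonal form `c X² + e y²` with `X = x + (d - a) y / (2c)`.
  -- Over a finite field of odd order two nondegenerate squares suffice to represent `1`.
  · set e : F := -((d - a) ^ 2 + 4 * b * c) / (4 * c) with he
    have h4 : (4 : F) ≠ 0 := by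
      rw [show (4 : F) = 2 * 2 by norm_num]; exact mul_ne_zero h2 h2
    have he0 : e ≠ 0 := div_ne_zero (neg_ne_zero.2 h) (mul_ne_zero h4 hc)
    obtain ⟨x, y, hxy⟩ := FiniteField.exists_root_sum_quadratic
      (Polynomial.degree_quadratic (b := 0) (c := -1) hc)
      (Polynomial.degree_quadratic (b := 0) (c := 0) he0) (by omega)
    simp at hxy
    refine ⟨x - y * (d - a) / (2 * c), y, ?_⟩
    have : c * x ^ 2 + e * y ^ 2 = 1 := by linear_combination hxy
    rw [← this, he]
    field_simp
    ring

/-- Matrices with the same trace, not `±2`, are conjugate. -/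
theorem exists_conj_big {g : SL(2, F)} (hg : tr g ^ 2 - 4 ≠ 0) :
    ∃ k : SL(2, F), g = k * big 1 0 (tr g) * k⁻¹ := by
  have hd := sl2_det g
  -- The form is the determinant of the pair `v, g v` for `v = (x, y)`, with discriminant `tr² - 4`.
  -- A vector where it equals `1` gives a basis of determinant one in which `g` is the companion
  -- matrix `big 1 0 (tr g)`.
  obtain ⟨x, y, hxy⟩ := exists_form_eq_one hm (a := g 0 0) (b := g 0 1) (c := g 1 0) (d := g 1 1) (by
    intro h0; apply hg; rw [tr, ← h0]; linear_combination 4 * hd)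
  let k : SL(2, F) := ⟨!![x, g 0 0 * x + g 0 1 * y; y, g 1 0 * x + g 1 1 * y], by
    rw [Matrix.det_fin_two_of]; linear_combination hxy⟩
  refine ⟨k, ?_⟩
  rw [eq_mul_inv_iff_mul_eq]
  have k00 : k 0 0 = x := rfl
  have k01 : k 0 1 = g 0 0 * x + g 0 1 * y := rfl
  have k10 : k 1 0 = y := rfl
  have k11 : k 1 1 = g 1 0 * x + g 1 1 * y := rfl
  apply sl2_ext
  · simp [sl2_mul_apply, k00, k01, k10]
  · simp only [sl2_mul_apply, k00, k01, k11, big_01, big_11, tr, Units.val_one, inv_one]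
    linear_combination (-x) * hd
  · simp [sl2_mul_apply, k00, k10, k11]
  · simp only [sl2_mul_apply, k01, k10, k11, big_01, big_11, tr, Units.val_one, inv_one]
    linear_combination (-y) * hd

variable (ρ : SL(2, F) →* U m)

theorem normChar_of_tr {g : SL(2, F)} (hg : tr g ^ 2 - 4 ≠ 0) :
    normChar ρ g = normChar ρ (big 1 0 (tr g)) := by
  obtain ⟨k, hk⟩ := exists_conj_big hm hg
  conv_lhs => rw [hk]
  rw [normChar_conj]

omit hm in
-- Both matrices are conjugate to `big c 1 2`, the first by `upp c⁻¹` and the second by the Weyl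
-- element.
theorem normChar_big_two (c : Fˣ) : normChar ρ (big c 0 2) = normChar ρ (upp (-(c : F))) := by
  rw [← normChar_conj ρ _ (upp (↑c⁻¹ : F)), ← normChar_conj ρ (upp (-(c : F))) (big 1 0 0),
    conj_upp_big, big_mul_upp]
  simp

/-- The two sums run over the matrices with zero and with nonzero lower left entry. -/
theorem sum_sl2 (f : SL(2, F) → ℝ) : ∑ᶠ g, f g = ∑ a : Fˣ, ∑ b : F, f (dia a * upp b) +
    ∑ c : Fˣ, ∑ a : F, ∑ t : F, f (big c a t) := by
  let φ : (Fˣ × F) ⊕ (Fˣ × F × F) → SL(2, F) :=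
    Sum.elim (fun p => dia p.1 * upp p.2) (fun p => big p.1 p.2.1 p.2.2)
  have hφ : Function.Bijective φ := by
    constructor
    · rintro (⟨a, b⟩ | ⟨c, a, t⟩) (⟨a', b'⟩ | ⟨c', a', t'⟩) h
      · have h1 : (dia a * upp b) 0 0 = (dia a' * upp b') 0 0 := congrArg (fun g : SL(2, F) => g 0 0) h
        have h2 : (dia a * upp b) 0 1 = (dia a' * upp b') 0 1 := congrArg (fun g : SL(2, F) => g 0 1) h
        simp [sl2_mul_apply] at h1 h2
        obtain rfl := Units.ext h1
        simpa using h2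
      · have h1 : (dia a * upp b) 1 0 = big c' a' t' 1 0 := congrArg (fun g : SL(2, F) => g 1 0) h
        simp [sl2_mul_apply] at h1
        exact absurd h1.symm c'.ne_zero
      · have h1 : big c a t 1 0 = (dia a' * upp b') 1 0 := congrArg (fun g : SL(2, F) => g 1 0) h
        simp [sl2_mul_apply] at h1
      · have h1 : big c a t 1 0 = big c' a' t' 1 0 := congrArg (fun g : SL(2, F) => g 1 0) h
        have h2 : big c a t 0 0 = big c' a' t' 0 0 := congrArg (fun g : SL(2, F) => g 0 0) h
        have h3 : tr (big c a t) = tr (big c' a' t') := congrArg tr h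
        simp only [tr_big, big_10, big_00] at h1 h2 h3
        rw [Units.ext h1, h2, h3]
    · intro g
      have hd := sl2_det g
      by_cases hg : g 1 0 = 0
      · have h0 : g 0 0 ≠ 0 := by
          intro h0; rw [h0, hg] at hd; simp at hd
        refine ⟨Sum.inl (Units.mk0 _ h0, (g 0 0)⁻¹ * g 0 1), ?_⟩
        apply sl2_ext <;> simp [φ, sl2_mul_apply, hg, h0]
        rw [inv_eq_iff_eq_inv]
        refine eq_inv_of_mul_eq_one_left ?_
        rw [hg] at hd; linear_combination hd
      · refine ⟨Sum.inr (Units.mk0 _ hg, g 0 0, tr g), ?_⟩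
        apply sl2_ext <;> simp [φ, tr]
        rw [mul_inv_eq_iff_eq_mul₀ hg]
        linear_combination hd
  rw [← finsum_comp_equiv (Equiv.ofBijective φ hφ), finsum_eq_sum_of_fintype, Fintype.sum_sum_type,
    Fintype.sum_prod_type, Fintype.sum_prod_type]
  congr 1
  refine Finset.sum_congr rfl fun c _ => ?_
  rw [Fintype.sum_prod_type]
  rfl

theorem card_sl2 : (Nat.card SL(2, F) : ℝ) = 2 * m * (2 * m + 1) + 2 * m * (2 * m + 1) ^ 2 := by
  have h := sum_sl2 hm (fun _ => 1)
  rw [finsum_eq_sum_of_fintype] at h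
  have hq : (Fintype.card F : ℝ) = 2 * m + 1 := by rw [← hm]; push_cast; ring
  have hu : (Fintype.card Fˣ : ℝ) = 2 * m := by
    rw [Fintype.card_units, ← hm]; push_cast; simp
  simp only [Finset.sum_const, Finset.card_univ, nsmul_eq_mul, mul_one, hq, hu] at h
  rw [Nat.card_eq_fintype_card, h]; ring

variable (hρ : (linearRep ρ).IsIrreducible) (hm1 : 1 < m)

include hρ hm1

omit [DecidableEq F] hm hρ hm1 in
theorem exists_primitive_addChar : ∃ ψ : AddChar F ℂ, ψ.IsPrimitive := by
  obtain ⟨ψ, hψ⟩ := AddChar.exists_apply_ne_zero.2 (one_ne_zero (α := F))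
  exact ⟨ψ, AddChar.IsPrimitive.of_ne_one fun h => hψ (by rw [h]; rfl)⟩

/-- The character vanishes on the split semisimple elements. -/
theorem normChar_eq_zero_of_split {g : SL(2, F)} {s : F} (hs : s ≠ 0) (hg : tr g ^ 2 - 4 = s ^ 2) :
    normChar ρ g = 0 := by
  obtain ⟨ψ, hψ⟩ := exists_primitive_addChar (F := F)
  have h2 := two_ne_zero_of_card hm
  have hne : tr g ^ 2 - 4 ≠ 0 := by rw [hg]; exact pow_ne_zero 2 hs
  have h1 : (tr g + s) / 2 * ((tr g - s) / 2) = 1 := by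
    field_simp; linear_combination hg
  -- The eigenvalues of `g` are `(tr g ± s) / 2`; they are distinct and mutually inverse, so `g` has
  -- the trace, hence the class, of a noncentral diagonal matrix.
  let a : Fˣ := ⟨(tr g + s) / 2, (tr g - s) / 2, h1, by rw [mul_comm, h1]⟩
  have ha : tr (dia a) = tr g := by
    change (tr g + s) / 2 + (tr g - s) / 2 = tr g
    field_simp; ring
  rw [normChar_of_tr hm ρ hne, ← ha, ← normChar_of_tr hm ρ (by rw [ha]; exact hne)]
  apply normChar_dia ρ ψ hψ hρ hm hm1
  intro h0
  have h3 : (tr g + s) / 2 * ((tr g + s) / 2) = 1 := h0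
  have h4 : (tr g + s) / 2 ≠ 0 := left_ne_zero_of_mul_eq_one h3
  have h5 := mul_left_cancel₀ h4 (h3.trans h1.symm)
  field_simp at h5
  apply hs
  have : 2 * s = 0 := by linear_combination h5
  exact (mul_eq_zero.1 this).resolve_left h2

open Classical in
/-- The traces of the elements with no eigenvalue in `F`. -/
def nonsplitTraces (F : Type*) [Field F] [Fintype F] : Finset F :=
  Finset.univ.filter fun t => ¬ IsSquare (t ^ 2 - 4)

omit [DecidableEq F] hm hρ hm1 in
theorem mem_nonsplitTraces {t : F} : t ∈ nonsplitTraces F ↔ ¬ IsSquare (t ^ 2 - 4) := by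
  simp [nonsplitTraces]

/-- Trace `±2` gives plus or minus a unipotent matrix, and the sign is invisible to `|χ|²`. Any
other trace with eigenvalues in `F` contributes nothing, and the remaining ones determine the
conjugacy class. -/
theorem normChar_big (c : Fˣ) (t : F) : normChar ρ (big c 0 t) =
    (if t = 2 then normChar ρ (upp (-(c : F))) else 0) +
    (if t = -2 then normChar ρ (upp (c : F)) else 0) +
    (if t ∈ nonsplitTraces F then normChar ρ (big 1 0 t) else 0) := by
  have h2 := two_ne_zero_of_card hm
  have h22 : (2 : F) ≠ -2 := by
    intro h
    have : (2 : F) * 2 = 0 := by linear_combination h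
    exact h2 (by simpa using this)
  have n2 : (2 : F) ∉ nonsplitTraces F := by
    rw [mem_nonsplitTraces, not_not]; exact ⟨0, by norm_num⟩
  have n2' : (-2 : F) ∉ nonsplitTraces F := by
    rw [mem_nonsplitTraces, not_not]; exact ⟨0, by norm_num⟩
  by_cases ht : t = 2
  · subst ht
    simp [h22, n2, normChar_big_two]
  by_cases ht' : t = -2
  · subst ht'
    rw [if_neg ht, if_pos rfl, if_neg n2', big_neg_two, normChar_mul_of_central ρ hρ negOne_mem_center,
      normChar_big_two]
    simp
  rw [if_neg ht, if_neg ht', zero_add, zero_add]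
  have ht4 : t ^ 2 - 4 ≠ 0 := by
    intro h0
    have : (t - 2) * (t + 2) = 0 := by linear_combination h0
    rcases mul_eq_zero.1 this with h | h
    · exact ht (sub_eq_zero.1 h)
    · exact ht' (eq_neg_of_add_eq_zero_left h)
  split_ifs with hN
  · have := normChar_of_tr hm ρ (g := big c 0 t) (by rwa [tr_big])
    rwa [tr_big] at this
  · rw [mem_nonsplitTraces, not_not] at hN
    obtain ⟨s, hs⟩ := hN
    refine normChar_eq_zero_of_split hm ρ hρ hm1 (s := s) ?_ (by rw [tr_big, hs, sq])
    rintro rfl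
    exact ht4 (by rw [hs, mul_zero])

/-- The sum of the values of the character on the classes without eigenvalues in `F`. -/
theorem sum_nonsplit : ∑ t ∈ nonsplitTraces F, normChar ρ (big 1 0 t) = m := by
  obtain ⟨ψ, hψ⟩ := exists_primitive_addChar (F := F)
  have hq : (Fintype.card F : ℝ) = 2 * m + 1 := by rw [← hm]; push_cast; ring
  have hu : (Fintype.card Fˣ : ℝ) = 2 * m := by
    rw [Fintype.card_units, ← hm]; push_cast; simp
  have hupp := sum_normChar_upp ρ ψ hψ hρ hm hm1
  rw [hq] at hupp
  have huppU : ∑ c : Fˣ, normChar ρ (upp (c : F)) = (2 * m + 1) * m - m ^ 2 := by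
    rw [← hupp, ← Finset.add_sum_erase _ _ (Finset.mem_univ (0 : F)), upp_zero, normChar_one,
      add_sub_cancel_left]
    refine Finset.sum_bij (fun c _ => (c : F)) (by simp) (fun a _ b _ h => Units.ext h) ?_ (by simp)
    intro b hb
    exact ⟨Units.mk0 b (Finset.ne_of_mem_erase hb), Finset.mem_univ _, rfl⟩
  have huppU' : ∑ c : Fˣ, normChar ρ (upp (-(c : F))) = (2 * m + 1) * m - m ^ 2 := by
    rw [← huppU]
    exact Fintype.sum_equiv (Equiv.neg Fˣ) _ _ fun c => by simp
  -- The relation `∑ |χ|² = |G|` is linear in the unknown sum, since every other contribution is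
  -- known: the triangular matrices give `2qm`, the rest `q (2 (qm - m²) + 2m S)`, and `|G| = 2mq +
  -- 2mq²`. Hence `S = m`.
  have hG := sum_normChar ρ hρ
  rw [sum_sl2 hm, card_sl2 hm] at hG
  have hA : ∑ a : Fˣ, ∑ b : F, normChar ρ (dia a * upp b) = 2 * ((2 * m + 1) * m) := by
    have h1 : ∀ a : Fˣ, ∑ b : F, normChar ρ (dia a * upp b) =
        (if a = 1 then (2 * m + 1) * (m : ℝ) else 0) + (if a = -1 then (2 * m + 1) * (m : ℝ) else 0) := by
      intro a
      have h2 := two_ne_zero_of_card hm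
      have h11 : (1 : Fˣ) ≠ -1 := by
        intro h
        have h3 : (1 : F) = -1 := by simpa using congrArg Units.val h
        exact h2 (by linear_combination h3)
      by_cases ha : a = 1
      · subst ha
        have : dia (1 : Fˣ) = (1 : SL(2, F)) := by apply sl2_ext <;> simp
        simp [this, h11, hupp]
      by_cases ha' : a = -1
      · subst ha'
        rw [if_neg ha, if_pos rfl, zero_add, ← hupp]
        exact Finset.sum_congr rfl fun b _ => normChar_mul_of_central ρ hρ negOne_mem_center _
      rw [if_neg ha, if_neg ha', add_zero]
      refine Finset.sum_eq_zero fun b _ => ?_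
      refine normChar_eq_zero_of_split hm ρ hρ hm1 (s := a - ↑a⁻¹) ?_ ?_
      · rw [sub_ne_zero]
        intro h0
        have h3 : (a : F) * a = 1 := by nth_rewrite 2 [h0]; simp
        rcases mul_self_eq_one_iff.1 h3 with h | h
        · exact ha (Units.ext h)
        · exact ha' (Units.ext (by simpa using h))
      · have h3 : (a : F) * (a : F)⁻¹ = 1 := mul_inv_cancel₀ a.ne_zero
        simp [tr, sl2_mul_apply]
        linear_combination 4 * h3
    simp only [h1, Finset.sum_add_distrib, Finset.sum_ite_eq', Finset.mem_univ, if_true]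
    ring
  have hB : ∑ c : Fˣ, ∑ a : F, ∑ t : F, normChar ρ (big c a t) =
      (2 * m + 1) * (2 * ((2 * m + 1) * m - m ^ 2) +
        2 * m * ∑ t ∈ nonsplitTraces F, normChar ρ (big 1 0 t)) := by
    have h1 : ∀ c a t, normChar ρ (big c a t) = normChar ρ (big c 0 t) := by
      intro c a t
      rw [← normChar_conj ρ (big c 0 t) (upp (a * ↑c⁻¹)), conj_upp_big]
      simp
    have h2 : ∀ c : Fˣ, ∑ t : F, normChar ρ (big c 0 t) = normChar ρ (upp (-(c : F))) +
        normChar ρ (upp (c : F)) + ∑ t ∈ nonsplitTraces F, normChar ρ (big 1 0 t) := by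
      intro c
      simp only [normChar_big hm ρ hρ hm1 c, Finset.sum_add_distrib, Finset.sum_ite_eq',
        Finset.mem_univ, if_true, Finset.sum_ite_mem, Finset.univ_inter]
    simp only [h1, h2, Finset.sum_const, Finset.card_univ, nsmul_eq_mul, hq, ← Finset.mul_sum,
      Finset.sum_add_distrib, huppU, huppU', hu]
    ring
  rw [hA, hB] at hG
  have hm0 : (m : ℝ) ≠ 0 := by
    have : m ≠ 0 := by omega
    exact_mod_cast this
  have hq0 : (2 * (m : ℝ) + 1) ≠ 0 := by positivity
  apply mul_left_cancel₀ (mul_ne_zero hq0 (mul_ne_zero two_ne_zero hm0))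
  linear_combination hG

omit hρ hm1 in
-- The map `a ↦ a + a⁻¹` sends the `2m` units to traces with eigenvalues in `F`. Its fibres have at
-- most two elements, those over `±2` at most one. So there are at least `m + 1` such traces among
-- the `2m + 1` elements of `F`.
theorem card_nonsplitTraces_le : (nonsplitTraces F).card ≤ m := by
  classical
  have h2 := two_ne_zero_of_card hm
  have h22 : (2 : F) ≠ -2 := by
    intro h
    have : (2 : F) * 2 = 0 := by linear_combination h
    exact h2 (by simpa using this)
  set Sq : Finset F := Finset.univ.filter fun t => IsSquare (t ^ 2 - 4) with hSq
  have hcard : Sq.card + (nonsplitTraces F).card = 2 * m + 1 := by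
    rw [hm, ← Finset.card_univ, ← Finset.card_filter_add_card_filter_not (s := Finset.univ)
      (p := fun t : F => IsSquare (t ^ 2 - 4))]
    congr 2
    ext; simp [mem_nonsplitTraces]
  have hfib : ∑ t ∈ Sq, (Finset.univ.filter fun a : Fˣ => (a : F) + ↑a⁻¹ = t).card = 2 * m := by
    rw [← Finset.card_eq_sum_card_fiberwise, Finset.card_univ, Fintype.card_units, ← hm,
      Nat.add_sub_cancel]
    intro a _
    simp only [hSq, Finset.coe_filter, Set.mem_ofPred_eq, Finset.mem_univ, true_and]
    have h3 : (a : F) * ↑a⁻¹ = 1 := a.mul_inv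
    exact ⟨a - ↑a⁻¹, by linear_combination 4 * h3⟩
  have hfib2 : ∀ a b : Fˣ, (a : F) + ↑a⁻¹ = b + ↑b⁻¹ → a = b ∨ a = b⁻¹ := by
    intro a b hab
    have ha : (a : F) * ↑a⁻¹ = 1 := a.mul_inv
    have hb : (b : F) * ↑b⁻¹ = 1 := b.mul_inv
    have h3 : ((a : F) - b) * (a - ↑b⁻¹) = 0 := by
      linear_combination (a : F) * hab - ha + hb
    rcases mul_eq_zero.1 h3 with h | h
    · exact Or.inl (Units.ext (sub_eq_zero.1 h))
    · exact Or.inr (Units.ext (sub_eq_zero.1 h))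
  have hbound : ∀ t ∈ Sq, (Finset.univ.filter fun a : Fˣ => (a : F) + ↑a⁻¹ = t).card +
      ((if t = 2 then 1 else 0) + (if t = -2 then 1 else 0)) ≤ 2 := by
    intro t _
    by_cases ht : t = 2
    · subst ht
      have : (Finset.univ.filter fun a : Fˣ => (a : F) + ↑a⁻¹ = 2) ⊆ {1} := by
        intro a ha
        have h3 := hfib2 a 1 ((Finset.mem_filter.1 ha).2.trans (by norm_num))
        simpa using h3
      have := Finset.card_le_card this
      simp only [h22, if_true, if_false, Finset.card_singleton] at this ⊢
      omega
    by_cases ht' : t = -2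
    · subst ht'
      have : (Finset.univ.filter fun a : Fˣ => (a : F) + ↑a⁻¹ = -2) ⊆ {-1} := by
        intro a ha
        have h3 := hfib2 a (-1) ((Finset.mem_filter.1 ha).2.trans (by simp; norm_num))
        simpa using h3
      have := Finset.card_le_card this
      simp only [ht, if_true, if_false, Finset.card_singleton] at this ⊢
      omega
    · rw [if_neg ht, if_neg ht', add_zero, add_zero]
      by_cases hc : ∃ b : Fˣ, (b : F) + ↑b⁻¹ = t
      · obtain ⟨b, rfl⟩ := hc
        refine (Finset.card_le_card (t := {b, b⁻¹}) ?_).trans Finset.card_le_two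
        intro a ha
        simpa using hfib2 a b (Finset.mem_filter.1 ha).2
      · rw [Finset.filter_false_of_mem]
        · simp
        · exact fun b _ hb => hc ⟨b, hb⟩
  have hs := Finset.sum_le_sum hbound
  have h2S : (2 : F) ∈ Sq := by simp [hSq]; exact ⟨0, by norm_num⟩
  have h2S' : (-2 : F) ∈ Sq := by simp [hSq]; exact ⟨0, by norm_num⟩
  rw [Finset.sum_add_distrib, hfib, Finset.sum_add_distrib, Finset.sum_ite_eq', Finset.sum_ite_eq',
    if_pos h2S, if_pos h2S', Finset.sum_const, smul_eq_mul] at hs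
  omega

end Traces

/-! ### The dimensions of the centralizers -/

section Powers

variable {F : Type*} [Field F]

theorem sl2_det_sub (k : SL(2, F)) (a : F) :
    ((k : Matrix (Fin 2) (Fin 2) F) - a • 1).det = a ^ 2 - tr k * a + 1 := by
  rw [Matrix.det_fin_two, tr]
  simp
  linear_combination sl2_det k

theorem sl2_mul_self (k : SL(2, F)) :
    (k : Matrix (Fin 2) (Fin 2) F) * k = tr k • (k : Matrix (Fin 2) (Fin 2) F) - 1 := by
  have hd := sl2_det k
  ext i j
  fin_cases i <;> fin_cases j <;> simp [Matrix.mul_apply, Fin.sum_univ_two, tr]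
  · linear_combination -hd
  · ring
  · ring
  · linear_combination -hd

/-- Here `k - a` squares to zero, so the binomial expansion stops after the linear term. The
coefficient `j a^(j-1)` is written `j a^(j+1)` because `a² = 1`. -/
theorem sl2_pow_of_tr {k : SL(2, F)} {a : F} (ha : a * a = 1) (hk : tr k = 2 * a) (j : ℕ) :
    (k : Matrix (Fin 2) (Fin 2) F) ^ j =
      a ^ j • (1 : Matrix (Fin 2) (Fin 2) F) + (j * a ^ (j + 1)) • ((k : Matrix (Fin 2) (Fin 2) F) - a • 1) := by
  induction j with
  | zero => simp
  | succ j ih =>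
    rw [pow_succ, ih, add_mul, smul_mul_assoc, smul_mul_assoc, sub_mul, sl2_mul_self, one_mul, hk,
      smul_mul_assoc, one_mul, show a ^ (j + 1 + 1) = a ^ j * (a * a) by ring, ha, pow_succ a j,
      mul_one]
    ext i i'
    simp only [Matrix.add_apply, Matrix.sub_apply, Matrix.smul_apply, smul_eq_mul]
    push_cast
    linear_combination (j : F) * a ^ j * (k i i') * ha

theorem eq_one_or_of_tr {k : SL(2, F)} {a : F} (ha : a * a = 1) (hk : tr k = 2 * a) {j : ℕ}
    (hj : (j : F) ≠ 0) (haj : a ^ j = 1) (hkj : k ^ j = 1) : k = 1 ∨ k = negOne := by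
  have h1 := sl2_pow_of_tr ha hk j
  have h2 : (k : Matrix (Fin 2) (Fin 2) F) ^ j = 1 := by
    rw [← Matrix.SpecialLinearGroup.coe_pow, hkj, Matrix.SpecialLinearGroup.coe_one]
  rw [h2, haj, one_smul, left_eq_add, smul_eq_zero] at h1
  have ha0 : a ≠ 0 := left_ne_zero_of_mul_eq_one ha
  have h3 : (k : Matrix (Fin 2) (Fin 2) F) = a • 1 :=
    sub_eq_zero.1 (h1.resolve_left (mul_ne_zero hj (pow_ne_zero _ ha0)))
  rcases mul_self_eq_one_iff.1 ha with rfl | rfl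
  · left; apply Subtype.ext; rw [h3, one_smul]; rfl
  · right
    apply sl2_ext <;> rw [h3] <;> simp [negOne]

/-- An involution equals its inverse, which in determinant one is the adjugate; comparing entries
leaves only scalars. So `-1` is the only involution, and by Cauchy it lies in every subgroup of even
order. -/
theorem eq_one_or_of_sq {k : SL(2, F)} (h2 : (2 : F) ≠ 0) (hk : k * k = 1) :
    k = 1 ∨ k = negOne := by
  have hk' : k = k⁻¹ := eq_inv_of_mul_eq_one_left hk
  have h00 : k 0 0 = k 1 1 := by
    conv_lhs => rw [hk']
    simp [Matrix.SpecialLinearGroup.coe_inv, Matrix.adjugate_fin_two]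
  have h01 : k 0 1 = -k 0 1 := by
    conv_lhs => rw [hk']
    simp [Matrix.SpecialLinearGroup.coe_inv, Matrix.adjugate_fin_two]
  have h10 : k 1 0 = -k 1 0 := by
    conv_lhs => rw [hk']
    simp [Matrix.SpecialLinearGroup.coe_inv, Matrix.adjugate_fin_two]
  have hz : ∀ x : F, x = -x → x = 0 := fun x hx =>
    (mul_eq_zero.1 (show 2 * x = 0 by linear_combination hx)).resolve_left h2
  have hd := sl2_det k
  rw [← h00, hz _ h01, zero_mul, sub_zero] at hd
  rcases mul_self_eq_one_iff.1 hd with h | h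
  · left; apply sl2_ext <;> simp [hz _ h01, hz _ h10, h, ← h00]
  · right; apply sl2_ext <;> simp [negOne, hz _ h01, hz _ h10, h, ← h00]

theorem exists_negOne_mem [Finite F] (h2 : (2 : F) ≠ 0) {K : Subgroup SL(2, F)} (hK : 2 ∣ Nat.card K) :
    negOne ∈ K := by
  have : Fact (Nat.Prime 2) := ⟨Nat.prime_two⟩
  obtain ⟨x, hx⟩ := exists_prime_orderOf_dvd_card' 2 hK
  have h1 : (x : SL(2, F)) * x = 1 := by
    have := pow_orderOf_eq_one x
    rw [hx, sq] at this
    exact congrArg Subtype.val this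
  rcases eq_one_or_of_sq h2 h1 with h | h
  · have : x = 1 := Subtype.ext h
    rw [this, orderOf_one] at hx
    omega
  · rw [← h]; exact x.2

theorem negOne_ne_one (h2 : (2 : F) ≠ 0) : (negOne : SL(2, F)) ≠ 1 := by
  intro h
  have h1 : (negOne : SL(2, F)) 0 0 = (1 : SL(2, F)) 0 0 := by rw [h]
  simp [negOne] at h1
  exact h2 (by linear_combination -h1)

variable [Fintype F]

/-- The matrix `k` is a root of `X^q - X`, the product of all `X - a`. Taking determinants, some `a`
in `F` is an eigenvalue. -/
theorem isSplit_of_pow {k : SL(2, F)} (hk : k ^ (Fintype.card F - 1) = 1)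
    (heven : Even (Fintype.card F - 1)) (h1 : k ≠ 1) (h1' : k ≠ negOne) :
    ∃ s, s ≠ 0 ∧ tr k ^ 2 - 4 = s ^ 2 := by
  classical
  have hp : 1 ≤ Fintype.card F := Fintype.card_pos
  have hprod : ∏ a : F, ((k : Matrix (Fin 2) (Fin 2) F) - a • 1).det = 0 := by
    have hX : ∏ a : F, (Polynomial.X - Polynomial.C a) =
        (Polynomial.X ^ Fintype.card F - Polynomial.X : Polynomial F) := by
      have hd := FiniteField.X_pow_card_sub_X_natDegree_eq F (Fintype.one_lt_card (α := F))
      have hr := FiniteField.roots_X_pow_card_sub_X F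
      have hmon : (Polynomial.X ^ Fintype.card F - Polynomial.X : Polynomial F).Monic :=
        Polynomial.monic_X_pow_sub (by
          rw [Polynomial.degree_X]; exact_mod_cast Fintype.one_lt_card (α := F))
      have := Polynomial.prod_multiset_X_sub_C_of_monic_of_roots_card_eq hmon (by
        rw [hr, hd]; rfl)
      rwa [hr] at this
    let φ : Polynomial F →* F := Matrix.detMonoidHom.comp
      ((Polynomial.aeval (k : Matrix (Fin 2) (Fin 2) F) :
        Polynomial F →ₐ[F] Matrix (Fin 2) (Fin 2) F) : Polynomial F →* Matrix (Fin 2) (Fin 2) F)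
    have h3 := congrArg φ hX
    have h4 : (k : Matrix (Fin 2) (Fin 2) F) ^ Fintype.card F - k = 0 := by
      rw [← Matrix.SpecialLinearGroup.coe_pow, ← Nat.sub_add_cancel hp, pow_succ, hk, one_mul,
        sub_self]
    rw [map_prod] at h3
    calc _ = ∏ a : F, φ (Polynomial.X - Polynomial.C a) := by
          refine Finset.prod_congr rfl fun a _ => ?_
          simp [φ, Algebra.algebraMap_eq_smul_one]
      _ = 0 := by
          rw [h3]
          simp [φ, h4]
  obtain ⟨a, -, ha⟩ := Finset.prod_eq_zero_iff.1 hprod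
  rw [sl2_det_sub] at ha
  -- The difference of the eigenvalues. If it vanishes, `k` is `±1` times a unipotent matrix whose
  -- order divides `q - 1`. Since `q - 1 = -1` in `F`, that matrix is `1`.
  refine ⟨2 * a - tr k, fun hs => ?_, by linear_combination (-4) * ha⟩
  have htr : tr k = 2 * a := by linear_combination -hs
  have haa : a * a = 1 := by rw [htr] at ha; linear_combination -ha
  have hj : ((Fintype.card F - 1 : ℕ) : F) ≠ 0 := by
    rw [Nat.cast_sub hp]; simp
  have haj : a ^ (Fintype.card F - 1) = 1 := by
    obtain ⟨j, hj⟩ := heven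
    rw [hj, ← two_mul, pow_mul, sq, haa, one_pow]
  rcases eq_one_or_of_tr haa htr hj haj hk with h | h
  · exact h1 h
  · exact h1' h

/-- An eigenvalue `a` in `F` satisfies both `a^(q+1) = 1` and `a^q = a`, so `a² = 1`. Then `k` has
trace `2a`, and as `q + 1 = 1` in `F` it is `±1`. -/
theorem mem_nonsplitTraces_of_pow {k : SL(2, F)} (hk : k ^ (Fintype.card F + 1) = 1)
    (h2 : (2 : F) ≠ 0) (h1 : k ≠ 1) (h1' : k ≠ negOne) :
    tr k ∈ nonsplitTraces F := by
  rw [mem_nonsplitTraces]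
  rintro ⟨s, hs⟩
  set a : F := (tr k + s) / 2 with hadef
  have h2a : 2 * a = tr k + s := by rw [hadef]; field_simp
  have ha : ((k : Matrix (Fin 2) (Fin 2) F) - a • 1).det = 0 := by
    rw [sl2_det_sub]
    have h4 : (4 : F) ≠ 0 := by
      rw [show (4 : F) = 2 * 2 by norm_num]; exact mul_ne_zero h2 h2
    apply mul_left_cancel₀ h4
    linear_combination (2 * a + s - tr k) * h2a - hs
  have hpow : a ^ (Fintype.card F + 1) = 1 := by
    have hc : Commute (k : Matrix (Fin 2) (Fin 2) F) (a • 1) := (Commute.one_right _).smul_right a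
    obtain ⟨z, hz⟩ := hc.sub_dvd_pow_sub_pow (Fintype.card F + 1)
    have h3 := congrArg Matrix.det hz
    rw [Matrix.det_mul, ha, zero_mul, ← Matrix.SpecialLinearGroup.coe_pow, hk, smul_pow, one_pow,
      sl2_det_sub] at h3
    have h4 : (a ^ (Fintype.card F + 1) - 1) ^ 2 = 0 := by
      rw [← h3]; simp [tr]; ring
    exact sub_eq_zero.1 (pow_eq_zero_iff two_ne_zero |>.1 h4)
  have haa : a * a = 1 := by
    rwa [pow_succ, FiniteField.pow_card] at hpow
  rw [sl2_det_sub] at ha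
  have ha0 : a ≠ 0 := left_ne_zero_of_mul_eq_one haa
  have htr : tr k = 2 * a := by
    apply mul_left_cancel₀ ha0
    linear_combination -ha - haa
  have hj : ((Fintype.card F + 1 : ℕ) : F) ≠ 0 := by simp
  rcases eq_one_or_of_tr haa htr hj hpow hk with h | h
  · exact h1 h
  · exact h1' h

/-- A singular matrix that commutes with a matrix without eigenvalues vanishes. -/
theorem eq_zero_of_commute_nonsplit {k : SL(2, F)} (hk : tr k ∈ nonsplitTraces F)
    {Z : Matrix (Fin 2) (Fin 2) F} (hZ : Commute Z k) (hd : Z.det = 0) : Z = 0 := by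
  rw [mem_nonsplitTraces] at hk
  have hdk := sl2_det k
  have hc : k 1 0 ≠ 0 := by
    intro h0
    apply hk
    refine ⟨k 0 0 - k 1 1, ?_⟩
    rw [h0, mul_zero, sub_zero] at hdk
    rw [tr]; linear_combination 4 * hdk
  have e00 : Z 0 0 * k 0 0 + Z 0 1 * k 1 0 = k 0 0 * Z 0 0 + k 0 1 * Z 1 0 := by
    have := congrFun (congrFun hZ 0) 0
    simpa [Matrix.mul_apply, Fin.sum_univ_two] using this
  have e10 : Z 1 0 * k 0 0 + Z 1 1 * k 1 0 = k 1 0 * Z 0 0 + k 1 1 * Z 1 0 := by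
    have := congrFun (congrFun hZ 1) 0
    simpa [Matrix.mul_apply, Fin.sum_univ_two] using this
  rw [Matrix.det_fin_two] at hd
  by_cases hw : Z 1 0 = 0
  · rw [hw] at e00 e10 hd
    have h1 : Z 0 1 = 0 := by
      apply (mul_eq_zero.1 (?_ : Z 0 1 * k 1 0 = 0)).resolve_right hc
      linear_combination e00
    have h2 : Z 1 1 = Z 0 0 := by
      apply mul_right_cancel₀ hc
      linear_combination e10
    have h3 : Z 0 0 = 0 := by
      rw [h2] at hd
      simpa using hd
    ext i j
    fin_cases i <;> fin_cases j <;> simp [h1, h2, h3, hw]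
  · exfalso
    apply hk
    -- Commuting with the nonscalar `k` forces `Z = α + β k` with `β = Z₁₀ / k₁₀`. Then `β² (tr² -
    -- 4)` is the discriminant of `Z`, which is the square of its trace because `det Z = 0`.
    refine ⟨(Z 0 0 + Z 1 1) * k 1 0 / Z 1 0, ?_⟩
    field_simp
    rw [tr]
    have e1 : (Z 0 0 - Z 1 1) * k 1 0 = Z 1 0 * (k 0 0 - k 1 1) := by linear_combination -e10
    have e2 : Z 0 1 * k 1 0 = k 0 1 * Z 1 0 := by linear_combination e00
    linear_combination (-((Z 0 0 - Z 1 1) * k 1 0 + Z 1 0 * (k 0 0 - k 1 1))) * e1 -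
      4 * Z 1 0 * k 1 0 * e2 - 4 * (k 1 0) ^ 2 * hd + 4 * (Z 1 0) ^ 2 * hdk

end Powers

/-! ### Character sums over the stabilizers. -/

section Dimensions

variable {F : Type*} [Field F] [Fintype F] [DecidableEq F] {m : ℕ} (ρ : SL(2, F) →* U m)
  (hρ : (linearRep ρ).IsIrreducible) (hm : 2 * m + 1 = Fintype.card F) (hm1 : 1 < m)

include hρ

theorem normChar_negOne : normChar ρ negOne = (m : ℝ) ^ 2 := by
  have := normChar_mul_of_central ρ hρ (negOne_mem_center (F := F)) 1
  rwa [mul_one, normChar_one] at this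

include hm hm1

theorem normChar_eq_zero_of_pow {k : SL(2, F)} (hk : k ^ (2 * m) = 1) (h1 : k ≠ 1)
    (h1' : k ≠ negOne) : normChar ρ k = 0 := by
  have hcard : Fintype.card F - 1 = 2 * m := by omega
  obtain ⟨s, hs, hs'⟩ := isSplit_of_pow (by rwa [hcard]) (by rw [hcard]; exact even_two_mul m) h1 h1'
  exact normChar_eq_zero_of_split hm ρ hρ hm1 hs hs'

/-- The dimension of the centralizer of a group of even order whose elements have eigenvalues
in `F`. -/
theorem finrank_commLie_of_pow {K : Subgroup SL(2, F)} (hK : ∀ k ∈ K, k ^ (2 * m) = 1)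
    (heven : 2 ∣ Nat.card K) : Module.finrank ℝ (commLie ρ K) * Nat.card K = 2 * m ^ 2 := by
  classical
  have h2 := two_ne_zero_of_card hm
  have hneg := exists_negOne_mem h2 heven
  have hne : (⟨negOne, hneg⟩ : K) ≠ 1 := fun h => negOne_ne_one h2 (congrArg Subtype.val h)
  have h := finrank_commLie_mul_card ρ K
  rw [finsum_eq_sum_of_fintype] at h
  -- Only `1` and `-1` contribute, each with `m²`.
  have h3 : ∀ k : K, normChar ρ k = (if k = 1 then (m : ℝ) ^ 2 else 0) +
      (if k = ⟨negOne, hneg⟩ then (m : ℝ) ^ 2 else 0) := by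
    intro k
    by_cases hk : k = 1
    · subst hk
      rw [if_pos rfl, if_neg hne.symm, add_zero, OneMemClass.coe_one, normChar_one]
    by_cases hk' : k = ⟨negOne, hneg⟩
    · subst hk'
      rw [if_neg hk, if_pos rfl, zero_add, normChar_negOne ρ hρ]
    rw [if_neg hk, if_neg hk', add_zero]
    exact normChar_eq_zero_of_pow ρ hρ hm hm1 (hK k k.2) (fun h => hk (Subtype.ext h))
      (fun h => hk' (Subtype.ext h))
  simp only [h3, Finset.sum_add_distrib, Finset.sum_ite_eq', Finset.mem_univ, if_true] at h
  have : ((Module.finrank ℝ (commLie ρ K) * Nat.card K : ℕ) : ℝ) = ((2 * m ^ 2 : ℕ) : ℝ) := by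
    push_cast; rw [h]; ring
  exact_mod_cast this

open QuaternionGroup in
/-- The dimension of the centralizer of a dicyclic group of order `2(q + 1)`. -/
theorem finrank_commLie_of_quaternion (h4 : 2 ∣ m) {K : Subgroup SL(2, F)}
    (φ : K ≃* QuaternionGroup (m + 1)) :
    Module.finrank ℝ (commLie ρ K) * (4 * (m + 1)) = 2 * m ^ 2 + 2 * m := by
  classical
  have h2 := two_ne_zero_of_card hm
  set f : QuaternionGroup (m + 1) → SL(2, F) := fun x => (φ.symm x : SL(2, F)) with hf
  have hf_mul : ∀ x y, f (x * y) = f x * f y := fun x y => by simp [hf]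
  have hf_one : f 1 = 1 := by simp [hf]
  have hf_pow : ∀ x (j : ℕ), f (x ^ j) = f x ^ j := fun x j => by simp [hf]
  have hf_inj : Function.Injective f := fun x y h => φ.symm.injective (Subtype.ext h)
  have hn : (a (m + 1 : ℕ) : QuaternionGroup (m + 1)) ≠ 1 := by
    rw [one_def, Ne, a.injEq, ZMod.natCast_eq_zero_iff]
    intro h
    have := Nat.le_of_dvd (by omega) h
    omega
  have hnn : (a (m + 1 : ℕ) : QuaternionGroup (m + 1)) * a (m + 1 : ℕ) = 1 := by
    rw [a_mul_a, one_def, ← Nat.cast_add, ← two_mul, ZMod.natCast_self]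
  have hf_n : f (a (m + 1 : ℕ)) = negOne := by
    refine (eq_one_or_of_sq h2 ?_).resolve_left fun h => hn (hf_inj (h.trans hf_one.symm))
    rw [← hf_mul, hnn, hf_one]
  have hsum : ∑ᶠ k : K, normChar ρ k = ∑ i : ZMod (2 * (m + 1)), normChar ρ (f (a i)) +
      ∑ i : ZMod (2 * (m + 1)), normChar ρ (f (xa i)) := by
    have hb : Function.Bijective (Sum.elim (fun i => φ.symm (a i)) fun i => φ.symm (xa i) :
        ZMod (2 * (m + 1)) ⊕ ZMod (2 * (m + 1)) → K) := by
      constructor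
      · rintro (i | i) (j | j) h <;> simp at h <;> simpa using h
      · intro k
        rcases hk : φ k with i | i
        · exact ⟨Sum.inl i, by simp [← hk]⟩
        · exact ⟨Sum.inr i, by simp [← hk]⟩
    rw [← finsum_comp_equiv (Equiv.ofBijective _ hb), finsum_eq_sum_of_fintype,
      Fintype.sum_sum_type]
    rfl
  -- These elements have order four, and `4` divides `2m = q - 1`; so they are split and noncentral.
  have hxa : ∀ i, normChar ρ (f (xa i)) = 0 := by
    intro i
    have hsq : f (xa i) ^ 2 = negOne := by rw [← hf_pow, xa_sq, hf_n]
    refine normChar_eq_zero_of_pow ρ hρ hm hm1 ?_ ?_ ?_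
    · obtain ⟨j, rfl⟩ := h4
      rw [← mul_assoc, pow_mul, ← hf_pow, show 2 * 2 = 4 from rfl, xa_pow_four, hf_one, one_pow]
    · intro h
      rw [h, one_pow] at hsq
      exact negOne_ne_one h2 hsq.symm
    · intro h
      rw [h, ← hf_n, ← hf_pow, sq, hnn, hf_one, hf_n] at hsq
      exact negOne_ne_one h2 hsq.symm
  set T : Finset (ZMod (2 * (m + 1))) := Finset.univ.filter fun i => i ≠ 0 ∧ i ≠ (m + 1 : ℕ) with hT
  have hTN : ∀ i ∈ T, tr (f (a i)) ∈ nonsplitTraces F := by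
    intro i hi
    obtain ⟨-, hi0, hin⟩ := Finset.mem_filter.1 hi
    have hcard : Fintype.card F + 1 = 2 * (m + 1) := by omega
    refine mem_nonsplitTraces_of_pow ?_ h2 ?_ ?_
    · have : (a i : QuaternionGroup (m + 1)) = a 1 ^ i.val := by
        rw [a_one_pow, ZMod.natCast_zmod_val]
      rw [hcard, ← hf_pow, this, pow_right_comm, a_one_pow_n, one_pow, hf_one]
    · intro h
      have := hf_inj (h.trans hf_one.symm)
      rw [one_def, a.injEq] at this
      exact hi0 this
    · intro h
      have := hf_inj (h.trans hf_n.symm)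
      rw [a.injEq] at this
      exact hin this
  have h0n : (0 : ZMod (2 * (m + 1))) ≠ (m + 1 : ℕ) := fun h => hn (by rw [← h, one_def])
  have hTc : T.card = 2 * m := by
    have h5 : T = Finset.univ \ {0, ((m + 1 : ℕ) : ZMod (2 * (m + 1)))} := by
      ext i; simp [hT]
    rw [h5, Finset.card_sdiff_of_subset (Finset.subset_univ _), Finset.card_univ, ZMod.card,
      Finset.card_pair h0n]
    omega
  -- For commuting `x, y` of equal trace, Cayley–Hamilton gives `(x - y)(x - y⁻¹) = 0`. One factor
  -- is singular and commutes with `y`, which has no eigenvalue in `F`, so that factor vanishes.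
  have hfib : ∀ i ∈ T, ∀ j ∈ T, tr (f (a i)) = tr (f (a j)) → i = j ∨ i = -j := by
    intro i hi j hj hij
    have hc : Commute (f (a i)) (f (a j)) := by
      rw [Commute, SemiconjBy, ← hf_mul, ← hf_mul, a_mul_a, a_mul_a, add_comm i j]
    have hcM : Commute (f (a i) : Matrix (Fin 2) (Fin 2) F) (f (a j)) := congrArg Subtype.val hc
    have hinv : f (a (-j)) * f (a j) = 1 := by
      rw [← hf_mul, a_mul_a, neg_add_cancel, ← one_def, hf_one]
    have hcM' : Commute (f (a (-j)) : Matrix (Fin 2) (Fin 2) F) (f (a j)) := by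
      rw [eq_inv_of_mul_eq_one_left hinv]
      exact congrArg Subtype.val (Commute.refl (f (a j))).inv_left
    have hinvM : (f (a (-j)) : Matrix (Fin 2) (Fin 2) F) * f (a j) = 1 := congrArg Subtype.val hinv
    have hjj := sl2_mul_self (f (a j))
    have hii := sl2_mul_self (f (a i))
    have hsumj : (f (a (-j)) : Matrix (Fin 2) (Fin 2) F) = tr (f (a j)) • 1 - f (a j) := by
      have : (f (a (-j)) : Matrix (Fin 2) (Fin 2) F) * (f (a j) * f (a j)) = f (a j) := by
        rw [← mul_assoc, hinvM, one_mul]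
      rw [hjj, mul_sub, mul_smul_comm, hinvM, mul_one] at this
      rw [← this]; abel
    have hprod : ((f (a i) : Matrix (Fin 2) (Fin 2) F) - f (a j)) * (f (a i) - f (a (-j))) = 0 := by
      rw [hsumj, sub_mul, mul_sub, mul_sub, mul_sub, mul_sub, hii, hjj, hij, hcM.eq]
      simp
    have hdet := congrArg Matrix.det hprod
    rw [Matrix.det_mul, Matrix.det_zero] at hdet
    rcases mul_eq_zero.1 hdet with h | h
    · left
      have := sub_eq_zero.1 (eq_zero_of_commute_nonsplit (hTN j hj) (hcM.sub_left (Commute.refl _)) h)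
      have := hf_inj (Subtype.ext this)
      rwa [a.injEq] at this
    · right
      have := sub_eq_zero.1 (eq_zero_of_commute_nonsplit (hTN j hj) (hcM.sub_left hcM') h)
      have := hf_inj (Subtype.ext this)
      rwa [a.injEq] at this
  have hle : ∀ t ∈ nonsplitTraces F, (T.filter fun i => tr (f (a i)) = t).card ≤ 2 := by
    intro t _
    by_cases hne : (T.filter fun i => tr (f (a i)) = t).Nonempty
    · obtain ⟨j, hj⟩ := hne
      obtain ⟨hjT, rfl⟩ := Finset.mem_filter.1 hj
      refine (Finset.card_le_card (t := {j, -j}) ?_).trans Finset.card_le_two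
      intro i hi
      obtain ⟨hi, hij⟩ := Finset.mem_filter.1 hi
      simpa using hfib i hi j hjT hij
    · rw [Finset.not_nonempty_iff_eq_empty.1 hne]; simp
  have hcount := Finset.card_eq_sum_card_fiberwise hTN
  -- The `2m` elements of `T` are spread over at most `m` traces, at most two on each. Hence every
  -- fibre has exactly two elements.
  have heq : ∀ t ∈ nonsplitTraces F, (T.filter fun i => tr (f (a i)) = t).card = 2 := by
    refine (Finset.sum_eq_sum_iff_of_le hle).1 (le_antisymm (Finset.sum_le_sum hle) ?_)
    rw [← hcount, hTc, Finset.sum_const, smul_eq_mul]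
    have := card_nonsplitTraces_le hm
    omega
  have hsumT : ∑ i ∈ T, normChar ρ (f (a i)) = 2 * m := by
    have h5 : ∀ i ∈ T, normChar ρ (f (a i)) = normChar ρ (big 1 0 (tr (f (a i)))) := by
      intro i hi
      refine normChar_of_tr hm ρ fun h0 => ?_
      exact mem_nonsplitTraces.1 (hTN i hi) ⟨0, by rw [h0, mul_zero]⟩
    rw [Finset.sum_congr rfl h5, ← Finset.sum_fiberwise_of_maps_to hTN, ← sum_nonsplit hm ρ hρ hm1,
      Finset.mul_sum]
    refine Finset.sum_congr rfl fun t ht => ?_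
    rw [Finset.sum_congr rfl fun i hi => by rw [(Finset.mem_filter.1 hi).2], Finset.sum_const,
      heq t ht, nsmul_eq_mul]
    simp
  have hsuma : ∑ i : ZMod (2 * (m + 1)), normChar ρ (f (a i)) = 2 * m ^ 2 + 2 * m := by
    rw [← Finset.sum_filter_add_sum_filter_not Finset.univ
      fun i : ZMod (2 * (m + 1)) => i ≠ 0 ∧ i ≠ (m + 1 : ℕ), ← hT, hsumT]
    have h5 : (Finset.univ.filter fun i : ZMod (2 * (m + 1)) => ¬(i ≠ 0 ∧ i ≠ (m + 1 : ℕ))) =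
        {0, ((m + 1 : ℕ) : ZMod (2 * (m + 1)))} := by
      ext i; simp; tauto
    rw [h5, Finset.sum_pair h0n, hf_n, normChar_negOne ρ hρ, ← one_def, hf_one, normChar_one]
    ring
  have h := finrank_commLie_mul_card ρ K
  rw [hsum, hsuma, Finset.sum_congr rfl fun i _ => hxa i, Finset.sum_const_zero, add_zero,
    Nat.card_congr φ.toEquiv, Nat.card_eq_fintype_card, QuaternionGroup.card] at h
  exact_mod_cast h

end Dimensions

/-! ### Orders and exponents of the stabilizers. -/

section Exponents

theorem pow_eq_one_of_mulEquiv {G Q : Type*} [Group G] [Group Q] {K : Subgroup G} (φ : K ≃* Q)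
    {n : ℕ} (hQ : ∀ x : Q, x ^ n = 1) : ∀ k ∈ K, k ^ n = 1 := by
  intro k hk
  have h : (⟨k, hk⟩ : K) ^ n = 1 := φ.injective (by rw [map_pow, hQ, map_one])
  exact congrArg Subtype.val h

theorem quaternionGroup_pow {n j : ℕ} (h4 : 4 ∣ j) (hn : 2 * n ∣ j) (x : QuaternionGroup n) :
    x ^ j = 1 := by
  rcases x with i | i
  · obtain ⟨k, rfl⟩ := hn
    have h : ∀ k : ℕ, (QuaternionGroup.a i : QuaternionGroup n) ^ k = QuaternionGroup.a ((k : ZMod (2 * n)) * i) := by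
      intro k
      induction k with
      | zero => simp
      | succ k ih => rw [pow_succ, ih, QuaternionGroup.a_mul_a]; congr 1; push_cast; ring
    rw [h, Nat.cast_mul, ZMod.natCast_self, zero_mul, zero_mul, QuaternionGroup.a_zero]
  · obtain ⟨k, rfl⟩ := h4
    rw [pow_mul, QuaternionGroup.xa_pow_four, one_pow]

/-- By Cayley–Hamilton, trace `0`, `1`, `-1` gives `x² = -1`, `x³ = -1`, `x³ = 1` respectively. -/
theorem sl2_three_pow (x : SL(2, ZMod 3)) : x ^ 12 = 1 := by
  have ht : ∀ t : ZMod 3, t = 0 ∨ t = 1 ∨ t = -1 := by decide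
  have : Fact (Nat.Prime 3) := ⟨Nat.prime_three⟩
  have h := sl2_mul_self x
  apply Subtype.ext
  rw [Matrix.SpecialLinearGroup.coe_pow, Matrix.SpecialLinearGroup.coe_one]
  generalize (x : Matrix (Fin 2) (Fin 2) (ZMod 3)) = M at h
  rcases ht (tr x) with h0 | h0 | h0 <;> rw [h0] at h
  · have h4 : M ^ 4 = 1 := by
      rw [show M ^ 4 = (M * M) * (M * M) by noncomm_ring, h]; simp
    rw [show 12 = 4 * 3 from rfl, pow_mul, h4, one_pow]
  · rw [one_smul] at h
    have h3 : M ^ 3 = -1 := by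
      rw [show M ^ 3 = (M * M) * M by noncomm_ring, h, sub_mul, h]; simp
    rw [show 12 = 3 * (2 * 2) from rfl, pow_mul, h3, pow_mul, neg_one_sq, one_pow]
  · rw [neg_one_smul] at h
    have h3 : M ^ 3 = 1 := by
      rw [show M ^ 3 = (M * M) * M by noncomm_ring, h, sub_mul, neg_mul, h]; simp
    rw [show 12 = 3 * 4 from rfl, pow_mul, h3, one_pow]

theorem card_sl2_three : Nat.card SL(2, ZMod 3) = 24 := by
  have : Fact (Nat.Prime 3) := ⟨Nat.prime_three⟩
  have h := card_sl2 (F := ZMod 3) (m := 1) (by simp [ZMod.card])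
  have h' : (Nat.card SL(2, ZMod 3) : ℝ) = (24 : ℕ) := by rw [h]; norm_num
  exact_mod_cast h'

end Exponents

theorem card_multiplicative_zmod {G : Type*} [Group G] {K : Subgroup G} {n : ℕ}
    (φ : K ≃* Multiplicative (ZMod n)) : Nat.card K = n ∧ ∀ k ∈ K, k ^ n = 1 := by
  refine ⟨by rw [Nat.card_congr φ.toEquiv, Nat.card_congr Multiplicative.toAdd, Nat.card_zmod],
    pow_eq_one_of_mulEquiv φ fun x => ?_⟩
  apply Multiplicative.toAdd.injective
  simp

/-- The dimensions of the centralizers of the stabilizers of vertices and edges. -/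
theorem OSGraph.exists_finrank {F V E : Type*} [Field F] [Finite F] [MulAction SL(2, F) V]
    [MulAction SL(2, F) E] {q m : ℕ} (hq : Nat.card F = q) (hq13 : q ≡ 13 [MOD 24])
    (hqm : (q - 1) / 2 = m) (X : OSGraph F V E) (ρ : SL(2, F) →* U m)
    (hρ : (linearRep ρ).IsIrreducible) :
    ∃ k : ℕ, 0 < k ∧ q = 12 * k + 1 ∧ m = 6 * k ∧
      Module.finrank ℝ (commLie ρ (X.Gη 0)) = 6 * k ∧
      Module.finrank ℝ (commLie ρ (X.Gη 1)) = 18 * k ^ 2 ∧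
      Module.finrank ℝ (commLie ρ (X.Gη 2)) = 9 * k ^ 2 ∧
      Module.finrank ℝ (commLie ρ (X.Gη 3)) = 12 * k ^ 2 ∧
      Module.finrank ℝ (commLie ρ (X.Gv 1)) = 3 * k ∧
      Module.finrank ℝ (commLie ρ (X.Gv 2)) = 3 * k ∧
      Module.finrank ℝ (commLie ρ (X.Gv 3)) = 3 * k ^ 2 := by
  classical
  let _ := Fintype.ofFinite F
  obtain ⟨k, hk, hqk⟩ : ∃ k : ℕ, 0 < k ∧ q = 12 * k + 1 := by
    refine ⟨q / 12, ?_, ?_⟩ <;> (unfold Nat.ModEq at hq13; omega)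
  obtain rfl : m = 6 * k := by omega
  have hm : 2 * (6 * k) + 1 = Fintype.card F := by rw [← Nat.card_eq_fintype_card, hq]; omega
  have hm1 : 1 < 6 * k := by omega
  -- The split case `c = 2m²/|K| = 72k²/|K|`, which covers every stabilizer needed except that of
  -- `v₂`.
  have key : ∀ K : Subgroup SL(2, F), ∀ n c : ℕ, Nat.card K = n → 2 ∣ n → 0 < n →
      (∀ x ∈ K, x ^ (12 * k) = 1) → c * n = 72 * k ^ 2 →
      Module.finrank ℝ (commLie ρ K) = c := by
    intro K n c hn h2 h0 hpow hc
    have h := finrank_commLie_of_pow ρ hρ hm hm1 (K := K)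
      (by rwa [show 2 * (6 * k) = 12 * k by ring]) (hn ▸ h2)
    rw [hn] at h
    apply Nat.eq_of_mul_eq_mul_right h0
    rw [h, hc]; ring
  have hpow : ∀ (K : Subgroup SL(2, F)) (n : ℕ), n ∣ 12 * k → (∀ x ∈ K, x ^ n = 1) →
      ∀ x ∈ K, x ^ (12 * k) = 1 := by
    rintro K n ⟨c, hc⟩ hK x hx
    rw [hc, pow_mul, hK x hx, one_pow]
  have e0 := X.stab_η₀
  have e1 := X.stab_v₁
  have e2 := X.stab_v₂
  rw [hq, show q - 1 = 12 * k by omega] at e0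
  rw [hq, show (q - 1) / 2 = 6 * k by omega] at e1
  rw [hq, show (q + 1) / 2 = 6 * k + 1 by omega] at e2
  obtain ⟨e0⟩ := e0
  obtain ⟨e1⟩ := e1
  obtain ⟨e2⟩ := e2
  obtain ⟨f1⟩ := X.stab_η₁
  obtain ⟨f2⟩ := X.stab_η₂
  obtain ⟨f3⟩ := X.stab_η₃
  obtain ⟨f4⟩ := X.stab_v₃
  have : NeZero (6 * k) := ⟨by omega⟩
  refine ⟨k, hk, hqk, rfl, ?_, ?_, ?_, ?_, ?_, ?_, ?_⟩
  · exact key _ _ _ (card_multiplicative_zmod e0).1 ⟨6 * k, by ring⟩ (by omega)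
      (card_multiplicative_zmod e0).2 (by ring)
  · exact key _ _ _ (card_multiplicative_zmod f1).1 (by norm_num) (by norm_num)
      (hpow _ _ ⟨3 * k, by ring⟩ (card_multiplicative_zmod f1).2) (by ring)
  · refine key _ 8 _ ?_ (by norm_num) (by norm_num) (pow_eq_one_of_mulEquiv f2
      (quaternionGroup_pow ⟨3 * k, by ring⟩ ⟨3 * k, by ring⟩)) (by ring)
    rw [Nat.card_congr f2.toEquiv, Nat.card_eq_fintype_card, QuaternionGroup.card]
  · exact key _ _ _ (card_multiplicative_zmod f3).1 (by norm_num) (by norm_num)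
      (hpow _ _ ⟨2 * k, by ring⟩ (card_multiplicative_zmod f3).2) (by ring)
  · refine key _ (4 * (6 * k)) _ ?_ ⟨2 * (6 * k), by ring⟩ (by omega) (pow_eq_one_of_mulEquiv e1
      (quaternionGroup_pow ⟨3 * k, by ring⟩ ⟨1, by ring⟩)) (by ring)
    rw [Nat.card_congr e1.toEquiv, Nat.card_eq_fintype_card, QuaternionGroup.card]
  -- The stabilizer of `v₂` has order `4(m + 1)`, giving `2m(m + 1) / (4(m + 1)) = m/2 = 3k`.
  · have h := finrank_commLie_of_quaternion ρ hρ hm hm1 ⟨3 * k, by ring⟩ e2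
    apply Nat.eq_of_mul_eq_mul_right (show 0 < 4 * (6 * k + 1) by omega)
    rw [h]; ring
  · exact key _ 24 _ (by rw [Nat.card_congr f4.toEquiv, card_sl2_three]) (by norm_num)
      (by norm_num) (hpow _ 12 ⟨k, rfl⟩ (pow_eq_one_of_mulEquiv f4 sl2_three_pow)) (by ring)

/-! ### Products and centralizers are Cayley groups -/

section Products

variable {ι R : Type*} [Ring R] [Algebra ℝ R]

/-- The product of subgroups of the group of units of a ring. -/
def piUnits (P : ι → Subgroup Rˣ) : Subgroup (ι → R)ˣ :=
  ⨅ i, (P i).comap (Units.map (Pi.evalMonoidHom (fun _ => R) i))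

theorem mem_piUnits {P : ι → Subgroup Rˣ} {u : (ι → R)ˣ} :
    u ∈ piUnits P ↔ ∀ i, Units.map (Pi.evalMonoidHom (fun _ => R) i) u ∈ P i := by
  simp [piUnits, Subgroup.mem_iInf]

theorem IsCayley.pi {P : ι → Subgroup Rˣ} {𝔰 : ι → Submodule ℝ R} (h : ∀ i, IsCayley (P i) (𝔰 i)) :
    IsCayley (piUnits P) (Submodule.pi Set.univ 𝔰) where
  isUnit_one_sub x hx := Pi.isUnit_iff.2 fun i => (h i).isUnit_one_sub (x i) (hx i trivial)
  mem_of_cay x hx u hu := mem_piUnits.2 fun i =>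
    (h i).mem_of_cay (x i) (hx i trivial) _ (congrFun hu i)
  mem_of_cayInv u hu h1 x hx i _ :=
    (h i).mem_of_cayInv _ (mem_piUnits.1 hu i) (Pi.isUnit_iff.1 h1 i) _ (congrFun hx i)
  conj_mem u hu x hx i _ := (h i).conj_mem _ (mem_piUnits.1 hu i) _ (hx i trivial)
  mem_of_sandwich x hx y hy z hz i _ :=
    (h i).mem_of_sandwich _ (hx i trivial) _ (hy i trivial) _ (congrFun hz i)
  exists_sqrt u hu := by
    choose w hw hw' using fun i => (h i).exists_sqrt _ (mem_piUnits.1 hu i)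
    exact ⟨MulEquiv.piUnits.symm w, mem_piUnits.2 hw,
      Units.ext (funext fun i => congrArg Units.val (hw' i))⟩

theorem IsCayley.bot : IsCayley (⊥ : Subgroup Rˣ) (⊥ : Submodule ℝ R) where
  isUnit_one_sub x hx := by
    rw [(Submodule.mem_bot ℝ).1 hx, sub_zero]; exact isUnit_one
  mem_of_cay x hx u hu := by
    rw [(Submodule.mem_bot ℝ).1 hx, sub_zero, add_zero, mul_one] at hu
    exact Subgroup.mem_bot.2 (Units.ext hu)
  mem_of_cayInv u hu h1 x hx := by
    rw [Subgroup.mem_bot.1 hu] at h1 hx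
    rw [Units.val_one, sub_self] at hx
    exact (Submodule.mem_bot ℝ).2 ((h1.mul_left_eq_zero).1 hx)
  conj_mem u hu x hx := by
    rw [(Submodule.mem_bot ℝ).1 hx, mul_zero, zero_mul]; exact zero_mem _
  mem_of_sandwich x hx y hy z hz := by
    rw [(Submodule.mem_bot ℝ).1 hx, (Submodule.mem_bot ℝ).1 hy] at hz
    rw [Submodule.mem_bot]
    simpa using hz
  exists_sqrt u hu := ⟨1, one_mem _, by rw [Subgroup.mem_bot.1 hu, one_mul]⟩

theorem finrank_submodule_pi [Fintype ι] [FiniteDimensional ℝ R] (𝔰 : ι → Submodule ℝ R) :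
    Module.finrank ℝ (Submodule.pi Set.univ 𝔰) = ∑ i, Module.finrank ℝ (𝔰 i) := by
  let φ : Submodule.pi Set.univ 𝔰 ≃ₗ[ℝ] (∀ i, 𝔰 i) :=
    { toFun := fun x i => ⟨x.1 i, x.2 i trivial⟩
      invFun := fun x => ⟨fun i => x i, fun i _ => (x i).2⟩
      map_add' := fun _ _ => rfl
      map_smul' := fun _ _ => rfl
      left_inv := fun _ => rfl
      right_inv := fun _ => rfl }
  rw [φ.finrank_eq, Module.finrank_pi_fintype]

end Products

/-! ### Centralizers in the unitary group. -/

section Unitary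

variable {m : ℕ}

open scoped ComplexOrder in
-- For skew-Hermitian `x` the product `(1 + x)(1 - x) = 1 + x* x` is positive definite.
theorem isUnit_one_sub_of_skew {x : Matrix (Fin m) (Fin m) ℂ} (hx : star x = -x) :
    IsUnit (1 - x) := by
  have h1 : (1 + star x * x).PosDef :=
    Matrix.PosDef.one.add_posSemidef (Matrix.posSemidef_conjTranspose_mul_self x)
  have h2 : 1 + star x * x = (1 + x) * (1 - x) := by rw [hx]; noncomm_ring
  have h3 := h1.isUnit
  rw [h2, Matrix.isUnit_iff_isUnit_det, Matrix.det_mul] at h3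
  exact (Matrix.isUnit_iff_isUnit_det _).2 (isUnit_of_mul_isUnit_right h3)

open scoped Matrix.Norms.L2Operator in
/-- A unitary matrix has a unitary square root that commutes with everything that commutes with
the matrix and its adjoint. -/
theorem exists_unitary_sqrt {u : Matrix (Fin m) (Fin m) ℂ} (hu : u ∈ Matrix.unitaryGroup (Fin m) ℂ) :
    ∃ w ∈ Matrix.unitaryGroup (Fin m) ℂ, w * w = u ∧
      ∀ x, Commute u x → Commute (star u) x → Commute w x := by
  have hn : IsStarNormal u := ⟨by rw [Commute, SemiconjBy, hu.1, hu.2]⟩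
  have hfin : (spectrum ℂ u).Finite := Matrix.finite_spectrum u
  have hsp : ∀ z ∈ spectrum ℂ u, ‖z‖ = 1 := fun z hz => by
    simpa using spectrum.subset_circle_of_unitary hu hz
  -- The branch cut is harmless: the spectrum is finite, so every function is continuous on it.
  let f : ℂ → ℂ := fun z => z ^ (1 / 2 : ℂ)
  have hf : ContinuousOn f (spectrum ℂ u) := hfin.continuousOn _
  have hf2 : ∀ z ∈ spectrum ℂ u, f z * f z = z := by
    intro z hz
    have hz0 : z ≠ 0 := by
      rintro rfl
      simpa using hsp 0 hz
    change z ^ (1 / 2 : ℂ) * z ^ (1 / 2 : ℂ) = z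
    rw [← Complex.cpow_add _ _ hz0]
    norm_num
  refine ⟨cfc f u, ?_, ?_, fun x h1 h2 => ?_⟩
  · refine (cfc_unitary_iff f u).2 fun z hz => ?_
    have h3 : ‖f z‖ * ‖f z‖ = 1 := by rw [← norm_mul, hf2 z hz, hsp z hz]
    rw [RCLike.star_def, mul_comm, Complex.mul_conj, Complex.normSq_eq_norm_sq, sq, h3]
    simp
  · rw [← cfc_mul f f u, cfc_congr (g := id) fun z hz => hf2 z hz, cfc_id ℂ u]
  · exact Commute.cfc h1 h2 f

variable {G : Type*} [Group G] (ρ : G →* U m)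

/-- The centralizer of `ρ(K)` in `U(m)` as a group of invertible matrices. -/
def unitsCentralizer (K : Subgroup G) : Subgroup (Matrix (Fin m) (Fin m) ℂ)ˣ :=
  (Subgroup.centralizer (ρ '' (K : Set G))).map Unitary.toUnits

theorem mem_unitsCentralizer {K : Subgroup G} {u : (Matrix (Fin m) (Fin m) ℂ)ˣ} :
    u ∈ unitsCentralizer ρ K ↔ (u : Matrix (Fin m) (Fin m) ℂ) ∈ Matrix.unitaryGroup (Fin m) ℂ ∧
      ∀ k ∈ K, mat ρ k * u = u * mat ρ k := by
  constructor
  · rintro ⟨t, ht, rfl⟩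
    exact ⟨t.2, fun k hk => congrArg Subtype.val (Subgroup.mem_centralizer_iff.1 ht _ ⟨k, hk, rfl⟩)⟩
  · rintro ⟨h1, h2⟩
    refine ⟨⟨u, h1⟩, Subgroup.mem_centralizer_iff.2 ?_, Units.ext rfl⟩
    rintro _ ⟨k, hk, rfl⟩
    exact Subtype.ext (h2 k hk)

theorem inv_eq_star {u : (Matrix (Fin m) (Fin m) ℂ)ˣ}
    (hu : (u : Matrix (Fin m) (Fin m) ℂ) ∈ Matrix.unitaryGroup (Fin m) ℂ) :
    (↑u⁻¹ : Matrix (Fin m) (Fin m) ℂ) = star (u : Matrix (Fin m) (Fin m) ℂ) :=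
  Units.inv_eq_of_mul_eq_one_right hu.2

/-- Each closure property is an identity cleared of the invertible factors `1 ± x` or `u + 1`.
Unitarity and skewness come from the adjoint of the given equation, commutation with `ρ(K)` from its
conjugate. -/
theorem isCayley_unitsCentralizer (K : Subgroup G) :
    IsCayley (unitsCentralizer ρ K) (commLie ρ K) where
  isUnit_one_sub x hx := isUnit_one_sub_of_skew ((mem_commLie ρ).1 hx).1
  mem_of_cay x hx u hu := by
    obtain ⟨hx1, hx2⟩ := (mem_commLie ρ).1 hx
    have h1 := isUnit_one_sub_of_skew hx1
    have h2 : IsUnit (1 + x) := by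
      simpa using isUnit_one_sub_of_skew (x := -x) (by rw [star_neg, hx1])
    have h3 : (1 + x) * star (u : Matrix (Fin m) (Fin m) ℂ) = 1 - x := by
      have := congrArg star hu
      rwa [star_mul, star_sub, star_add, star_one, hx1, sub_neg_eq_add, ← sub_eq_add_neg] at this
    rw [mem_unitsCentralizer]
    refine ⟨Matrix.mem_unitaryGroup_iff'.2 ?_, fun k hk => ?_⟩
    · apply h2.mul_left_cancel
      apply h1.mul_right_cancel
      rw [← mul_assoc, h3, mul_assoc, hu]
      noncomm_ring
    · apply h1.mul_right_cancel
      rw [mul_assoc, hu, mul_assoc, mul_sub, mul_one, hx2 k hk, mul_add, mul_one, hx2 k hk,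
        show mat ρ k - x * mat ρ k = (1 - x) * mat ρ k by noncomm_ring, ← mul_assoc, hu]
      noncomm_ring
  mem_of_cayInv u hu h1 x hx := by
    obtain ⟨hu1, hu2⟩ := (mem_unitsCentralizer ρ).1 hu
    rw [mem_commLie]
    have h2 : ((u : Matrix (Fin m) (Fin m) ℂ) + 1) * x = u - 1 := by
      apply h1.mul_right_cancel
      rw [mul_assoc, hx]
      noncomm_ring
    refine ⟨?_, fun k hk => ?_⟩
    · have h3 := congrArg star hx
      rw [star_mul, star_add, star_sub, star_one] at h3
      have h4 : ((u : Matrix (Fin m) (Fin m) ℂ) + 1) * star x = 1 - u := by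
        calc _ = (u : Matrix (Fin m) (Fin m) ℂ) * ((star (u : Matrix (Fin m) (Fin m) ℂ) + 1) * star x) := by
              rw [← mul_assoc, mul_add, hu1.2, mul_one, add_comm]
          _ = 1 - u := by rw [h3, mul_sub, hu1.2, mul_one]
      apply h1.mul_left_cancel
      rw [h4, mul_neg, h2, neg_sub]
    · apply h1.mul_right_cancel
      have h5 : mat ρ k * ((u : Matrix (Fin m) (Fin m) ℂ) + 1) = (u + 1) * mat ρ k := by
        rw [mul_add, hu2 k hk]; noncomm_ring
      rw [mul_assoc, hx, mul_assoc, h5, ← mul_assoc, hx, mul_sub, hu2 k hk]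
      noncomm_ring
  conj_mem u hu x hx := by
    obtain ⟨hu1, hu2⟩ := (mem_unitsCentralizer ρ).1 hu
    obtain ⟨hu3, hu4⟩ := (mem_unitsCentralizer ρ).1 (inv_mem hu)
    obtain ⟨hx1, hx2⟩ := (mem_commLie ρ).1 hx
    rw [mem_commLie]
    refine ⟨?_, fun k hk => ?_⟩
    · rw [inv_eq_star hu1, star_mul, star_mul, star_star, hx1]
      noncomm_ring
    · rw [← mul_assoc, ← mul_assoc, hu2 k hk, mul_assoc (u : Matrix (Fin m) (Fin m) ℂ), hx2 k hk,
        ← mul_assoc, mul_assoc _ (mat ρ k), hu4 k hk, ← mul_assoc]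
  mem_of_sandwich x hx y hy z hz := by
    obtain ⟨hx1, hx2⟩ := (mem_commLie ρ).1 hx
    obtain ⟨hy1, hy2⟩ := (mem_commLie ρ).1 hy
    have h1 := isUnit_one_sub_of_skew hx1
    have h2 : IsUnit (1 + x) := by
      simpa using isUnit_one_sub_of_skew (x := -x) (by rw [star_neg, hx1])
    rw [mem_commLie]
    refine ⟨?_, fun k hk => ?_⟩
    · apply h2.mul_left_cancel
      apply h1.mul_right_cancel
      have := congrArg star hz
      rw [star_mul, star_mul, star_sub, star_add, star_one, hx1, sub_neg_eq_add,
        ← sub_eq_add_neg, hy1, ← hz] at this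
      rw [mul_assoc, this]
      noncomm_ring
    · apply h2.mul_left_cancel
      apply h1.mul_right_cancel
      have e1 : (1 + x) * mat ρ k = mat ρ k * (1 + x) := by rw [mul_add, hx2 k hk]; noncomm_ring
      have e2 : mat ρ k * (1 - x) = (1 - x) * mat ρ k := by rw [mul_sub, hx2 k hk]; noncomm_ring
      rw [← mul_assoc, e1, mul_assoc, mul_assoc, ← mul_assoc (1 + x), hz, hy2 k hk, ← hz]
      simp only [mul_assoc, e2]
  -- A functional calculus square root of `u` commutes with whatever commutes with `u` and `u*`, so
  -- it stays in the centralizer.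
  exists_sqrt u hu := by
    obtain ⟨hu1, hu2⟩ := (mem_unitsCentralizer ρ).1 hu
    obtain ⟨hu3, hu4⟩ := (mem_unitsCentralizer ρ).1 (inv_mem hu)
    rw [inv_eq_star hu1] at hu4
    obtain ⟨w, hw1, hw2, hw3⟩ := exists_unitary_sqrt hu1
    refine ⟨Unitary.toUnits ⟨w, hw1⟩, (mem_unitsCentralizer ρ).2 ⟨hw1, fun k hk => ?_⟩, Units.ext hw2⟩
    exact (hw3 _ (hu2 k hk).symm (hu4 k hk).symm).eq.symm

end Unitary

/-! ### The orbit spaces of the moduli -/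

section OrbitSpaces

open scoped Matrix.Norms.Operator

variable {F V E : Type*} [Field F] [MulAction SL(2, F) V] [MulAction SL(2, F) E]
  (X : OSGraph F V E) {m : ℕ} (ρ : SL(2, F) →* U m) {ι : Type} [Fintype ι] (ε : ι → Fin 4)
  (S : Set (Fin 4))

/-- The group of units of the algebra of tuples of matrices which is formed by the moduli. -/
def OSGraph.modUnits : Subgroup (ι → Matrix (Fin m) (Fin m) ℂ)ˣ :=
  piUnits fun i => unitsCentralizer ρ (X.Gη (ε i))

/-- The Lie algebra of the group of moduli. -/
def OSGraph.modLie : Submodule ℝ (ι → Matrix (Fin m) (Fin m) ℂ) :=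
  Submodule.pi Set.univ fun i => commLie ρ (X.Gη (ε i))

open Classical in
/-- The gauge group as a group of units of the algebra of quadruples of matrices. -/
def OSGraph.gaugeUnits : Subgroup (Fin 4 → Matrix (Fin m) (Fin m) ℂ)ˣ :=
  piUnits fun i => if i ∈ S then ⊥ else unitsCentralizer ρ (X.Gv i)

open Classical in
/-- The Lie algebra of the gauge group. -/
def OSGraph.gaugeLie : Submodule ℝ (Fin 4 → Matrix (Fin m) (Fin m) ℂ) :=
  Submodule.pi Set.univ fun i => if i ∈ S then ⊥ else commLie ρ (X.Gv i)

/-- The action of the gauge group from the left. -/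
def OSGraph.gaugeLeft :
    (Fin 4 → Matrix (Fin m) (Fin m) ℂ) →ₐ[ℝ] (ι → Matrix (Fin m) (Fin m) ℂ) where
  toFun x i := mat ρ (X.g (ε i)) * x (tgt (ε i)) * mat ρ (X.g (ε i))⁻¹
  map_one' := by
    funext i
    rw [Pi.one_apply, mul_one, ← mat_mul, mul_inv_cancel, mat_one, Pi.one_apply]
  map_mul' x y := by
    funext i
    have h : mat ρ (X.g (ε i))⁻¹ * mat ρ (X.g (ε i)) = 1 := by rw [← mat_mul, inv_mul_cancel, mat_one]
    simp only [Pi.mul_apply, mul_assoc]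
    rw [← mul_assoc (mat ρ (X.g (ε i))⁻¹), h, one_mul]
  map_zero' := by funext i; simp
  map_add' x y := by funext i; simp [mul_add, add_mul]
  commutes' c := by
    funext i
    simp only [Pi.algebraMap_apply]
    rw [← Algebra.commutes, mul_assoc, ← mat_mul, mul_inv_cancel, mat_one, mul_one]

/-- The action of the gauge group from the right. -/
def gaugeRight :
    (Fin 4 → Matrix (Fin m) (Fin m) ℂ) →ₐ[ℝ] (ι → Matrix (Fin m) (Fin m) ℂ) where
  toFun x i := x (src (ε i))
  map_one' := rfl
  map_mul' _ _ := rfl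
  map_zero' := rfl
  map_add' _ _ := rfl
  commutes' _ := rfl

/-- A point of the moduli as an invertible tuple of matrices. -/
def OSGraph.modToUnits (τ : X.Moduli ρ ε) : (ι → Matrix (Fin m) (Fin m) ℂ)ˣ :=
  MulEquiv.piUnits.symm fun i => Unitary.toUnits (τ.entry i : U m)

variable {ρ S} in
/-- An element of the gauge group as an invertible quadruple of matrices. -/
def OSGraph.gaugeToUnits (α : X.Gauge ρ S) : (Fin 4 → Matrix (Fin m) (Fin m) ℂ)ˣ :=
  MulEquiv.piUnits.symm fun i => Unitary.toUnits (α.1 i : U m)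

variable {ρ S} in
theorem OSGraph.mem_gaugeUnits {u : (Fin 4 → Matrix (Fin m) (Fin m) ℂ)ˣ} :
    u ∈ X.gaugeUnits ρ S ↔ ∃ α : X.Gauge ρ S, u = X.gaugeToUnits α := by
  rw [OSGraph.gaugeUnits, mem_piUnits]
  constructor
  · intro h
    have h1 : ∀ i, ∃ t : X.Cv ρ i, Unitary.toUnits (t : U m) =
        Units.map (Pi.evalMonoidHom (fun _ => Matrix (Fin m) (Fin m) ℂ) i) u ∧ (i ∈ S → t = 1) := by
      intro i
      have hi := h i
      split_ifs at hi with hS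
      · exact ⟨1, by rw [Subgroup.mem_bot.1 hi]; simp, fun _ => rfl⟩
      · obtain ⟨t, ht, ht'⟩ := hi
        exact ⟨⟨t, ht⟩, ht', fun h => absurd h hS⟩
    choose t ht ht' using h1
    exact ⟨⟨t, ht'⟩, Units.ext (funext fun i => (congrArg Units.val (ht i)).symm)⟩
  · rintro ⟨α, rfl⟩ i
    split_ifs with hS
    · refine Subgroup.mem_bot.2 (Units.ext ?_)
      change ((α.1 i : U m) : Matrix (Fin m) (Fin m) ℂ) = 1
      rw [α.2 i hS]; rfl
    · exact ⟨(α.1 i : U m), (α.1 i).2, Units.ext rfl⟩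

theorem OSGraph.range_modToUnits : Set.range (X.modToUnits ρ ε) = X.modUnits ρ ε := by
  ext u
  rw [SetLike.mem_coe, OSGraph.modUnits, mem_piUnits]
  constructor
  · rintro ⟨τ, rfl⟩ i
    exact ⟨(τ.entry i : U m), (τ.entry i).2, Units.ext rfl⟩
  · intro h
    choose t ht ht' using h
    exact ⟨⟨fun i => ⟨t i, ht i⟩⟩, Units.ext (funext fun i => congrArg Units.val (ht' i))⟩

theorem OSGraph.injective_modToUnits : Function.Injective (X.modToUnits ρ ε) := by
  intro x y h
  apply OSGraph.Moduli.ext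
  funext i
  exact Subtype.ext (Subtype.ext (congrFun (congrArg Units.val h) i))

theorem OSGraph.inducing_modToUnits :
    Topology.IsInducing fun x => (X.modToUnits ρ ε x : ι → Matrix (Fin m) (Fin m) ℂ) := by
  have h1 : Topology.IsInducing (OSGraph.Moduli.entry : X.Moduli ρ ε → _) := ⟨rfl⟩
  have h2 : Topology.IsInducing fun (x : ∀ i, X.Cη ρ (ε i)) (i : ι) =>
      ((x i : U m) : Matrix (Fin m) (Fin m) ℂ) :=
    Topology.IsInducing.piMap (f := fun i (t : X.Cη ρ (ε i)) => ((t : U m) : Matrix (Fin m) (Fin m) ℂ))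
      fun _ => Topology.IsInducing.subtypeVal.comp Topology.IsInducing.subtypeVal
  exact h2.comp h1

theorem OSGraph.continuous_entry (i : ι) :
    Continuous fun x : X.Moduli ρ ε => ((x.entry i : U m) : Matrix (Fin m) (Fin m) ℂ) :=
  (continuous_apply i).comp (X.inducing_modToUnits ρ ε).continuous

instance OSGraph.continuousConstSMul : ContinuousConstSMul (X.Gauge ρ S)ᵐᵒᵖ (X.Moduli ρ ε) where
  continuous_const_smul α := by
    rw [(X.inducing_modToUnits ρ ε).continuous_iff]
    refine continuous_pi fun i => ?_
    exact ((continuous_const.mul (X.continuous_entry ρ ε i)).mul continuous_const)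

theorem OSGraph.proj_eq_iff (x y : X.Moduli ρ ε) : X.proj ρ ε S x = X.proj ρ ε S y ↔
    ∃ α : X.Gauge ρ S, y = MulOpposite.op α • x := by
  constructor
  · intro h
    obtain ⟨α, hα⟩ := Quotient.exact h.symm
    exact ⟨α.unop, hα.symm⟩
  · rintro ⟨α, rfl⟩
    exact (Quotient.sound ⟨MulOpposite.op α, rfl⟩ : X.proj ρ ε S (MulOpposite.op α • x) = _).symm

theorem OSGraph.isOpenQuotientMap_proj : IsOpenQuotientMap (X.proj ρ ε S) :=
  MulAction.isOpenQuotientMap_quotientMk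

theorem OSGraph.modToUnits_eq_iff (x y : X.Moduli ρ ε) (α : X.Gauge ρ S) :
    (X.modToUnits ρ ε y : ι → Matrix (Fin m) (Fin m) ℂ) =
      X.gaugeLeft ρ ε (↑(X.gaugeToUnits α)⁻¹ : Fin 4 → Matrix (Fin m) (Fin m) ℂ) *
      X.modToUnits ρ ε x * gaugeRight ε (X.gaugeToUnits α : Fin 4 → Matrix (Fin m) (Fin m) ℂ) ↔ y = MulOpposite.op α • x := by
  have h : ∀ i, ((MulOpposite.op α • x).entry i : U m).1 = mat ρ (X.g (ε i)) *
      ((α.1 (tgt (ε i)) : U m)⁻¹ : U m).1 * mat ρ (X.g (ε i))⁻¹ * (x.entry i : U m).1 *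
      (α.1 (src (ε i)) : U m).1 := fun i => by
    rw [X.smul_apply, ← map_inv]; rfl
  constructor
  · intro hy
    apply OSGraph.Moduli.ext
    funext i
    exact Subtype.ext (Subtype.ext ((congrFun hy i).trans (h i).symm))
  · rintro rfl
    exact funext h

/-- The group is cut out by finitely or infinitely many closed conditions on the matrices:
unitarity, commutation, and triviality on `S`. -/
theorem OSGraph.isClosed_gaugeUnits : IsClosed
    ((fun h : (Fin 4 → Matrix (Fin m) (Fin m) ℂ)ˣ => (h : Fin 4 → Matrix (Fin m) (Fin m) ℂ)) ''
      (X.gaugeUnits ρ S : Set (Fin 4 → Matrix (Fin m) (Fin m) ℂ)ˣ)) := by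
  have h : ((fun h : (Fin 4 → Matrix (Fin m) (Fin m) ℂ)ˣ => (h : Fin 4 → Matrix (Fin m) (Fin m) ℂ)) ''
      (X.gaugeUnits ρ S : Set (Fin 4 → Matrix (Fin m) (Fin m) ℂ)ˣ)) =
      ⋂ i, {x | star (x i) * x i = 1} ∩ {x | x i * star (x i) = 1} ∩
        (⋂ k ∈ X.Gv i, {x | mat ρ k * x i = x i * mat ρ k}) ∩ (⋂ _ : i ∈ S, {x | x i = 1}) := by
    ext x
    simp only [Set.mem_image, SetLike.mem_coe, X.mem_gaugeUnits, Set.mem_iInter, Set.mem_inter_iff,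
      Set.mem_ofPred_eq]
    constructor
    · rintro ⟨_, ⟨α, rfl⟩, rfl⟩ i
      exact ⟨⟨⟨(α.1 i : U m).2.1, (α.1 i : U m).2.2⟩, fun k hk => congrArg Subtype.val
        (Subgroup.mem_centralizer_iff.1 (α.1 i).2 _ ⟨k, hk, rfl⟩)⟩,
        fun hS => by change ((α.1 i : U m) : Matrix (Fin m) (Fin m) ℂ) = 1; rw [α.2 i hS]; rfl⟩
    · intro hx
      refine ⟨_, ⟨⟨fun i => ⟨⟨x i, (hx i).1.1⟩, Subgroup.mem_centralizer_iff.2 ?_⟩, fun i hS =>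
        Subtype.ext (Subtype.ext ((hx i).2 hS))⟩, rfl⟩, rfl⟩
      rintro _ ⟨k, hk, rfl⟩
      exact Subtype.ext ((hx i).1.2 k hk)
  rw [h]
  have hc : ∀ i : Fin 4, Continuous fun x : Fin 4 → Matrix (Fin m) (Fin m) ℂ => x i := continuous_apply
  have hs : ∀ i : Fin 4, Continuous fun x : Fin 4 → Matrix (Fin m) (Fin m) ℂ => star (x i) :=
    fun i => (hc i).matrix_conjTranspose
  refine isClosed_iInter fun i => IsClosed.inter (IsClosed.inter (IsClosed.inter ?_ ?_) ?_) ?_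
  · exact isClosed_eq ((hs i).mul (hc i)) continuous_const
  · exact isClosed_eq ((hc i).mul (hs i)) continuous_const
  · exact isClosed_biInter fun k _ => isClosed_eq (continuous_const.mul (hc i)) ((hc i).mul continuous_const)
  · exact isClosed_iInter fun _ => isClosed_eq (hc i) continuous_const

theorem OSGraph.isCayleyPair : IsCayleyPair (X.modUnits ρ ε) (X.modLie ρ ε) (X.gaugeUnits ρ S)
    (X.gaugeLie ρ S) (X.gaugeLeft ρ ε) (gaugeRight ε) where
  left := IsCayley.pi fun i => isCayley_unitsCentralizer ρ _
  right := IsCayley.pi fun i => by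
    split_ifs
    · exact IsCayley.bot
    · exact isCayley_unitsCentralizer ρ _
  l_mem h hh := by
    obtain ⟨α, rfl⟩ := X.mem_gaugeUnits.1 hh
    refine mem_piUnits.2 fun i => ⟨_, X.conj_Cv_tgt ρ (α.1 (tgt (ε i))).2, Units.ext ?_⟩
    rw [← map_inv]; rfl
  r_mem h hh := by
    obtain ⟨α, rfl⟩ := X.mem_gaugeUnits.1 hh
    exact mem_piUnits.2 fun i => ⟨_, X.Cv_src_le ρ _ (α.1 (src (ε i))).2, Units.ext rfl⟩
  l_mem' x hx i _ := by
    have hi := hx (tgt (ε i)) trivial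
    have hi' : x (tgt (ε i)) ∈ commLie ρ (X.Gv (tgt (ε i))) := by
      simp only at hi
      split_ifs at hi
      · rw [(Submodule.mem_bot ℝ).1 hi]; exact zero_mem _
      · exact hi
    obtain ⟨h1, h2⟩ := (mem_commLie ρ).1 hi'
    change mat ρ (X.g (ε i)) * x (tgt (ε i)) * mat ρ (X.g (ε i))⁻¹ ∈ _
    have hg : mat ρ (X.g (ε i)) * mat ρ (X.g (ε i))⁻¹ = 1 := by rw [← mat_mul, mul_inv_cancel, mat_one]
    refine (mem_commLie ρ).2 ⟨?_, fun k hk => ?_⟩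
    · rw [star_mul, star_mul, star_mat, star_mat, inv_inv, h1]
      noncomm_ring
    · have h3 := h2 _ (X.mem_tgt hk)
      calc _ = mat ρ (X.g (ε i)) * (mat ρ ((X.g (ε i))⁻¹ * k * X.g (ε i)) * x (tgt (ε i))) *
            mat ρ (X.g (ε i))⁻¹ := by
            simp only [mat_mul, ← mul_assoc, hg, one_mul]
        _ = _ := by
            rw [h3]
            simp only [mat_mul, mul_assoc, hg, mul_one]
  r_mem' x hx i _ := by
    have hi := hx (src (ε i)) trivial
    have hi' : x (src (ε i)) ∈ commLie ρ (X.Gv (src (ε i))) := by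
      simp only at hi
      split_ifs at hi
      · rw [(Submodule.mem_bot ℝ).1 hi]; exact zero_mem _
      · exact hi
    obtain ⟨h1, h2⟩ := (mem_commLie ρ).1 hi'
    exact (mem_commLie ρ).2 ⟨h1, fun k hk => h2 k (X.mem_src hk)⟩

/-- The orbit space of the moduli is the quotient of a Cayley group if the action of the gauge
group is free, in the sense that the group element is a continuous function `δ` of the two points. -/
theorem OSGraph.isCayleyQuotient
    (δ : X.Moduli ρ ε → X.Moduli ρ ε → Fin 4 → Matrix (Fin m) (Fin m) ℂ)
    (hδ : Continuous (Function.uncurry δ)) (hδ' : ∀ (x : X.Moduli ρ ε) (α : X.Gauge ρ S) (i : Fin 4),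
      δ x (MulOpposite.op α • x) i = (α.1 i : U m).1) :
    IsCayleyQuotient (X.modUnits ρ ε) (X.modLie ρ ε) (X.gaugeUnits ρ S) (X.gaugeLie ρ S)
      (X.gaugeLeft ρ ε) (gaugeRight ε) (X.modToUnits ρ ε) (X.proj ρ ε S) δ where
  pair := X.isCayleyPair ρ ε S
  range_e := X.range_modToUnits ρ ε
  injective_e := X.injective_modToUnits ρ ε
  inducing_e := X.inducing_modToUnits ρ ε
  quot := X.isOpenQuotientMap_proj ρ ε S
  rel x y := by
    rw [X.proj_eq_iff]
    constructor
    · rintro ⟨α, h⟩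
      exact ⟨_, X.mem_gaugeUnits.2 ⟨α, rfl⟩, (X.modToUnits_eq_iff ρ ε S x y α).2 h⟩
    · rintro ⟨h, hh, he⟩
      obtain ⟨α, rfl⟩ := X.mem_gaugeUnits.1 hh
      exact ⟨α, (X.modToUnits_eq_iff ρ ε S x y α).1 he⟩
  continuous_δ := hδ
  δ_spec x y h hh he := by
    obtain ⟨α, rfl⟩ := X.mem_gaugeUnits.1 hh
    obtain rfl := (X.modToUnits_eq_iff ρ ε S x y α).1 he
    exact funext fun i => (hδ' x α i).symm
  isClosed := X.isClosed_gaugeUnits ρ S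

/-- The orbit space is an oriented quotient manifold. -/
theorem OSGraph.exists_isQuotientManifold
    (δ : X.Moduli ρ ε → X.Moduli ρ ε → Fin 4 → Matrix (Fin m) (Fin m) ℂ)
    (hδ : Continuous (Function.uncurry δ)) (hδ' : ∀ (x : X.Moduli ρ ε) (α : X.Gauge ρ S) (i : Fin 4),
      δ x (MulOpposite.op α • x) i = (α.1 i : U m).1) {n : ℕ} (hn : n ≠ 0)
    (hdim : Module.finrank ℝ (X.modLie ρ ε) = n + Module.finrank ℝ (X.gaugeLie ρ S)) :
    ∃ _ : ChartedSpace (EuclideanSpace ℝ (Fin n)) (X.OrbitSpace ρ ε S),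
      IsQuotientManifold (X.coords ρ ε) (X.proj ρ ε S) n ∧
      ∃ A : Set (OpenPartialHomeomorph (X.OrbitSpace ρ ε S) (EuclideanSpace ℝ (Fin n))),
        IsOrientedAtlas A := by
  -- Matrices carry an operator norm and arrays the sup norm. The topologies agree, so the identity
  -- is continuous both ways.
  let Λ : (ι → Matrix (Fin m) (Fin m) ℂ) →L[ℝ] (ι → Fin m → Fin m → ℂ) :=
    ⟨{ toFun := fun x i j k => x i j k, map_add' := fun _ _ => rfl, map_smul' := fun _ _ => rfl },
      continuous_id⟩
  let Λ' : (ι → Fin m → Fin m → ℂ) →L[ℝ] (ι → Matrix (Fin m) (Fin m) ℂ) :=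
    ⟨{ toFun := fun x i => Matrix.of (x i), map_add' := fun _ _ => rfl,
        map_smul' := fun _ _ => rfl }, continuous_id⟩
  exact (X.isCayleyQuotient ρ ε S δ hδ hδ').exists_isQuotientManifold hn hdim Λ Λ' fun _ => rfl

end OrbitSpaces

/-! ### Freeness of the gauge actions. -/

section Spaces

variable {F V E : Type*} [Field F] [MulAction SL(2, F) V] [MulAction SL(2, F) E]
  (X : OSGraph F V E) {m : ℕ} (ρ : SL(2, F) →* U m)

/-- The element of the gauge group that moves one point of `𝓜₀` to another. -/
def OSGraph.gaugeOfM₀ (x y : X.M₀ ρ) : Fin 4 → U m :=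
  ![1, (x.entry 0 : U m) * (y.entry 0 : U m)⁻¹,
    (x.entry 1 : U m) * ((x.entry 0 : U m) * (y.entry 0 : U m)⁻¹) * (y.entry 1 : U m)⁻¹,
    (x.entry 2 : U m) * ((x.entry 0 : U m) * (y.entry 0 : U m)⁻¹) * (y.entry 2 : U m)⁻¹]

/-- The element of the gauge group that moves one point of `M` to another. -/
def OSGraph.gaugeOfM (x y : X.Moduli ρ edges023) : Fin 4 → U m :=
  ![1, (x.entry 0 : U m) * (y.entry 0 : U m)⁻¹, 1,
    (x.entry 1 : U m) * ((x.entry 0 : U m) * (y.entry 0 : U m)⁻¹) * (y.entry 1 : U m)⁻¹]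

theorem OSGraph.rho_g {e : Fin 4} (he : e ≠ 3) : ρ (X.g e) = 1 := by rw [X.g_tree e he, map_one]

/-- Starting from `α₀ = 1`, the entries at `η₀, η₁, η₂` determine `α₁`, then `α₂` and `α₃`. The tree
edges alone suffice. -/
theorem OSGraph.gaugeOfM₀_eq {x y : X.M₀ ρ} (α : X.Gauge ρ {0})
    (hy : ∀ i, (y.entry i : U m) = ρ (X.g i) * (α.1 (tgt i) : U m)⁻¹ * (ρ (X.g i))⁻¹ *
      (x.entry i : U m) * (α.1 (src i) : U m)) (i : Fin 4) :
    X.gaugeOfM₀ ρ x y i = α.1 i := by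
  have h0 : (α.1 0 : U m) = 1 := by rw [α.2 0 rfl]; rfl
  have e0 : (y.entry 0 : U m) = (α.1 1 : U m)⁻¹ * (x.entry 0 : U m) := by
    rw [hy, X.rho_g ρ (e := 0) (by decide)]
    change 1 * (α.1 1 : U m)⁻¹ * 1⁻¹ * (x.entry 0 : U m) * (α.1 0 : U m) = _
    rw [h0]; group
  have e1 : (y.entry 1 : U m) =
      (α.1 2 : U m)⁻¹ * (x.entry 1 : U m) * (α.1 1 : U m) := by
    rw [hy, X.rho_g ρ (e := 1) (by decide)]
    change 1 * (α.1 2 : U m)⁻¹ * 1⁻¹ * (x.entry 1 : U m) * (α.1 1 : U m) = _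
    group
  have e2 : (y.entry 2 : U m) =
      (α.1 3 : U m)⁻¹ * (x.entry 2 : U m) * (α.1 1 : U m) := by
    rw [hy, X.rho_g ρ (e := 2) (by decide)]
    change 1 * (α.1 3 : U m)⁻¹ * 1⁻¹ * (x.entry 2 : U m) * (α.1 1 : U m) = _
    group
  unfold OSGraph.gaugeOfM₀
  rw [e0, e1, e2]
  fin_cases i
  · exact h0.symm
  · change (x.entry 0 : U m) * ((α.1 1 : U m)⁻¹ * (x.entry 0 : U m))⁻¹ = α.1 1
    group
  · change (x.entry 1 : U m) * ((x.entry 0 : U m) * ((α.1 1 : U m)⁻¹ * (x.entry 0 : U m))⁻¹) *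
      ((α.1 2 : U m)⁻¹ * (x.entry 1 : U m) * (α.1 1 : U m))⁻¹ = α.1 2
    group
  · change (x.entry 2 : U m) * ((x.entry 0 : U m) * ((α.1 1 : U m)⁻¹ * (x.entry 0 : U m))⁻¹) *
      ((α.1 3 : U m)⁻¹ * (x.entry 2 : U m) * (α.1 1 : U m))⁻¹ = α.1 3
    group

theorem OSGraph.gaugeOfM_eq {x y : X.Moduli ρ edges023} (α : X.Gauge ρ {0, 2})
    (hy : ∀ i, (y.entry i : U m) = ρ (X.g (edges023 i)) * (α.1 (tgt (edges023 i)) : U m)⁻¹ *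
      (ρ (X.g (edges023 i)))⁻¹ * (x.entry i : U m) * (α.1 (src (edges023 i)) : U m)) (i : Fin 4) :
    X.gaugeOfM ρ x y i = α.1 i := by
  have h0 : (α.1 0 : U m) = 1 := by rw [α.2 0 (Or.inl rfl)]; rfl
  have h2 : (α.1 2 : U m) = 1 := by rw [α.2 2 (Or.inr rfl)]; rfl
  have e0 : (y.entry 0 : U m) = (α.1 1 : U m)⁻¹ * (x.entry 0 : U m) := by
    rw [hy, X.rho_g ρ (e := edges023 0) (by decide)]
    change 1 * (α.1 1 : U m)⁻¹ * 1⁻¹ * (x.entry 0 : U m) * (α.1 0 : U m) = _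
    rw [h0]; group
  have e1 : (y.entry 1 : U m) =
      (α.1 3 : U m)⁻¹ * (x.entry 1 : U m) * (α.1 1 : U m) := by
    rw [hy, X.rho_g ρ (e := edges023 1) (by decide)]
    change 1 * (α.1 3 : U m)⁻¹ * 1⁻¹ * (x.entry 1 : U m) * (α.1 1 : U m) = _
    group
  unfold OSGraph.gaugeOfM
  rw [e0, e1]
  fin_cases i
  · exact h0.symm
  · change (x.entry 0 : U m) * ((α.1 1 : U m)⁻¹ * (x.entry 0 : U m))⁻¹ = α.1 1
    group
  · exact h2.symm
  · change (x.entry 1 : U m) * ((x.entry 0 : U m) * ((α.1 1 : U m)⁻¹ * (x.entry 0 : U m))⁻¹) *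
      ((α.1 3 : U m)⁻¹ * (x.entry 1 : U m) * (α.1 1 : U m))⁻¹ = α.1 3
    group

end Spaces

/-! ### The two orbit spaces and the comparison of their maps. -/

section Quotients

open scoped Matrix.Norms.Operator

variable {F V E : Type*} [Field F] [MulAction SL(2, F) V] [MulAction SL(2, F) E]
  (X : OSGraph F V E) {m : ℕ} (ρ : SL(2, F) →* U m)

theorem OSGraph.continuous_entryU {ι : Type} [Fintype ι] (ε : ι → Fin 4) (i : ι) :
    Continuous fun x : X.Moduli ρ ε => (x.entry i : U m) :=
  Continuous.subtype_mk (X.continuous_entry ρ ε i) _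

theorem OSGraph.continuous_gaugeOfM₀ : Continuous (Function.uncurry (X.gaugeOfM₀ ρ)) := by
  have hx : ∀ i, Continuous fun p : X.M₀ ρ × X.M₀ ρ => (p.1.entry i : U m) :=
    fun i => (X.continuous_entryU ρ id i).comp continuous_fst
  have hy : ∀ i, Continuous fun p : X.M₀ ρ × X.M₀ ρ => (p.2.entry i : U m)⁻¹ :=
    fun i => ((X.continuous_entryU ρ id i).comp continuous_snd).inv
  refine continuous_pi fun i => ?_
  fin_cases i
  · exact continuous_const
  · exact (hx 0).mul (hy 0)
  · exact ((hx 1).mul ((hx 0).mul (hy 0))).mul (hy 1)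
  · exact ((hx 2).mul ((hx 0).mul (hy 0))).mul (hy 2)

theorem OSGraph.continuous_gaugeOfM : Continuous (Function.uncurry (X.gaugeOfM ρ)) := by
  have hx : ∀ i, Continuous fun p : X.Moduli ρ edges023 × X.Moduli ρ edges023 =>
      (p.1.entry i : U m) := fun i => (X.continuous_entryU ρ edges023 i).comp continuous_fst
  have hy : ∀ i, Continuous fun p : X.Moduli ρ edges023 × X.Moduli ρ edges023 =>
      (p.2.entry i : U m)⁻¹ := fun i => ((X.continuous_entryU ρ edges023 i).comp continuous_snd).inv
  refine continuous_pi fun i => ?_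
  fin_cases i
  · exact continuous_const
  · exact (hx 0).mul (hy 0)
  · exact continuous_const
  · exact ((hx 1).mul ((hx 0).mul (hy 0))).mul (hy 1)

theorem continuous_coe_tuple {Z : Type*} [TopologicalSpace Z] {f : Z → Fin 4 → U m}
    (hf : Continuous f) : Continuous fun z i => (f z i : Matrix (Fin m) (Fin m) ℂ) :=
  continuous_pi fun i => continuous_subtype_val.comp ((continuous_apply i).comp hf)

theorem OSGraph.M₀bar_isQuotientManifold {n : ℕ} (hn : n ≠ 0)
    (hdim : Module.finrank ℝ (commLie ρ (X.Gη 0)) + Module.finrank ℝ (commLie ρ (X.Gη 1)) +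
      Module.finrank ℝ (commLie ρ (X.Gη 2)) + Module.finrank ℝ (commLie ρ (X.Gη 3)) =
      n + (Module.finrank ℝ (commLie ρ (X.Gv 1)) + Module.finrank ℝ (commLie ρ (X.Gv 2)) +
        Module.finrank ℝ (commLie ρ (X.Gv 3)))) :
    ∃ _ : ChartedSpace (EuclideanSpace ℝ (Fin n)) (X.M₀bar ρ),
      IsQuotientManifold (X.coords ρ id) (X.proj ρ id {0}) n ∧
      ∃ A : Set (OpenPartialHomeomorph (X.M₀bar ρ) (EuclideanSpace ℝ (Fin n))),
        IsOrientedAtlas A := by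
  refine X.exists_isQuotientManifold ρ id {0} (fun x y i => (X.gaugeOfM₀ ρ x y i).1)
    (continuous_coe_tuple (X.continuous_gaugeOfM₀ ρ))
    (fun x α i => congrArg Subtype.val (X.gaugeOfM₀_eq ρ α (X.smul_apply ρ (MulOpposite.op α) x) i)) hn ?_
  rw [OSGraph.modLie, OSGraph.gaugeLie, finrank_submodule_pi, finrank_submodule_pi,
    Fin.sum_univ_four, Fin.sum_univ_four]
  simp only [id, hdim]
  rw [if_pos (show (0 : Fin 4) ∈ ({0} : Set (Fin 4)) by simp), if_neg (show (1 : Fin 4) ∉ ({0} : Set (Fin 4)) by simp),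
    if_neg (show (2 : Fin 4) ∉ ({0} : Set (Fin 4)) by simp),
    if_neg (show (3 : Fin 4) ∉ ({0} : Set (Fin 4)) by simp), finrank_bot, zero_add]

theorem OSGraph.MmodH_isQuotientManifold {n : ℕ} (hn : n ≠ 0)
    (hdim : Module.finrank ℝ (commLie ρ (X.Gη 0)) + Module.finrank ℝ (commLie ρ (X.Gη 2)) +
      Module.finrank ℝ (commLie ρ (X.Gη 3)) =
      n + (Module.finrank ℝ (commLie ρ (X.Gv 1)) + Module.finrank ℝ (commLie ρ (X.Gv 3)))) :
    ∃ _ : ChartedSpace (EuclideanSpace ℝ (Fin n)) (X.MmodH ρ),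
      IsQuotientManifold (X.coords ρ edges023) (X.proj ρ edges023 {0, 2}) n := by
  obtain ⟨C, h, -⟩ := X.exists_isQuotientManifold ρ edges023 {0, 2}
    (fun x y i => (X.gaugeOfM ρ x y i).1) (continuous_coe_tuple (X.continuous_gaugeOfM ρ))
    (fun x α i => congrArg Subtype.val (X.gaugeOfM_eq ρ α (X.smul_apply ρ (MulOpposite.op α) x) i)) hn (by
      rw [OSGraph.modLie, OSGraph.gaugeLie, finrank_submodule_pi, finrank_submodule_pi,
        Fin.sum_univ_three, Fin.sum_univ_four]
      rw [if_pos (show (0 : Fin 4) ∈ ({0, 2} : Set (Fin 4)) by simp),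
        if_neg (show (1 : Fin 4) ∉ ({0, 2} : Set (Fin 4)) by simp),
        if_pos (show (2 : Fin 4) ∈ ({0, 2} : Set (Fin 4)) by simp),
        if_neg (show (3 : Fin 4) ∉ ({0, 2} : Set (Fin 4)) by simp), finrank_bot, zero_add, add_zero, ← hdim]
      rfl)
  exact ⟨C, h⟩

/-! ### The map to the unitary group -/

/-- The projection of `𝓜₀` to `M` that forgets `τ₁`. -/
def OSGraph.forget (τ : X.M₀ ρ) : X.Moduli ρ edges023 := ⟨fun i => τ.entry (edges023 i)⟩

theorem OSGraph.Y₀bar_proj (τ : X.M₀ ρ) :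
    X.Y₀bar ρ (X.proj ρ id {0} τ) = X.Tbar ρ (X.proj ρ edges023 {0, 2} (X.forget ρ τ)) :=
  X.Y₀_eq τ

/-- The entry `τ₁` plays no role in the value, and `1` is an admissible choice for it when a point
of `M` is lifted to `𝓜₀`. -/
theorem OSGraph.range_Y₀bar : Set.range (X.Y₀bar ρ) = Set.range (X.Tbar ρ) := by
  apply subset_antisymm
  · rintro _ ⟨p, rfl⟩
    obtain ⟨τ, rfl⟩ := (X.isOpenQuotientMap_proj ρ id {0}).surjective p
    exact ⟨_, (X.Y₀bar_proj ρ τ).symm⟩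
  · rintro _ ⟨p, rfl⟩
    obtain ⟨τ, rfl⟩ := (X.isOpenQuotientMap_proj ρ edges023 {0, 2}).surjective p
    refine ⟨X.proj ρ id {0} ⟨Fin.cons (τ.entry 0) (Fin.cons 1 (Fin.cons (τ.entry 1)
      (Fin.cons (τ.entry 2) fun i => i.elim0)))⟩, ?_⟩
    rw [X.Y₀bar_proj]
    congr 2
    apply OSGraph.Moduli.ext
    funext i
    fin_cases i <;> rfl

/-- The formula for the map to the unitary group, on tuples of arrays. -/
def mapFormula (g : U m) (w : Fin 3 → Fin m → Fin m → ℂ) : Fin m → Fin m → ℂ := fun j k =>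
  (star (Matrix.of (w 0)) * star (Matrix.of (w 1)) * star (Matrix.of (w 2)) *
    (g : Matrix (Fin m) (Fin m) ℂ)) j k

/-- On unitary matrices the inverse is the adjoint. With adjoints the formula is real polynomial,
hence smooth on all arrays. -/
theorem contDiff_mapFormula (g : U m) : ContDiff ℝ ∞ (mapFormula g) := by
  have hstar : ∀ i : Fin 3, ContDiff ℝ ∞ fun w : Fin 3 → Fin m → Fin m → ℂ =>
      (star (Matrix.of (w i)) : Matrix (Fin m) (Fin m) ℂ) := by
    intro i
    let L : (Fin 3 → Fin m → Fin m → ℂ) →ₗ[ℝ] Matrix (Fin m) (Fin m) ℂ :=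
      { toFun := fun w => star (Matrix.of (w i))
        map_add' := fun x y => by ext; simp
        map_smul' := fun c x => by ext; simp }
    exact (LinearMap.toContinuousLinearMap L).contDiff
  have hmul := (((hstar 0).mul (hstar 1)).mul (hstar 2)).mul
    (contDiff_const (c := (g : Matrix (Fin m) (Fin m) ℂ)))
  let L : Matrix (Fin m) (Fin m) ℂ →ₗ[ℝ] (Fin m → Fin m → ℂ) :=
    { toFun := fun x j k => x j k, map_add' := fun _ _ => rfl, map_smul' := fun _ _ => rfl }
  exact (LinearMap.toContinuousLinearMap L).contDiff.comp hmul

theorem OSGraph.coords_Tbar (τ : X.Moduli ρ edges023) :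
    U.coords (X.Tbar ρ (X.proj ρ edges023 {0, 2} τ)) =
      mapFormula (ρ (X.g 3)) (X.coords ρ edges023 τ) := rfl

end Quotients

/-! ### Smooth maps to the unitary group: smoothness, rank and image. -/

section Maps

variable {S Q W : Type*} [NormedAddCommGroup W] [NormedSpace ℝ W] {c : S → W} {π : S → Q} {n m : ℕ}
  [TopologicalSpace Q] [ChartedSpace (EuclideanSpace ℝ (Fin n)) Q]

/-- A map on a quotient manifold that is smooth upstairs is smooth. -/
theorem IsQuotientManifold.smoothToU (h : IsQuotientManifold c π n) (hπ : Function.Surjective π)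
    {f : Q → U m} {g : W → Fin m → Fin m → ℂ} (hg : ContDiff ℝ ∞ g)
    (hfg : ∀ x, U.coords (f (π x)) = g (c x)) : SmoothToU n f := by
  intro p
  obtain ⟨x, rfl⟩ := hπ p
  obtain ⟨O, hO, hx, s, -, hs2, hs3⟩ := h.smooth_section x
  have h1 : ContMDiffOn (𝓡 n) 𝓘(ℝ, Fin m → Fin m → ℂ) ∞ (fun p => g (c (s p))) O :=
    hg.contMDiff.comp_contMDiffOn hs3
  refine (h1.contMDiffAt (hO.mem_nhds hx)).congr_of_eventuallyEq ?_
  filter_upwards [hO.mem_nhds hx] with p hp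
  rw [← hfg, hs2 p hp]

/-- A map that factors locally through a manifold of smaller dimension has no regular points. -/
theorem not_hasDerivIso {Q' : Type*} {d : ℕ} [TopologicalSpace Q']
    [ChartedSpace (EuclideanSpace ℝ (Fin d)) Q'] [IsManifold (𝓡 n) ∞ Q] (hdn : d < n) {f : Q → U m}
    {f' : Q' → U m} (hf' : SmoothToU d f') {θ : Q → Q'} {p : Q}
    (hθ : ContMDiffAt (𝓡 n) (𝓡 d) ∞ θ p) (hfθ : ∀ᶠ x in nhds p, f x = f' (θ x))
    {φ : OpenPartialHomeomorph Q (EuclideanSpace ℝ (Fin n))}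
    (hφ : φ ∈ IsManifold.maximalAtlas (𝓡 n) ∞ Q) (hp : p ∈ φ.source)
    (L : EuclideanSpace ℝ (Fin n) ≃ₗ[ℝ] LieU m) : ¬ HasDerivIso f φ p L := by
  intro hL
  have hφp : φ p ∈ φ.target := φ.map_source hp
  have h1 : ContMDiffAt (𝓡 n) (𝓡 n) ∞ φ.symm (φ p) :=
    (contMDiffOn_symm_of_mem_maximalAtlas hφ).contMDiffAt (φ.open_target.mem_nhds hφp)
  have h2 : ContMDiffAt (𝓡 n) (𝓡 d) ∞ (fun x => θ (φ.symm x)) (φ p) := by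
    refine ContMDiffAt.comp (φ p) (g := θ) (f := φ.symm) ?_ h1
    rwa [φ.left_inv hp]
  have h3 : MDifferentiableAt (𝓡 n) (𝓡 d) (fun x => θ (φ.symm x)) (φ p) :=
    h2.mdifferentiableAt (by simp)
  have h4 : MDifferentiableAt (𝓡 d) 𝓘(ℝ, Fin m → Fin m → ℂ) (fun p => U.coords (f' p))
      (θ (φ.symm (φ p))) := (hf' _).mdifferentiableAt (by simp)
  have h5 : fderiv ℝ (fun x => U.coords (f (φ.symm x))) (φ p) =
      (mfderiv (𝓡 d) 𝓘(ℝ, Fin m → Fin m → ℂ) (fun p => U.coords (f' p)) (θ (φ.symm (φ p)))).comp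
        (mfderiv (𝓡 n) (𝓡 d) (fun x => θ (φ.symm x)) (φ p)) := by
    rw [← mfderiv_comp (φ p) h4 h3, ← mfderiv_eq_fderiv]
    refine Filter.EventuallyEq.mfderiv_eq ?_
    have hc : Filter.Tendsto φ.symm (nhds (φ p)) (nhds p) := by
      have := (φ.continuousAt_symm hφp).tendsto
      rwa [φ.left_inv hp] at this
    filter_upwards [hc.eventually hfθ] with x hx
    simp only [Function.comp, hx]
  -- The differential `v ↦ f(p) L(v)` is injective because `f(p)` is invertible. But by `h5` it
  -- factors through a space of dimension `d < n`.
  have h6 : Function.Injective (fderiv ℝ (fun x => U.coords (f (φ.symm x))) (φ p)) := by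
    rw [injective_iff_map_eq_zero]
    intro v hv
    rw [hL v] at hv
    have h7 : (f p : Matrix (Fin m) (Fin m) ℂ) * (L v : Matrix (Fin m) (Fin m) ℂ) = 0 :=
      Matrix.ext fun j k => congrFun (congrFun hv j) k
    have h8 : (L v : Matrix (Fin m) (Fin m) ℂ) = 0 := by
      rw [← one_mul (L v : Matrix (Fin m) (Fin m) ℂ), ← (f p).2.1, mul_assoc, h7, mul_zero]
    exact (map_eq_zero_iff L L.injective).1 (Subtype.ext h8)
  have h9 : Function.Injective (mfderiv (𝓡 n) (𝓡 d) (fun x => θ (φ.symm x)) (φ p)) := by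
    rw [h5] at h6
    exact Function.Injective.of_comp h6
  let D : EuclideanSpace ℝ (Fin n) →L[ℝ] EuclideanSpace ℝ (Fin d) :=
    mfderiv (𝓡 n) (𝓡 d) (fun x => θ (φ.symm x)) (φ p)
  have h10 := LinearMap.finrank_le_finrank_of_injective (f := (D : EuclideanSpace ℝ (Fin n) →ₗ[ℝ] EuclideanSpace ℝ (Fin d))) h9
  rw [finrank_euclideanSpace_fin, finrank_euclideanSpace_fin] at h10
  omega

/-- The degree of a map that has no regular points and is not surjective is zero. -/
theorem hasDegree_zero {A : Set (OpenPartialHomeomorph Q (EuclideanSpace ℝ (Fin n)))}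
    (o : Orientation ℝ (LieU m) (Fin n)) {f : Q → U m} (hf : ¬ Function.Surjective f)
    (hreg : ∀ p, ¬ IsRegularPoint A f p) : HasDegree A o f 0 := by
  constructor
  · rw [Function.Surjective] at hf
    push Not at hf
    obtain ⟨y, hy⟩ := hf
    exact ⟨y, fun p hp => absurd hp (hy p)⟩
  · intro y hy
    have : f ⁻¹' {y} = ∅ := by
      ext p
      simp only [Set.mem_preimage, Set.mem_singleton_iff, Set.mem_empty_iff_false, iff_false]
      exact fun hp => hreg p (hy p hp)
    rw [this]
    simp

open scoped Matrix.Norms.Operator in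
/-- A smooth map from a manifold of smaller dimension to the unitary group is not surjective. -/
theorem SmoothToU.not_surjective [SecondCountableTopology Q] [IsManifold (𝓡 n) ∞ Q]
    {f : Q → U m} (hf : SmoothToU n f) (hn : n < dimU m) : ¬ Function.Surjective f := by
  intro hsurj
  let e : LieU m ≃ₗ[ℝ] EuclideanSpace ℝ (Fin (dimU m)) :=
    LinearEquiv.ofFinrankEq _ _ (by rw [finrank_euclideanSpace_fin, dimU])
  let pr : Matrix (Fin m) (Fin m) ℂ →L[ℝ] EuclideanSpace ℝ (Fin (dimU m)) :=
    LinearMap.toContinuousLinearMap (e.toLinearMap ∘ₗ skewAdjointPart ℝ)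
  let L : (Fin m → Fin m → ℂ) →L[ℝ] Matrix (Fin m) (Fin m) ℂ :=
    LinearMap.toContinuousLinearMap
      { toFun := fun x => Matrix.of x, map_add' := fun _ _ => rfl, map_smul' := fun _ _ => rfl }
  -- The map in the Cayley chart of `U(m)`, meaningful on the set `O`. The chart maps onto the whole
  -- Lie algebra, so surjectivity of `f` gives a smooth surjection of `O` onto a Euclidean space of
  -- larger dimension.
  let K : Q → EuclideanSpace ℝ (Fin (dimU m)) := fun p => pr (cayInv (L (U.coords (f p))))
  let O : Set Q := {p | IsUnit (L (U.coords (f p)) + 1)}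
  have hK : ∀ p ∈ O, ContMDiffAt (𝓡 n) 𝓘(ℝ, EuclideanSpace ℝ (Fin (dimU m))) ∞ K p := by
    intro p hp
    have h1 : ContDiffAt ℝ ∞ (fun x => pr (cayInv (L x))) (U.coords (f p)) :=
      pr.contDiff.contDiffAt.comp _ ((contDiffAt_cayInv hp).comp _ L.contDiff.contDiffAt)
    exact ContMDiffAt.comp (g := fun x => pr (cayInv (L x))) (f := fun p => U.coords (f p)) p
      h1.contMDiffAt (hf p)
  have hrange : K '' O = Set.univ := by
    rw [Set.eq_univ_iff_forall]
    intro y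
    set x := e.symm y with hxy
    have hx : star (x : Matrix (Fin m) (Fin m) ℂ) = -x := x.2
    have h1 := isUnit_one_sub_of_skew hx
    obtain ⟨u, hu, hu1, -⟩ := (isCayley_unitsCentralizer (1 : Unit →* U m) ⊥).exists_cay
      (x := (x : Matrix (Fin m) (Fin m) ℂ)) ((mem_commLie _).2 ⟨hx, fun k _ => by simp [mat]⟩)
    obtain ⟨p, hp⟩ := hsurj ⟨u, ((mem_unitsCentralizer _).1 hu).1⟩
    have hp' : L (U.coords (f p)) = cay (x : Matrix (Fin m) (Fin m) ℂ) := by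
      rw [hp]; exact hu1
    refine ⟨p, ?_, ?_⟩
    · change IsUnit (L (U.coords (f p)) + 1)
      rw [hp']
      exact isUnit_cay_add_one h1
    · change e (skewAdjointPart ℝ (cayInv (L (U.coords (f p))))) = y
      rw [hp', cayInv_cay h1]
      have h2 : (skewAdjointPart ℝ (x : Matrix (Fin m) (Fin m) ℂ) : LieU m) = x := by
        apply Subtype.ext
        change (skewAdjointPart ℝ (x : Matrix (Fin m) (Fin m) ℂ)).1 = x
        rw [skewAdjointPart_apply_coe, hx, sub_neg_eq_add, ← two_smul ℝ, smul_smul]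
        simp
      exact (congrArg e h2).trans (e.apply_symm_apply y)
  -- On each chart domain `K` is locally Lipschitz in the coordinates, so it does not raise
  -- Hausdorff dimension. Countably many chart domains suffice, and a countable union has the
  -- supremum of the dimensions.
  have hloc : ∀ q : Q, dimH (K '' (O ∩ (chartAt (EuclideanSpace ℝ (Fin n)) q).source)) ≤ n := by
    intro q
    set φ := chartAt (EuclideanSpace ℝ (Fin n)) q with hφ
    have hφm : φ ∈ IsManifold.maximalAtlas (𝓡 n) ∞ Q := IsManifold.chart_mem_maximalAtlas q
    have himg : K '' (O ∩ φ.source) ⊆ (fun x => K (φ.symm x)) '' (φ.target ∩ φ.symm ⁻¹' O) := by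
      rintro _ ⟨p, ⟨hp, hp'⟩, rfl⟩
      exact ⟨φ p, ⟨φ.map_source hp', by rw [Set.mem_preimage, φ.left_inv hp']; exact hp⟩,
        by simp only [φ.left_inv hp']⟩
    refine (dimH_mono himg).trans ((dimH_image_le_of_locally_lipschitzOn fun x hx => ?_).trans
      ((dimH_mono (Set.subset_univ _)).trans ?_))
    · have h1 : ContMDiffAt (𝓡 n) (𝓡 n) ∞ φ.symm x :=
        (contMDiffOn_symm_of_mem_maximalAtlas hφm).contMDiffAt (φ.open_target.mem_nhds hx.1)
      have h2 : ContMDiffAt (𝓡 n) 𝓘(ℝ, EuclideanSpace ℝ (Fin (dimU m))) ∞ (fun x => K (φ.symm x)) x := (hK _ hx.2).comp x h1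
      obtain ⟨C, t, ht, hC⟩ := ((contMDiffAt_iff_contDiffAt.1 h2).of_le
        (m := 1) (by simp)).exists_lipschitzOnWith
      exact ⟨C, t, mem_nhdsWithin_of_mem_nhds ht, hC⟩
    · rw [Real.dimH_univ_eq_finrank, finrank_euclideanSpace_fin]
  obtain ⟨s, hs, hs'⟩ := TopologicalSpace.countable_cover_nhds
    (fun q : Q => chart_source_mem_nhds (EuclideanSpace ℝ (Fin n)) q)
  have hcov : (Set.univ : Set (EuclideanSpace ℝ (Fin (dimU m)))) ⊆
      ⋃ q ∈ s, K '' (O ∩ (chartAt (EuclideanSpace ℝ (Fin n)) q).source) := by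
    rw [← hrange]
    rintro _ ⟨p, hp, rfl⟩
    have : p ∈ ⋃ q ∈ s, (chartAt (EuclideanSpace ℝ (Fin n)) q).source := by rw [hs']; trivial
    obtain ⟨q, hq, hpq⟩ := Set.mem_iUnion₂.1 this
    exact Set.mem_iUnion₂.2 ⟨q, hq, p, ⟨hp, hpq⟩, rfl⟩
  have h1 := dimH_mono hcov
  rw [Real.dimH_univ_eq_finrank, finrank_euclideanSpace_fin, dimH_bUnion hs] at h1
  have h2 := h1.trans (iSup₂_le fun q _ => hloc q)
  have h3 : dimU m ≤ n := by exact_mod_cast h2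
  omega

end Maps

/-! ### The main results -/

section Results

variable {F V E : Type*} [Field F] [MulAction SL(2, F) V] [MulAction SL(2, F) E]
  (X : OSGraph F V E) {m : ℕ} (ρ : SL(2, F) →* U m)

theorem OSGraph.smoothToU_Tbar {d : ℕ} [ChartedSpace (EuclideanSpace ℝ (Fin d)) (X.MmodH ρ)]
    (h : IsQuotientManifold (X.coords ρ edges023) (X.proj ρ edges023 {0, 2}) d) :
    SmoothToU d (X.Tbar ρ) :=
  h.smoothToU (X.isOpenQuotientMap_proj ρ edges023 {0, 2}).surjective
    (contDiff_mapFormula (ρ (X.g 3))) fun x => X.coords_Tbar ρ x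

/-- The restriction of tuples indexed by the four edges. -/
def restrict023 (m : ℕ) : (Fin 4 → Fin m → Fin m → ℂ) →L[ℝ] (Fin 3 → Fin m → Fin m → ℂ) :=
  ContinuousLinearMap.pi fun i => ContinuousLinearMap.proj (edges023 i)

theorem OSGraph.smoothToU_Y₀bar {n : ℕ} [ChartedSpace (EuclideanSpace ℝ (Fin n)) (X.M₀bar ρ)]
    (h : IsQuotientManifold (X.coords ρ id) (X.proj ρ id {0}) n) : SmoothToU n (X.Y₀bar ρ) :=
  h.smoothToU (X.isOpenQuotientMap_proj ρ id {0}).surjective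
    ((contDiff_mapFormula (ρ (X.g 3))).comp (restrict023 m).contDiff) fun x => by
      rw [X.Y₀bar_proj, X.coords_Tbar]; rfl

/-- Near `p`, lift to `𝓜₀` by a smooth section, forget `τ₁`, and project to `M/H`. This smooth `θ`
satisfies `Ȳ₀ = Tbar ∘ θ`, so the rank of `Ȳ₀` at `p` is at most `d`. -/
theorem OSGraph.not_isRegularPoint {n d : ℕ} (hdn : d < n)
    [ChartedSpace (EuclideanSpace ℝ (Fin n)) (X.M₀bar ρ)]
    [ChartedSpace (EuclideanSpace ℝ (Fin d)) (X.MmodH ρ)]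
    (h : IsQuotientManifold (X.coords ρ id) (X.proj ρ id {0}) n)
    (h' : IsQuotientManifold (X.coords ρ edges023) (X.proj ρ edges023 {0, 2}) d)
    {A : Set (OpenPartialHomeomorph (X.M₀bar ρ) (EuclideanSpace ℝ (Fin n)))}
    (hA : A ⊆ IsManifold.maximalAtlas (𝓡 n) ∞ (X.M₀bar ρ)) (p : X.M₀bar ρ) :
    ¬ IsRegularPoint A (X.Y₀bar ρ) p := by
  rintro ⟨φ, hφ, hp, L, hL⟩
  have := h.isManifold
  obtain ⟨τ, rfl⟩ := (X.isOpenQuotientMap_proj ρ id {0}).surjective p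
  obtain ⟨O, hO, hτO, s, hsτ, hs, hsO⟩ := h.smooth_section τ
  obtain ⟨O', hO', hτO', f, hf, hf'⟩ := h'.smooth_proj (X.forget ρ τ)
  have hsm : ContMDiffAt (𝓡 n) 𝓘(ℝ, Fin 3 → Fin m → Fin m → ℂ) ∞
      (fun p => restrict023 m (X.coords ρ id (s p))) (X.proj ρ id {0} τ) :=
    (restrict023 m).contDiff.contMDiff.contMDiffAt.comp _ (hsO.contMDiffAt (hO.mem_nhds hτO))
  have hmem : restrict023 m (X.coords ρ id (s (X.proj ρ id {0} τ))) ∈ O' := by rw [hsτ]; exact hτO'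
  refine not_hasDerivIso hdn (X.smoothToU_Tbar ρ h') (θ := fun p => f (restrict023 m (X.coords ρ id (s p))))
    ?_ ?_ (hA hφ) hp L hL
  · exact (hf.contMDiffAt (hO'.mem_nhds hmem)).comp (X.proj ρ id {0} τ) hsm
  · filter_upwards [hO.mem_nhds hτO, hsm.continuousAt.preimage_mem_nhds (hO'.mem_nhds hmem)] with p hp hp'
    have h1 := hf' (X.forget ρ (s p)) hp'
    change f (restrict023 m (X.coords ρ id (s p))) = _ at h1
    rw [h1, ← X.Y₀bar_proj, hs p hp]

end Results

end OliverSegev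

end

open OliverSegev in
theorem mainTheorem3 {F V E : Type*} [Field F] [Finite F]
    [MulAction SL(2, F) V] [MulAction SL(2, F) E]
    (q : ℕ) (hq : Nat.card F = q) (hq13 : q ≡ 13 [MOD 24])
    (X : OSGraph F V E)
    (ρ : SL(2, F) →* U ((q - 1) / 2)) (hρ : (linearRep ρ).IsIrreducible) :
    (∃ _ : ChartedSpace (EuclideanSpace ℝ (Fin (dimU ((q - 1) / 2)))) (X.M₀bar ρ),
      IsQuotientManifold (X.coords ρ id) (X.proj ρ id {0}) (dimU ((q - 1) / 2)) ∧
      ∃ A : Set (OpenPartialHomeomorph (X.M₀bar ρ)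
        (EuclideanSpace ℝ (Fin (dimU ((q - 1) / 2))))), IsOrientedAtlas A) ∧
    (∀ _ : ChartedSpace (EuclideanSpace ℝ (Fin (dimU ((q - 1) / 2)))) (X.M₀bar ρ),
      IsQuotientManifold (X.coords ρ id) (X.proj ρ id {0}) (dimU ((q - 1) / 2)) →
      SmoothToU (dimU ((q - 1) / 2)) (X.Y₀bar ρ) ∧
      ∀ A : Set (OpenPartialHomeomorph (X.M₀bar ρ)
        (EuclideanSpace ℝ (Fin (dimU ((q - 1) / 2))))), IsOrientedAtlas A →
      ∀ o : Orientation ℝ (LieU ((q - 1) / 2)) (Fin (dimU ((q - 1) / 2))),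
        HasDegree A o (X.Y₀bar ρ) 0) ∧
    (∃ d : ℕ,
      (d : ℝ) = dimU ((q - 1) / 2) - ((q : ℝ) - 1) ^ 2 / 8 + ((q : ℝ) - 1) / 4 ∧
      d < dimU ((q - 1) / 2) ∧
      ∃ _ : ChartedSpace (EuclideanSpace ℝ (Fin d)) (X.MmodH ρ),
        IsQuotientManifold (X.coords ρ edges023) (X.proj ρ edges023 {0, 2}) d ∧
        SmoothToU d (X.Tbar ρ) ∧
        Set.range (X.Y₀bar ρ) = Set.range (X.Tbar ρ)) ∧
    ¬ Function.Surjective (X.Y₀bar ρ) := by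
  obtain ⟨k, hk, hqk, hm, h0, h1, h2, h3, hv1, hv2, hv3⟩ := X.exists_finrank hq hq13 rfl ρ hρ
  have hdim : dimU ((q - 1) / 2) = 36 * k ^ 2 := by rw [dimU_eq, hm]; ring
  have hn : dimU ((q - 1) / 2) ≠ 0 := by
    rw [hdim]; positivity
  have hd : 18 * k ^ 2 + 3 * k < dimU ((q - 1) / 2) := by
    rw [hdim]; nlinarith
  -- The dimension is `(6k + 9k² + 12k²) - (3k + 3k²)`.
  obtain ⟨C', hM⟩ := X.MmodH_isQuotientManifold ρ (n := 18 * k ^ 2 + 3 * k) (by positivity)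
    (by rw [h0, h2, h3, hv1, hv3]; ring)
  have hsurj : ¬ Function.Surjective (X.Y₀bar ρ) := by
    rw [← Set.range_eq_univ, X.range_Y₀bar, Set.range_eq_univ]
    have := hM.secondCountable
    have := hM.isManifold
    exact (X.smoothToU_Tbar ρ hM).not_surjective hd
  -- Edges minus vertices: `(6k + 18k² + 9k² + 12k²) - (3k + 3k + 3k²) = 36k² = m²`, the dimension
  -- of `U(m)`.
  refine ⟨X.M₀bar_isQuotientManifold ρ hn (by rw [h0, h1, h2, h3, hv1, hv2, hv3, hdim]; ring),
    fun _ h => ⟨X.smoothToU_Y₀bar ρ h, fun A hA o => ?_⟩, ⟨_, ?_, hd, C', hM,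
    X.smoothToU_Tbar ρ hM, X.range_Y₀bar ρ⟩, hsurj⟩
  · exact hasDegree_zero o hsurj fun p => X.not_isRegularPoint ρ hd h hM hA.subset p
  · rw [hdim, hqk]
    push_cast
    ring
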